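/- Conventions. Let $\mathcal H=\bigotimes_{i=1}^n\mathbb C^{d_i}$. A vector $\psi\neq0$ in $\mathcal H$ represents the pure state $|\psi\rangle\langle\psi|/\langle\psi|\psi\rangle$; it is fully entangled if each one-party reduced density matrix has full rank $d_i$. Its stabilizer is $\mathcal S_\psi=\{S=\bigotimes_iS^{(i)}: S^{(i)}\in GL(d_i,\mathbb C),\ S\psi=\psi\}$. A map $\Lambda(X)=\sum_kK_kXK_k^\dagger$ (finite sum) with $\sum_kK_k^\dagger K_k=\mathbb 1$ is in SEP if it has such a decomposition with all $K_k=\bigotimes_iK_k^{(i)}$, and in SEP$_1$ if moreover all $K_k^{(i)}$ can be chosen invertible. In an LOCC protocol, in each round one party, depending on all previous outcomes, performs a generalized measurement with finitely many outcomes and announces its outcome, and the other parties apply local unitaries. Let $\Lambda_m$ be the map implemented by the first $m$ rounds. The maps $\Lambda_m$ form LOCC$_{\mathbb N}$; LOCC consists of LOCC$_{\mathbb N}$ and of all limits $\lim_{m\to\infty}\Lambda_m$ for a protocol with infinitely many rounds. A state $\psi$ is convertible into $\varphi$ via SEP, SEP$_1$ or LOCC$_{\mathbb N}$ if a map of the class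 sends the state of $\psi$ to that of $\varphi$; via LOCC if this holds for LOCC$_{\mathbb N}$ or if there is an infinite protocol for which the images of the state of $\psi$ under $\Lambda_m$ converge to the state of $\varphi$. For such classes (with $n\ge1$ and all $d_i$ arbitrary), $X\subseteq_TY$ means that every conversion between fully entangled pure states possible via $X$ is possible via $Y$; $X\subsetneq_TY$ means that $X\subset Y$ as classes of maps and that some conversion between fully entangled pure states is possible via $Y$ but not via $X$. Three qutrits. Let $$\psi(a,b,c)=a(|000\rangle+|111\rangle+|222\rangle)+b(|012\rangle+|120\rangle+|201\rangle)+c(|021\rangle+|102\rangle+|210\rangle),$$ where $a,b,c\in\mathbb C$ are generic in the sense that (i) $abc\ne0$; (ii) $(a^3+b^3+c^3)^3\neq(3abc)^3$; (iii) $a^3,b^3,c^3$ are pairwise distinct; and (iv) the equations $a^6+b^6+c^6=10(a^3b^3+b^3c^3+c^3a^3)$ and $(a^3+b^3+c^3)\big((a^3+b^3+c^3)^3+(6abc)^3\big)=0$ do not both hold. Let $X|j\rangle=|j+1 \bmod 3\rangle$, $Z|j\rangle=e^{2\pi ij/3}|j\rangle$, and $W_p=X^{p_1}Z^{p_2}$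 for $p\in(\mathbb Z/3)^2$. Let $p^{(1)},\dots,p^{(4)}\in(\mathbb Z/3)^2$ be pairwise linearly independent, let $z_1,\dots,z_4\in\mathbb C\setminus\{0\}$, and let $h_1,h_2\in GL(3,\mathbb C)$ satisfy $$h_1^\dagger h_1=\mathbb 1+\sum_{j=1,2}\big(z_jW_{p^{(j)}}+\bar z_jW_{p^{(j)}}^\dagger\big),\qquad h_2^\dagger h_2=\mathbb 1+\sum_{j=3,4}\big(z_jW_{p^{(j)}}+\bar z_jW_{p^{(j)}}^\dagger\big).$$ Put $h=h_1\otimes h_2\otimes\mathbb 1$. Theorem. Generic parameters $(a,b,c)$ and pairs $(h_1,h_2)$ as above exist, and for all of them, with $\psi=\psi(a,b,c)$: 1. $\mathcal S_\psi=\{W_p\otimes W_p\otimes W_p: p\in(\mathbb Z/3)^2\}$; it has exactly nine elements, all unitary. 2. $\psi$ and $h\psi$ are fully entangled, and $\psi$ can be converted into $h\psi$ via SEP$_1$, hence via SEP. 3. $\psi$ cannot be converted into $h\psi$ via LOCC, not even with infinitely many rounds. Consequently SEP$_1\not\subseteq_T$ LOCC and LOCC $\subsetneq_T$ SEP. -/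

import Mathlib

open scoped Matrix

noncomputable section

/-- Basis labels of `⨂ i, ℂ^(d i)`. -/
abbrev Idx {n : ℕ} (d : Fin n → ℕ) : Type := ∀ i : Fin n, Fin (d i)

/-- Vectors of `⨂ i, ℂ^(d i)`, by their coordinates in the product basis. -/
abbrev StateVec {n : ℕ} (d : Fin n → ℕ) : Type := Idx d → ℂ

/-- Operators on `⨂ i, ℂ^(d i)`. -/
abbrev Op {n : ℕ} (d : Fin n → ℕ) : Type := Matrix (Idx d) (Idx d) ℂ

/-- A tuple of one-party operators, party `i` acting on `ℂ^(d i)`. -/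
abbrev LocalOps {n : ℕ} (d : Fin n → ℕ) : Type :=
  ∀ i : Fin n, Matrix (Fin (d i)) (Fin (d i)) ℂ

/-- The tensor product `K 0 ⊗ K 1 ⊗ ⋯`. -/
def tensorOp {n : ℕ} {d : Fin n → ℕ} (K : LocalOps d) : Op d :=
  fun x y => ∏ i, K i (x i) (y i)

/-- The density operator `|ψ⟩⟨ψ| / ⟨ψ|ψ⟩` of the normalized state along `ψ ≠ 0`. -/
def density {n : ℕ} {d : Fin n → ℕ} (ψ : StateVec d) : Op d :=
  (∑ x, ψ x * star (ψ x))⁻¹ • Matrix.vecMulVec ψ (star ψ)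

/-- The (unnormalized) reduced density matrix of party `i`:
all other parties are traced out of `|ψ⟩⟨ψ|`. -/
def reducedDensity {n : ℕ} {d : Fin n → ℕ} (ψ : StateVec d) (i : Fin n) :
    Matrix (Fin (d i)) (Fin (d i)) ℂ :=
  fun s t => ∑ x : Idx d, if x i = s then ψ x * star (ψ (Function.update x i t)) else 0

/-- Every one-party reduced density matrix has full rank. -/
def FullyEntangled {n : ℕ} {d : Fin n → ℕ} (ψ : StateVec d) : Prop :=
  ψ ≠ 0 ∧ ∀ i, (reducedDensity ψ i).rank = d i

/-- The local invertible operators `S` with `S ψ = ψ`. -/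
def stabilizer {n : ℕ} {d : Fin n → ℕ} (ψ : StateVec d) : Set (Op d) :=
  {S | ∃ K : LocalOps d, (∀ i, IsUnit (K i)) ∧ S = tensorOp K ∧ S *ᵥ ψ = ψ}

/-! ### Separable maps -/

/-- Separable maps: completely positive trace-preserving maps with a (finite) Kraus
decomposition all of whose Kraus operators are tensor products. -/
def IsSEP {n : ℕ} (d : Fin n → ℕ) (Λ : Op d → Op d) : Prop :=
  ∃ (r : ℕ) (K : Fin r → LocalOps d),
    ∑ k, (tensorOp (K k))ᴴ * tensorOp (K k) = 1 ∧
    ∀ X, Λ X = ∑ k, tensorOp (K k) * X * (tensorOp (K k))ᴴ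

/-- Separable maps with a product Kraus decomposition consisting of invertible operators. -/
def IsSEP₁ {n : ℕ} (d : Fin n → ℕ) (Λ : Op d → Op d) : Prop :=
  ∃ (r : ℕ) (K : Fin r → LocalOps d),
    (∀ k i, IsUnit (K k i)) ∧
    ∑ k, (tensorOp (K k))ᴴ * tensorOp (K k) = 1 ∧
    ∀ X, Λ X = ∑ k, tensorOp (K k) * X * (tensorOp (K k))ᴴ

/-! ### Local operations and classical communication -/

/-- An LOCC protocol with an unbounded number of rounds. A history is the list of the outcomes
obtained so far, the most recent one first. After the history `t`, party `party t` performs a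
generalized measurement with outcomes `0, …, outcomes t - 1`; it broadcasts its outcome `k`, and
the other parties apply local unitaries. `op t k i` is what party `i` applies. -/
structure Protocol {n : ℕ} (d : Fin n → ℕ) where
  party : List ℕ → Fin n
  outcomes : List ℕ → ℕ
  op : List ℕ → ℕ → LocalOps d
  isUnitary : ∀ t, ∀ k < outcomes t, ∀ i, i ≠ party t →
    op t k i ∈ Matrix.unitaryGroup (Fin (d i)) ℂ
  complete : ∀ t,
    ∑ k ∈ Finset.range (outcomes t), (op t k (party t))ᴴ * op t k (party t) = 1

/-- The possible histories after `m` rounds. -/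
def Protocol.histories {n : ℕ} {d : Fin n → ℕ} (P : Protocol d) : ℕ → Finset (List ℕ)
  | 0 => {[]}
  | m + 1 => (P.histories m).biUnion fun t =>
      (Finset.range (P.outcomes t)).image fun k => k :: t

/-- The Kraus operator belonging to a history: the product of the operators of the rounds,
later rounds to the left. -/
def Protocol.kraus {n : ℕ} {d : Fin n → ℕ} (P : Protocol d) : List ℕ → Op d
  | [] => 1
  | k :: t => tensorOp (P.op t k) * P.kraus t

/-- The map implemented by the first `m` rounds. The maps for `m` and `m + 1` rounds are
composable: the Kraus operators of the latter are those of the former, followed by one round. -/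
def Protocol.map {n : ℕ} {d : Fin n → ℕ} (P : Protocol d) (m : ℕ) (X : Op d) : Op d :=
  ∑ t ∈ P.histories m, P.kraus t * X * (P.kraus t)ᴴ

/-- Maps implemented by finitely many rounds. -/
def IsLOCCN {n : ℕ} (d : Fin n → ℕ) (Λ : Op d → Op d) : Prop :=
  ∃ (P : Protocol d) (m : ℕ), ∀ X, Λ X = P.map m X

/-- LOCC maps: those implemented by finitely many rounds, and the limits of the maps implemented
by the first `m` rounds of a protocol as `m → ∞`. -/
def IsLOCC {n : ℕ} (d : Fin n → ℕ) (Λ : Op d → Op d) : Prop :=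
  IsLOCCN d Λ ∨
    ∃ P : Protocol d, ∀ X, Filter.Tendsto (fun m => P.map m X) Filter.atTop (nhds (Λ X))

/-! ### Convertibility of pure states -/

/-- `ψ` can be converted into `φ` by a separable map. -/
def ConvSEP {n : ℕ} (d : Fin n → ℕ) (ψ φ : StateVec d) : Prop :=
  ∃ Λ : Op d → Op d, IsSEP d Λ ∧ Λ (density ψ) = density φ

/-- `ψ` can be converted into `φ` by a separable map with invertible Kraus operators. -/
def ConvSEP₁ {n : ℕ} (d : Fin n → ℕ) (ψ φ : StateVec d) : Prop :=
  ∃ Λ : Op d → Op d, IsSEP₁ d Λ ∧ Λ (density ψ) = density φ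

/-- `ψ` can be converted into `φ` by LOCC, either in finitely many rounds or by a protocol with
infinitely many rounds, whose output only has to converge to `φ`. -/
def ConvLOCC {n : ℕ} (d : Fin n → ℕ) (ψ φ : StateVec d) : Prop :=
  (∃ Λ : Op d → Op d, IsLOCCN d Λ ∧ Λ (density ψ) = density φ) ∨
    ∃ P : Protocol d,
      Filter.Tendsto (fun m => P.map m (density ψ)) Filter.atTop (nhds (density φ))

/-- A class of maps, for every number of parties and all local dimensions. -/
abbrev MapClass : Type := ∀ {n : ℕ} (d : Fin n → ℕ), (Op d → Op d) → Prop

/-- A convertibility relation, for every number of parties and all local dimensions. -/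
abbrev ConvRel : Type := ∀ {n : ℕ} (d : Fin n → ℕ), StateVec d → StateVec d → Prop

/-- `X ⊆_T Y`: every transformation among pure fully entangled states that is possible via `X`
is possible via `Y`. -/
def SubsetT (X Y : ConvRel) : Prop :=
  ∀ (n : ℕ) (d : Fin n → ℕ), 0 < n → ∀ ψ φ : StateVec d,
    FullyEntangled ψ → FullyEntangled φ → X d ψ φ → Y d ψ φ

/-- `X ⊊_T Y`: every map of the class `X` belongs to `Y`, and some transformation among pure
fully entangled states is possible via `Y` but not via `X`. -/
def StrictSubsetT (mapX mapY : MapClass) (X Y : ConvRel) : Prop :=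
  (∀ (n : ℕ) (d : Fin n → ℕ), 0 < n → ∀ Λ : Op d → Op d, mapX d Λ → mapY d Λ) ∧
  ∃ (n : ℕ) (d : Fin n → ℕ) (ψ φ : StateVec d), 0 < n ∧
    FullyEntangled ψ ∧ FullyEntangled φ ∧ Y d ψ φ ∧ ¬ X d ψ φ

/-! ### Three qutrits -/

/-- The local dimensions of three qutrits. -/
abbrev qutrits : Fin 3 → ℕ := fun _ => 3

/-- The vector `a (|000⟩ + |111⟩ + |222⟩) + b (|012⟩ + |120⟩ + |201⟩)
+ c (|021⟩ + |102⟩ + |210⟩)`. -/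
def seedState (a b c : ℂ) : StateVec qutrits := fun x =>
  if x 1 = x 0 ∧ x 2 = x 1 then a
  else if x 1 = x 0 + 1 ∧ x 2 = x 1 + 1 then b
  else if x 1 = x 0 + 2 ∧ x 2 = x 1 + 2 then c
  else 0

/-- Generic parameters of the seed states: the point `[a : b : c]` of the projective plane is not
fixed by any nontrivial element of the Hessian group of order 216. In terms of the invariants of
degrees 12 (the discriminant), 9, 6 and 12 of that group, this reads as follows. -/
def IsSeedParameter (a b c : ℂ) : Prop :=
  a * b * c ≠ 0 ∧
  (a ^ 3 + b ^ 3 + c ^ 3) ^ 3 ≠ (3 * a * b * c) ^ 3 ∧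
  a ^ 3 ≠ b ^ 3 ∧ b ^ 3 ≠ c ^ 3 ∧ c ^ 3 ≠ a ^ 3 ∧
  ¬ (a ^ 6 + b ^ 6 + c ^ 6 = 10 * (a ^ 3 * b ^ 3 + b ^ 3 * c ^ 3 + c ^ 3 * a ^ 3) ∧
     (a ^ 3 + b ^ 3 + c ^ 3) * ((a ^ 3 + b ^ 3 + c ^ 3) ^ 3 + (6 * a * b * c) ^ 3) = 0)

/-- The generalized Pauli operator `X ^ p.1 * Z ^ p.2` on a qutrit, where `X |j⟩ = |j + 1⟩` and
`Z |j⟩ = exp (2 π i j / 3) |j⟩`. -/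
def pauli (p : Fin 3 × Fin 3) : Matrix (Fin 3) (Fin 3) ℂ := fun i j =>
  if i = j + p.1 then
    Complex.exp (2 * Real.pi * Complex.I / 3) ^ ((p.2 : ℕ) * (j : ℕ))
  else 0

/-- The Hermitian operator `z W + z̄ W†` with `W` the generalized Pauli operator `p`. -/
def pauliHerm (p : Fin 3 × Fin 3) (z : ℂ) : Matrix (Fin 3) (Fin 3) ℂ :=
  z • pauli p + star z • (pauli p)ᴴ

/-- The operators `h₁`, `h₂` of the example: `h₁† h₁` is `𝟙` plus nonzero components along two of
the four cyclic subgroups of order 3 of the qutrit Pauli group modulo phases, `h₂† h₂` is `𝟙` plus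
nonzero components along the other two. -/
def IsExamplePair (h₁ h₂ : Matrix (Fin 3) (Fin 3) ℂ) : Prop :=
  IsUnit h₁ ∧ IsUnit h₂ ∧
  ∃ (p : Fin 4 → Fin 3 × Fin 3) (z : Fin 4 → ℂ),
    (Pairwise fun i j => (p i).1 * (p j).2 ≠ (p i).2 * (p j).1) ∧
    (∀ i, z i ≠ 0) ∧
    h₁ᴴ * h₁ = 1 + pauliHerm (p 0) (z 0) + pauliHerm (p 1) (z 1) ∧
    h₂ᴴ * h₂ = 1 + pauliHerm (p 2) (z 2) + pauliHerm (p 3) (z 3)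

/-- The vector `(h₁ ⊗ h₂ ⊗ 𝟙) ψ`. -/
def applyPair (h₁ h₂ : Matrix (Fin 3) (Fin 3) ℂ) (ψ : StateVec qutrits) : StateVec qutrits :=
  tensorOp (d := qutrits) ![h₁, h₂, 1] *ᵥ ψ

end

noncomputable section

/-! ### Tensor products of one-party operators -/

section TensorOp

variable {n : ℕ} {d : Fin n → ℕ}

/-! Stabilizer. Contracting one factor of the seed state with a vector `x` gives a 3×3 matrix whose
determinant is a smooth cubic of the Hesse pencil, and local operators act on this cubic by linear
substitutions. A stabilizer element preserves the cubic up to a factor, hence also its Hessian,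
hence the pencil spanned by the two (`hesseCubic_pencil_comp`). Conjugating a Pauli operator by the
substitution gives a map of order 3 that fixes every member of the pencil, and such a map is a
multiple of a Pauli operator. So all factors normalize the Pauli group modulo phases, and they
induce the same element of SL(2,3) (`exists_actsOnPauli`). In SL(2,3) an element either has a power
equal to -1 or fixes a nonzero vector. The first is impossible because -1 swaps `b` and `c`; in the
second case a Clifford operator turns the element into a shear, which changes the phases of `b` and
`c`. Genericity is invariant under the Clifford operators used, so only the identity survives
(`actsOnPauli_eq_id`).

Separable conversion. The nine Kraus operators are `h S / 3`, with `S` in the stabilizer. Averaging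
`S† h† h S` keeps only Pauli coefficients whose labels sum to zero. The supports of `h₁† h₁` and
`h₂† h₂` lie on different lines of the plane over ℤ/3, so only the identity remains
(`convSEP₁_applyPair`).

No LOCC conversion. In a perfect protocol every final branch operator has Gram operator proportional
to some `S† h† h S`, so at every intermediate node the Gram operator is a product operator and also
a mixture of these nine. Comparing Pauli coefficients, the Fourier transform of the mixing weights
is multiplicative across the two pairs of lines, and its modulus on the four lines is constantly 0
or constantly 1 (`norm_eq_zero_or_one_of_multiplicative`). Hence either all local Gram operators are
scalar, or both of the first two are far from scalar. The protocol starts in the first situation and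
must end in the second, while each round changes the Gram operator of one party only: the first
party to leave the neighbourhood of the scalars does so alone, a contradiction.

To cover infinite protocols this is made quantitative: the summed distance of the branches from the
line of the target, `Protocol.totalDefect`, has a positive lower bound independent of the protocol
and of the number of rounds (`exists_totalDefect_bound`). The constants come from compactness of
normalized product operators. Nearly singular operators are the obstacle; they are controlled by the
gradient of the cubic (`exists_wellConditioned`) and, at intermediate nodes, by quantities additive
over outcomes (`exists_node_wellConditioned`).

LOCC inside SEP. The coefficients of a product-Kraus channel lie in the convex hull of a compact set
of normalized product coefficients. This hull is compact in finite dimension, so limits of protocols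
remain separable (`isSEP_of_tendsto`). -/

theorem tensorOp_mul (K L : LocalOps d) :
    tensorOp K * tensorOp L = tensorOp (fun i => K i * L i) := by
  ext x y
  simp only [Matrix.mul_apply, tensorOp, ← Finset.prod_mul_distrib]
  rw [Finset.prod_univ_sum]
  simp

theorem tensorOp_one : tensorOp (fun i => (1 : Matrix (Fin (d i)) (Fin (d i)) ℂ)) = 1 := by
  ext x y
  simp only [tensorOp, Matrix.one_apply]
  by_cases h : x = y
  · subst h; simp
  · rw [if_neg h]
    obtain ⟨i, hi⟩ := Function.ne_iff.mp h
    exact Finset.prod_eq_zero (Finset.mem_univ i) (if_neg hi)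

theorem tensorOp_conjTranspose (K : LocalOps d) :
    (tensorOp K)ᴴ = tensorOp (fun i => (K i)ᴴ) := by
  ext x y
  simp [tensorOp, Matrix.conjTranspose_apply]

theorem tensorOp_smul (c : Fin n → ℂ) (K : LocalOps d) :
    tensorOp (fun i => c i • K i) = (∏ i, c i) • tensorOp K := by
  ext x y
  simp [tensorOp, Finset.prod_mul_distrib]

theorem tensorOp_update_apply (K : LocalOps d) (i : Fin n) (M : Matrix (Fin (d i)) (Fin (d i)) ℂ)
    (x y : Idx d) :
    tensorOp (Function.update K i M) x y =
      M (x i) (y i) * ∏ j ∈ Finset.univ.erase i, K j (x j) (y j) := by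
  rw [tensorOp, ← Finset.mul_prod_erase _ _ (Finset.mem_univ i)]
  congr 1
  · simp
  · refine Finset.prod_congr rfl fun j hj => ?_
    rw [Function.update_of_ne (Finset.ne_of_mem_erase hj)]

theorem sum_tensorOp_update {ι : Type*} (s : Finset ι) (K : LocalOps d) (i : Fin n)
    (M : ι → Matrix (Fin (d i)) (Fin (d i)) ℂ) :
    ∑ k ∈ s, tensorOp (Function.update K i (M k)) =
      tensorOp (Function.update K i (∑ k ∈ s, M k)) := by
  ext x y
  rw [Matrix.sum_apply]
  simp only [tensorOp_update_apply, Matrix.sum_apply, Finset.sum_mul]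

/-- The unitaries of the other parties drop out of the Gram operators, so completeness of one local
measurement is completeness of the round. -/
theorem Protocol.sum_op (P : Protocol d) (t : List ℕ) :
    ∑ k ∈ Finset.range (P.outcomes t), (tensorOp (P.op t k))ᴴ * tensorOp (P.op t k) = 1 := by
  have h : ∀ k ∈ Finset.range (P.outcomes t), (tensorOp (P.op t k))ᴴ * tensorOp (P.op t k) =
      tensorOp (Function.update (fun _ => 1) (P.party t)
        ((P.op t k (P.party t))ᴴ * P.op t k (P.party t))) := by
    intro k hk
    rw [tensorOp_conjTranspose, tensorOp_mul]
    congr 1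
    ext1 i
    by_cases hi : i = P.party t
    · subst hi; simp
    · rw [Function.update_of_ne hi]
      exact Matrix.mem_unitaryGroup_iff'.mp (P.isUnitary t k (Finset.mem_range.mp hk) i hi)
  rw [Finset.sum_congr rfl h, sum_tensorOp_update, P.complete t, Function.update_eq_self_iff.mpr rfl,
    tensorOp_one]

/-- The one-party operators accumulated along a history. -/
def Protocol.localKraus (P : Protocol d) : List ℕ → LocalOps d
  | [] => fun _ => 1
  | k :: t => fun i => P.op t k i * P.localKraus t i

theorem Protocol.kraus_eq (P : Protocol d) (t : List ℕ) :
    P.kraus t = tensorOp (P.localKraus t) := by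
  induction t with
  | nil => exact tensorOp_one.symm
  | cons k t ih => rw [Protocol.kraus, ih, tensorOp_mul, Protocol.localKraus]

theorem Protocol.sum_histories_succ {M : Type*} [AddCommMonoid M] (P : Protocol d) (m : ℕ)
    (f : List ℕ → M) :
    ∑ t ∈ P.histories (m + 1), f t =
      ∑ t ∈ P.histories m, ∑ k ∈ Finset.range (P.outcomes t), f (k :: t) := by
  rw [Protocol.histories, Finset.sum_biUnion]
  · refine Finset.sum_congr rfl fun t _ => ?_
    rw [Finset.sum_image]
    intro a _ b _ h
    simpa using h
  · intro s _ t _ hst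
    rw [Function.onFun, Finset.disjoint_left]
    intro u hu hu'
    simp only [Finset.mem_image, Finset.mem_range] at hu hu'
    obtain ⟨k, _, rfl⟩ := hu
    obtain ⟨l, _, hl⟩ := hu'
    simp only [List.cons.injEq] at hl
    exact hst hl.2.symm

theorem Protocol.sum_kraus (P : Protocol d) (m : ℕ) :
    ∑ t ∈ P.histories m, (P.kraus t)ᴴ * P.kraus t = 1 := by
  induction m with
  | zero => simp [Protocol.histories, Protocol.kraus]
  | succ m ih =>
    rw [P.sum_histories_succ, ← ih]
    refine Finset.sum_congr rfl fun t _ => ?_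
    have : ∀ k, (P.kraus (k :: t))ᴴ * P.kraus (k :: t) =
        (P.kraus t)ᴴ * ((tensorOp (P.op t k))ᴴ * tensorOp (P.op t k)) * P.kraus t := by
      intro k
      simp only [Protocol.kraus, Matrix.conjTranspose_mul, Matrix.mul_assoc]
    simp only [this, ← Finset.sum_mul, ← Finset.mul_sum, P.sum_op, mul_one]

end TensorOp

/-! ### Third roots of unity and generalized Pauli operators -/

/-- `exp (2 π i / 3)`. -/
def omega : ℂ := Complex.exp (2 * Real.pi * Complex.I / 3)

theorem omega_isPrimitiveRoot : IsPrimitiveRoot omega 3 := by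
  simpa [omega] using Complex.isPrimitiveRoot_exp 3 (by norm_num)

theorem omega_pow_three : omega ^ 3 = 1 := omega_isPrimitiveRoot.pow_eq_one

theorem omega_ne_one : omega ≠ 1 := omega_isPrimitiveRoot.ne_one (by norm_num)

theorem omega_sq : omega ^ 2 = -1 - omega := by
  have h : (omega - 1) * (omega ^ 2 + omega + 1) = 0 := by
    linear_combination omega_pow_three
  have := (mul_eq_zero.mp h).resolve_left (sub_ne_zero.mpr omega_ne_one)
  linear_combination this

theorem norm_omega : ‖omega‖ = 1 :=
  Complex.norm_eq_one_of_pow_eq_one omega_pow_three (by norm_num)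

theorem star_omega : star omega = omega ^ 2 := by
  have h : star omega * omega = 1 := by
    have := Complex.conj_mul' omega
    rw [norm_omega] at this
    simpa using this
  calc star omega = star omega * omega ^ 3 := by rw [omega_pow_three, mul_one]
    _ = (star omega * omega) * omega ^ 2 := by ring
    _ = omega ^ 2 := by rw [h, one_mul]

/-- The additive character `k ↦ exp (2 π i k / 3)` of `ℤ/3`. -/
def zeta (k : Fin 3) : ℂ := omega ^ (k : ℕ)

theorem zeta_zero : zeta 0 = 1 := by simp [zeta]
theorem zeta_one : zeta 1 = omega := by simp [zeta]
theorem zeta_two : zeta 2 = omega ^ 2 := by simp [zeta]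

theorem omega_pow_mod (k : ℕ) : omega ^ k = omega ^ (k % 3) := by
  conv_lhs => rw [← Nat.div_add_mod k 3, pow_add, pow_mul, omega_pow_three, one_pow, one_mul]

theorem zeta_add (a b : Fin 3) : zeta (a + b) = zeta a * zeta b := by
  rw [zeta, zeta, zeta, ← pow_add, Fin.val_add, ← omega_pow_mod]

theorem zeta_mul_val (a b : Fin 3) : omega ^ ((a : ℕ) * b) = zeta (a * b) := by
  rw [zeta, Fin.val_mul, ← omega_pow_mod]

theorem zeta_ne_zero (a : Fin 3) : zeta a ≠ 0 :=
  pow_ne_zero _ (omega_isPrimitiveRoot.ne_zero (by norm_num))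

theorem norm_zeta (a : Fin 3) : ‖zeta a‖ = 1 := by simp [zeta, norm_omega]

theorem zeta_pow_three (a : Fin 3) : zeta a ^ 3 = 1 := by
  rw [zeta, ← pow_mul, mul_comm, pow_mul, omega_pow_three, one_pow]

theorem zeta_neg (a : Fin 3) : zeta (-a) = star (zeta a) := by
  fin_cases a
  · simp [zeta]
  · have : (-1 : Fin 3) = 2 := by decide
    simpa [this, zeta_one, zeta_two] using star_omega.symm
  · have : (-2 : Fin 3) = 1 := by decide
    simp only [Fin.reduceFinMk, this, zeta_one, zeta_two, star_pow, star_omega]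
    rw [← pow_mul, omega_pow_mod]; simp

theorem zeta_injective : Function.Injective zeta := by
  intro a b h
  exact Fin.ext (omega_isPrimitiveRoot.pow_inj a.2 b.2 h)

theorem zeta_eq_one {a : Fin 3} (h : zeta a = 1) : a = 0 :=
  zeta_injective (h.trans zeta_zero.symm)

theorem exists_zeta_of_pow_three {z : ℂ} (h : z ^ 3 = 1) : ∃ k, z = zeta k := by
  have : (z - 1) * ((z - omega) * (z - omega ^ 2)) = 0 := by
    linear_combination h + (z - z ^ 2) * omega_sq + (z - 1) * omega_pow_three
  rcases mul_eq_zero.mp this with h | h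
  · exact ⟨0, by rw [zeta_zero]; linear_combination h⟩
  rcases mul_eq_zero.mp h with h | h
  · exact ⟨1, by rw [zeta_one]; linear_combination h⟩
  · exact ⟨2, by rw [zeta_two]; linear_combination h⟩

theorem exists_zeta_of_pow_three_eq {z w : ℂ} (hw : w ≠ 0) (h : z ^ 3 = w ^ 3) :
    ∃ k, z = zeta k * w := by
  obtain ⟨k, hk⟩ := exists_zeta_of_pow_three (z := z / w) (by
    rw [div_pow, h, div_self (pow_ne_zero _ hw)])
  exact ⟨k, by rw [← hk, div_mul_cancel₀ _ hw]⟩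

theorem pauli_apply (p : Fin 3 × Fin 3) (i j : Fin 3) :
    pauli p i j = if i = j + p.1 then zeta (p.2 * j) else 0 := by
  rw [pauli, ← zeta_mul_val]; rfl

theorem pauli_add_apply (p : Fin 3 × Fin 3) (j : Fin 3) :
    pauli p (j + p.1) j = zeta (p.2 * j) := by simp [pauli_apply]

theorem pauli_zero : pauli 0 = 1 := by
  ext i j
  simp [pauli_apply, Matrix.one_apply, zeta_zero]

theorem pauli_mul (p q : Fin 3 × Fin 3) :
    pauli p * pauli q = zeta (p.2 * q.1) • pauli (p + q) := by
  ext i j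
  simp only [Matrix.mul_apply, pauli_apply, Matrix.smul_apply, smul_eq_mul, Prod.fst_add,
    Prod.snd_add, mul_ite, mul_zero, Finset.sum_ite_eq', Finset.mem_univ, if_true]
  have h1 : j + q.1 + p.1 = j + (p.1 + q.1) := by rw [add_assoc, add_comm q.1]
  simp only [h1]
  split_ifs
  · rw [← zeta_add, ← zeta_add]
    have : ∀ a b c j : Fin 3, a * (j + b) + c * j = a * b + (a + c) * j := by decide
    rw [this]
  · simp

theorem pauli_conjTranspose (p : Fin 3 × Fin 3) :
    (pauli p)ᴴ = zeta (p.1 * p.2) • pauli (-p) := by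
  ext i j
  simp only [Matrix.conjTranspose_apply, pauli_apply, Matrix.smul_apply, smul_eq_mul, Prod.fst_neg,
    Prod.snd_neg]
  have h1 : (j = i + p.1) ↔ (i = j + -p.1) := by
    constructor <;> (rintro h; rw [h]; simp)
  by_cases h : i = j + -p.1
  · rw [if_pos h, if_pos (h1.mpr h), ← zeta_neg, ← zeta_add]
    congr 1
    rw [h]
    obtain ⟨p1, p2⟩ := p
    clear h h1
    revert p1 p2 j
    decide
  · rw [if_neg h, if_neg (fun h' => h (h1.mp h'))]; simp

theorem pauli_conjTranspose_mul (p : Fin 3 × Fin 3) : (pauli p)ᴴ * pauli p = 1 := by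
  rw [pauli_conjTranspose, Matrix.smul_mul, pauli_mul, smul_smul, neg_add_cancel, pauli_zero,
    ← zeta_add]
  have : p.1 * p.2 + (-p).2 * p.1 = 0 := by
    obtain ⟨p1, p2⟩ := p
    revert p1 p2
    decide
  rw [this, zeta_zero, one_smul]

theorem pauli_mul_conjTranspose (p : Fin 3 × Fin 3) : pauli p * (pauli p)ᴴ = 1 :=
  mul_eq_one_comm.mp (pauli_conjTranspose_mul p)

theorem isUnit_pauli (p : Fin 3 × Fin 3) : IsUnit (pauli p) :=
  IsUnit.of_mul_eq_one _ (pauli_mul_conjTranspose p)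

theorem pauli_mul_comm (p q : Fin 3 × Fin 3) :
    pauli p * pauli q = zeta (p.2 * q.1 - q.2 * p.1) • (pauli q * pauli p) := by
  rw [pauli_mul, pauli_mul, smul_smul, ← zeta_add, sub_add_cancel, add_comm q p]

theorem pauli_smul_inj {p q : Fin 3 × Fin 3} {c : ℂ} (h : pauli p = c • pauli q) : p = q := by
  have h1 := congrFun (congrFun h (0 + p.1)) 0
  have h2 := congrFun (congrFun h (1 + p.1)) 1
  rw [Matrix.smul_apply, pauli_add_apply] at h1 h2
  simp only [pauli_apply, smul_eq_mul] at h1 h2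
  by_cases hs : p.1 = q.1
  · simp only [hs, if_true, mul_zero, zeta_zero, mul_one] at h1 h2
    rw [← h1, one_mul] at h2
    exact Prod.ext hs (zeta_injective h2)
  · rw [if_neg (by simpa using hs)] at h1
    exact absurd h1 (by simp [zeta_zero])

/-- Slices transform under the transpose of the first local operator, so the normalizer argument is
run for transposes and translated back with this identity. -/
theorem pauli_transpose (p : Fin 3 × Fin 3) :
    (pauli p)ᵀ = zeta (-(p.1 * p.2)) • pauli (-p.1, p.2) := by
  ext i j
  simp only [Matrix.transpose_apply, pauli_apply, Matrix.smul_apply, smul_eq_mul]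
  have h1 : (j = i + p.1) ↔ (i = j + -p.1) := by
    constructor <;> (rintro h; rw [h]; simp)
  by_cases h : i = j + -p.1
  · rw [if_pos h, if_pos (h1.mpr h), ← zeta_add]
    congr 1
    rw [h]
    obtain ⟨p1, p2⟩ := p
    clear h h1
    revert p1 p2 j
    decide
  · rw [if_neg h, if_neg (fun h' => h (h1.mp h'))]; simp

/-- The coefficient of `Q` at the generalized Pauli operator `u`, times 3. -/
def pauliCoef (u : Fin 3 × Fin 3) (Q : Matrix (Fin 3) (Fin 3) ℂ) : ℂ := ((pauli u)ᴴ * Q).trace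

theorem pauliCoef_eq (u : Fin 3 × Fin 3) (Q : Matrix (Fin 3) (Fin 3) ℂ) :
    pauliCoef u Q = ∑ j, star (zeta (u.2 * j)) * Q (j + u.1) j := by
  simp only [pauliCoef, Matrix.trace, Matrix.diag_apply, Matrix.mul_apply,
    Matrix.conjTranspose_apply, pauli_apply]
  refine Finset.sum_congr rfl fun j _ => ?_
  rw [Finset.sum_eq_single (j + u.1)]
  · simp
  · intro k _ hk; simp [hk]
  · simp

theorem sum_zeta_mul (m : Fin 3) : ∑ k, zeta (k * m) = if m = 0 then 3 else 0 := by
  rw [Fin.sum_univ_three]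
  fin_cases m
  · simp [zeta_zero]; norm_num
  · simp [zeta_zero, zeta_one, zeta_two, omega_sq]
  · have : (2 * 2 : Fin 3) = 1 := by decide
    simp [zeta_zero, zeta_one, zeta_two, this, omega_sq]; ring

/-- The nine operators are orthogonal for the trace form, each with squared norm 3. For a given
entry only one shift contributes, and summing over the phases isolates that entry. -/
theorem sum_pauliCoef_smul (Q : Matrix (Fin 3) (Fin 3) ℂ) :
    ∑ u, pauliCoef u Q • pauli u = (3 : ℂ) • Q := by
  ext i j
  rw [Matrix.sum_apply]
  simp only [Matrix.smul_apply, smul_eq_mul, pauliCoef_eq, pauli_apply, Fintype.sum_prod_type]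
  rw [Finset.sum_eq_single (i - j)]
  · have : i = j + (i - j) := by abel
    simp only [← this, if_true, Finset.sum_mul]
    rw [Finset.sum_comm]
    have h : ∀ l, ∑ k, star (zeta (k * l)) * Q (l + (i - j)) l * zeta (k * j) =
        (if j - l = 0 then 3 else 0) * Q (l + (i - j)) l := by
      intro l
      rw [← sum_zeta_mul, Finset.sum_mul]
      refine Finset.sum_congr rfl fun k _ => ?_
      have : ∀ k j l : Fin 3, k * (j - l) = -(k * l) + k * j := by decide
      rw [this, zeta_add, zeta_neg]; ring
    simp only [h, sub_eq_zero, ite_mul, zero_mul, Finset.sum_ite_eq, Finset.mem_univ, if_true]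
    rw [← this]
  · intro k _ hk
    refine Finset.sum_eq_zero fun l _ => ?_
    rw [if_neg, mul_zero]
    rintro rfl
    simp at hk
  · simp

theorem pauliCoef_pauli (u v : Fin 3 × Fin 3) :
    pauliCoef u (pauli v) = if u = v then 3 else 0 := by
  rw [pauliCoef_eq]
  simp only [pauli_apply, add_right_inj]
  by_cases h1 : u.1 = v.1
  · simp only [h1, if_true, ← zeta_neg, ← zeta_add]
    have : ∀ x : Fin 3, -(u.2 * x) + v.2 * x = x * (v.2 - u.2) := by
      generalize u.2 = a; generalize v.2 = b
      revert a b; decide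
    simp only [this, sum_zeta_mul, sub_eq_zero, Prod.ext_iff, h1, true_and, eq_comm]
  · rw [if_neg (fun h => h1 (by rw [h]))]
    simp [h1]

theorem pauliCoef_add (u : Fin 3 × Fin 3) (Q R : Matrix (Fin 3) (Fin 3) ℂ) :
    pauliCoef u (Q + R) = pauliCoef u Q + pauliCoef u R := by
  simp [pauliCoef, Matrix.mul_add]

theorem pauliCoef_smul (u : Fin 3 × Fin 3) (c : ℂ) (Q : Matrix (Fin 3) (Fin 3) ℂ) :
    pauliCoef u (c • Q) = c * pauliCoef u Q := by
  simp [pauliCoef]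

/-! ### Three qutrits: coordinates and slices -/

theorem sum_idx {M : Type*} [AddCommMonoid M] (f : Idx qutrits → M) :
    ∑ x, f x = ∑ i : Fin 3, ∑ j : Fin 3, ∑ k : Fin 3, f ![i, j, k] := by
  let e : Fin 3 × Fin 3 × Fin 3 ≃ Idx qutrits :=
    { toFun := fun t => ![t.1, t.2.1, t.2.2]
      invFun := fun x => (x 0, x 1, x 2)
      left_inv := fun t => rfl
      right_inv := fun x => by ext i; fin_cases i <;> rfl }
  rw [← e.sum_comp]
  simp only [Fintype.sum_prod_type]
  rfl

theorem tensorOp_apply_three (K : LocalOps qutrits) (i j k i' j' k' : Fin 3) :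
    tensorOp K ![i, j, k] ![i', j', k'] = K 0 i i' * K 1 j j' * K 2 k k' := by
  simp [tensorOp, Fin.prod_univ_three]

theorem tensorOp_mulVec_apply (K : LocalOps qutrits) (χ : StateVec qutrits) (i j k : Fin 3) :
    (tensorOp K *ᵥ χ) ![i, j, k] =
      ∑ i' : Fin 3, ∑ j' : Fin 3, ∑ k' : Fin 3,
        K 0 i i' * K 1 j j' * K 2 k k' * χ ![i', j', k'] := by
  rw [Matrix.mulVec, dotProduct, sum_idx]
  simp only [tensorOp_apply_three]

/-- The contraction of a tensor with a vector in the first factor. -/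
def slice (χ : StateVec qutrits) (x : Fin 3 → ℂ) : Matrix (Fin 3) (Fin 3) ℂ :=
  fun j k => ∑ i : Fin 3, x i * χ ![i, j, k]

/-- After taking determinants, party 0 acts on a ternary cubic by substitution, and the other two
parties contribute only a scalar. -/
theorem slice_tensorOp (K : LocalOps qutrits) (χ : StateVec qutrits) (x : Fin 3 → ℂ) :
    slice (tensorOp K *ᵥ χ) x = K 1 * slice χ ((K 0)ᵀ *ᵥ x) * (K 2)ᵀ := by
  ext j k
  simp only [slice, tensorOp_mulVec_apply]
  simp only [slice, Matrix.mul_apply, Matrix.mulVec, dotProduct,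
    Matrix.transpose_apply, Finset.mul_sum, Finset.sum_mul]
  simp only [Fin.sum_univ_three]
  ring

/-- The cyclic shift of the three parties. -/
def rotate : Equiv.Perm (Fin 3) := Equiv.addRight 1

theorem tensorOp_comp_perm (σ : Equiv.Perm (Fin 3)) (K : LocalOps qutrits) (x y : Idx qutrits) :
    tensorOp (d := qutrits) (fun i => K (σ i)) (fun i => x (σ i)) (fun i => y (σ i)) =
      tensorOp K x y :=
  Equiv.prod_comp σ fun i => K i (x i) (y i)

theorem sum_comp_perm {M : Type*} [AddCommMonoid M] (σ : Equiv.Perm (Fin 3))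
    (f : Idx qutrits → M) : ∑ x : Idx qutrits, f (fun i => x (σ i)) = ∑ x, f x :=
  Equiv.sum_comp (Equiv.arrowCongr σ.symm (Equiv.refl (Fin 3))) f

theorem tensorOp_mulVec_comp_perm (σ : Equiv.Perm (Fin 3)) (K : LocalOps qutrits)
    (χ : StateVec qutrits) (x : Idx qutrits) :
    (tensorOp (d := qutrits) (fun i => K (σ i)) *ᵥ χ) (fun i => x (σ i)) =
      (tensorOp K *ᵥ fun y => χ fun i => y (σ i)) x := by
  simp only [Matrix.mulVec, dotProduct]
  rw [← sum_comp_perm σ]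
  simp only [tensorOp_comp_perm]

/-! ### The seed states -/

/-- The coefficient of the seed state at `|j, j + m, j + 2 m⟩`. -/
def seedCoef (a b c : ℂ) : Fin 3 → ℂ := ![a, b, c]

theorem seedState_apply (a b c : ℂ) (x : Idx qutrits) :
    seedState a b c x = if x 0 + x 1 + x 2 = 0 then seedCoef a b c (x 1 - x 0) else 0 := by
  rw [seedState]
  generalize x 0 = i
  generalize x 1 = j
  generalize x 2 = k
  change Fin 3 at i j k
  fin_cases i <;> fin_cases j <;> fin_cases k <;> simp [seedCoef]

theorem seedState_apply_three (a b c : ℂ) (i j k : Fin 3) :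
    seedState a b c ![i, j, k] = if i + j + k = 0 then seedCoef a b c (j - i) else 0 := by
  rw [seedState_apply]; rfl

/-- On the support the three labels sum to zero mod 3, so consecutive differences agree. This
symmetry transfers every result about party 0 to the other parties. -/
theorem seedState_rotate (a b c : ℂ) (x : Idx qutrits) :
    seedState a b c (fun i => x (rotate i)) = seedState a b c x := by
  simp only [seedState_apply, rotate]
  generalize h0 : x 0 = i
  generalize h1 : x 1 = j
  generalize h2 : x 2 = k
  change Fin 3 at i j k
  have e0 : x (Equiv.addRight 1 0) = j := h1
  have e1 : x (Equiv.addRight 1 1) = k := h2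
  have e2 : x (Equiv.addRight 1 2) = i := h0
  rw [e0, e1, e2]
  have : ∀ i j k : Fin 3, (j + k + i = 0 ↔ i + j + k = 0) ∧ (i + j + k = 0 → k - j = j - i) := by
    decide
  by_cases h : i + j + k = 0
  · rw [if_pos h, if_pos ((this i j k).1.mpr h), (this i j k).2 h]
  · rw [if_neg h, if_neg (fun h' => h ((this i j k).1.mp h'))]

theorem tensorOp_rotate_mulVec (a b c : ℂ) (K : LocalOps qutrits) (x : Idx qutrits) :
    (tensorOp (d := qutrits) (fun i => K (rotate i)) *ᵥ seedState a b c) (fun i => x (rotate i)) =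
      (tensorOp K *ᵥ seedState a b c) x := by
  rw [tensorOp_mulVec_comp_perm]
  simp only [seedState_rotate]

theorem tensorOp_pauli_mulVec (r : Fin 3 → Fin 3 × Fin 3) (χ : StateVec qutrits)
    (x : Idx qutrits) :
    (tensorOp (d := qutrits) (fun i => pauli (r i)) *ᵥ χ) x =
      zeta (∑ i, (r i).2 * (x i - (r i).1)) * χ (fun i => x i - (r i).1) := by
  rw [Matrix.mulVec, dotProduct, Finset.sum_eq_single (fun i => x i - (r i).1)]
  · congr 1
    simp only [tensorOp, pauli_apply, sub_add_cancel, if_true, Fin.prod_univ_three,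
      Fin.sum_univ_three, zeta_add]
  · intro y _ hy
    obtain ⟨i, hi⟩ := Function.ne_iff.mp hy
    rw [tensorOp, Finset.prod_eq_zero (Finset.mem_univ i), zero_mul]
    rw [pauli_apply, if_neg]
    rintro h
    exact hi (by rw [h]; simp)
  · simp

theorem tensorOp_pauli_mulVec_seedState (p : Fin 3 × Fin 3) (a b c : ℂ) :
    tensorOp (d := qutrits) (fun _ => pauli p) *ᵥ seedState a b c = seedState a b c := by
  ext x
  rw [tensorOp_pauli_mulVec (fun _ => p)]
  simp only [seedState_apply, Fin.sum_univ_three]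
  have h1 : ∀ i j k u : Fin 3, i - u + (j - u) + (k - u) = i + j + k := by decide
  have h2 : ∀ v i j k u : Fin 3, i + j + k = 0 → v * (i - u) + v * (j - u) + v * (k - u) = 0 := by
    decide
  rw [h1]
  split_ifs with h
  · rw [h2 _ _ _ _ _ h, zeta_zero, one_mul]; simp
  · simp

/-- The cubic form attached to a seed state is `hesseCubic` for suitable coefficients. -/
def hesseCubic (α β : ℂ) (x : Fin 3 → ℂ) : ℂ :=
  α * (x 0 ^ 3 + x 1 ^ 3 + x 2 ^ 3) + β * (x 0 * x 1 * x 2)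

theorem slice_seedState (a b c : ℂ) (x : Fin 3 → ℂ) :
    slice (seedState a b c) x =
      !![a * x 0, b * x 2, c * x 1; c * x 2, a * x 1, b * x 0; b * x 1, c * x 0, a * x 2] := by
  ext j k
  simp only [slice, Fin.sum_univ_three, seedState_apply_three]
  fin_cases j <;> fin_cases k <;> simp [seedCoef, mul_comm, Fin.reduceAdd, Fin.reduceEq]

/-- A member of the Hesse pencil; the first two genericity conditions say that it is smooth and not
the triangle `x 0 * x 1 * x 2`. -/
theorem det_slice_seedState (a b c : ℂ) (x : Fin 3 → ℂ) :
    (slice (seedState a b c) x).det =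
      hesseCubic (-(a * b * c)) (a ^ 3 + b ^ 3 + c ^ 3) x := by
  rw [slice_seedState, Matrix.det_fin_three]
  simp [hesseCubic]
  ring

/-! ### Symmetries of the Hesse pencil of plane cubics -/

/-- The Hessian matrix of `hesseCubic α β`. -/
def hesseMat (α β : ℂ) (x : Fin 3 → ℂ) : Matrix (Fin 3) (Fin 3) ℂ :=
  !![6 * α * x 0, β * x 2, β * x 1; β * x 2, 6 * α * x 1, β * x 0; β * x 1, β * x 0, 6 * α * x 2]

/-- The Hessian is recovered from values of the cubic alone, so any substitution law for the cubic
passes to it without differentiation. -/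
theorem hesseCubic_polarization (α β : ℂ) (x y z : Fin 3 → ℂ) :
    y ⬝ᵥ (hesseMat α β x *ᵥ z) =
      hesseCubic α β (x + y + z) - hesseCubic α β (x + y) - hesseCubic α β (x + z) -
        hesseCubic α β (y + z) + hesseCubic α β x + hesseCubic α β y + hesseCubic α β z := by
  simp [hesseMat, hesseCubic, dotProduct, Matrix.mulVec, Fin.sum_univ_three]
  ring

/-- The classical fact that the Hesse pencil is closed under taking Hessians. -/
theorem det_hesseMat (α β : ℂ) (x : Fin 3 → ℂ) :
    (hesseMat α β x).det = hesseCubic (-6 * α * β ^ 2) (216 * α ^ 3 + 2 * β ^ 3) x := by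
  rw [hesseMat, Matrix.det_fin_three]
  simp [hesseCubic]
  ring

theorem hesseCubic_hessian_comp {α β μ : ℂ} {T : Matrix (Fin 3) (Fin 3) ℂ}
    (h : ∀ x, hesseCubic α β (T *ᵥ x) = μ * hesseCubic α β x) (x : Fin 3 → ℂ) :
    T.det ^ 2 * hesseCubic (-6 * α * β ^ 2) (216 * α ^ 3 + 2 * β ^ 3) (T *ᵥ x) =
      μ ^ 3 * hesseCubic (-6 * α * β ^ 2) (216 * α ^ 3 + 2 * β ^ 3) x := by
  have key : Tᵀ * hesseMat α β (T *ᵥ x) * T = μ • hesseMat α β x := by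
    have h2 : ∀ y z, y ⬝ᵥ ((Tᵀ * hesseMat α β (T *ᵥ x) * T) *ᵥ z) =
        y ⬝ᵥ ((μ • hesseMat α β x) *ᵥ z) := by
      intro y z
      rw [← Matrix.mulVec_mulVec, ← Matrix.mulVec_mulVec, Matrix.dotProduct_mulVec,
        Matrix.vecMul_transpose, hesseCubic_polarization, Matrix.smul_mulVec, dotProduct_smul,
        hesseCubic_polarization]
      simp only [← Matrix.mulVec_add, h, smul_eq_mul]
      ring
    ext i j
    simpa using h2 (Pi.single i 1) (Pi.single j 1)
  have := congrArg Matrix.det key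
  rw [Matrix.det_mul, Matrix.det_mul, Matrix.det_transpose, Matrix.det_smul, det_hesseMat,
    det_hesseMat, Fintype.card_fin] at this
  linear_combination this

/-- The cubic and its Hessian are each scaled by `T`, and they span the pencil: the determinant of
their coefficients is `8 * α * (27 * α ^ 3 + β ^ 3)`. So composition with `T` maps the pencil
linearly to itself. -/
theorem hesseCubic_pencil_comp {α β μ : ℂ} (hα : α ≠ 0) (hd : 27 * α ^ 3 + β ^ 3 ≠ 0)
    {T : Matrix (Fin 3) (Fin 3) ℂ} (hT : IsUnit T)
    (h : ∀ x, hesseCubic α β (T *ᵥ x) = μ * hesseCubic α β x) (γ δ : ℂ) :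
    ∃ γ' δ' : ℂ, ∀ x, hesseCubic γ δ (T *ᵥ x) = hesseCubic γ' δ' x := by
  have hdet : T.det ≠ 0 := ((Matrix.isUnit_iff_isUnit_det T).mp hT).ne_zero
  set α' := -6 * α * β ^ 2 with hα'
  set β' := 216 * α ^ 3 + 2 * β ^ 3 with hβ'
  have hΔ : α * β' - β * α' ≠ 0 := by
    have : α * β' - β * α' = 8 * α * (27 * α ^ 3 + β ^ 3) := by rw [hα', hβ']; ring
    rw [this]
    exact mul_ne_zero (mul_ne_zero (by norm_num) hα) hd
  set Δ := α * β' - β * α' with hΔ'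
  have hlin : ∀ x, hesseCubic γ δ x = ((γ * β' - δ * α') / Δ) * hesseCubic α β x +
      ((α * δ - β * γ) / Δ) * hesseCubic α' β' x := by
    intro x
    field_simp
    simp only [hesseCubic, hΔ']
    ring
  refine ⟨((γ * β' - δ * α') / Δ) * μ * α + ((α * δ - β * γ) / Δ) * (μ ^ 3 / T.det ^ 2) * α',
    ((γ * β' - δ * α') / Δ) * μ * β + ((α * δ - β * γ) / Δ) * (μ ^ 3 / T.det ^ 2) * β',
    fun x => ?_⟩
  have h2 : hesseCubic α' β' (T *ᵥ x) = μ ^ 3 / T.det ^ 2 * hesseCubic α' β' x := by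
    have := hesseCubic_hessian_comp h x
    rw [← hα', ← hβ'] at this
    field_simp
    linear_combination this
  rw [hlin, h, h2]
  simp only [hesseCubic]
  ring

theorem pauli_mulVec (u : Fin 3 × Fin 3) (x : Fin 3 → ℂ) (i : Fin 3) :
    (pauli u *ᵥ x) i = zeta (u.2 * (i - u.1)) * x (i - u.1) := by
  rw [Matrix.mulVec, dotProduct, Finset.sum_eq_single (i - u.1)]
  · simp [pauli_apply]
  · intro j _ hj
    rw [pauli_apply, if_neg, zero_mul]
    rintro rfl
    simp at hj
  · simp

theorem hesseCubic_pauli (γ δ : ℂ) (u : Fin 3 × Fin 3) (x : Fin 3 → ℂ) :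
    hesseCubic γ δ (pauli u *ᵥ x) = hesseCubic γ δ x := by
  have h0 : ∀ i, (pauli u *ᵥ x) i ^ 3 = x (i - u.1) ^ 3 := by
    intro i
    rw [pauli_mulVec, mul_pow, zeta_pow_three, one_mul]
  have h1 : (pauli u *ᵥ x) 0 * (pauli u *ᵥ x) 1 * (pauli u *ᵥ x) 2 =
      x (0 - u.1) * x (1 - u.1) * x (2 - u.1) := by
    simp only [pauli_mulVec]
    have : ∀ a b : Fin 3, a * (0 - b) + a * (1 - b) + a * (2 - b) = 0 := by decide
    have hz : zeta (u.2 * (0 - u.1)) * zeta (u.2 * (1 - u.1)) * zeta (u.2 * (2 - u.1)) = 1 := by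
      rw [← zeta_add, ← zeta_add, this, zeta_zero]
    linear_combination (x (0 - u.1) * x (1 - u.1) * x (2 - u.1)) * hz
  rw [hesseCubic, hesseCubic, h1, h0, h0, h0]
  obtain ⟨u1, u2⟩ := u
  fin_cases u1
  · simp
  · have e1 : (0 - 1 : Fin 3) = 2 := by decide
    have e2 : (2 - 1 : Fin 3) = 1 := by decide
    simp [e1, e2]; ring
  · have e1 : (0 - 2 : Fin 3) = 1 := by decide
    have e2 : (1 - 2 : Fin 3) = 2 := by decide
    simp [e1, e2]; ring

/-- A plane other than a coordinate plane meets the open torus. The point with last coordinates 1, 1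
works unless its first coordinate vanishes; then 2, 1 does. -/
theorem exists_ne_zero_of_linear {l₀ l₁ : ℂ} (l₂ : ℂ) (h₀ : l₀ ≠ 0) (h₁ : l₁ ≠ 0) :
    ∃ x₀ x₁ x₂ : ℂ, x₀ ≠ 0 ∧ x₁ ≠ 0 ∧ x₂ ≠ 0 ∧ l₀ * x₀ + l₁ * x₁ + l₂ * x₂ = 0 := by
  by_cases h : l₁ + l₂ = 0
  · refine ⟨-(l₁ * 2 + l₂) / l₀, 2, 1, ?_, by norm_num, one_ne_zero, ?_⟩
    · refine div_ne_zero (neg_ne_zero.mpr fun h' => h₁ ?_) h₀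
      linear_combination h' - h
    · field_simp; ring
  · refine ⟨-(l₁ + l₂) / l₀, 1, 1, div_ne_zero (neg_ne_zero.mpr h) h₀, one_ne_zero, one_ne_zero, ?_⟩
    field_simp; ring

/-- A linear map of order 3 that fixes all members of the Hesse pencil is a multiple of a
generalized Pauli operator. -/
theorem exists_pauli_of_fixes_hesseCubic {R : Matrix (Fin 3) (Fin 3) ℂ}
    (hR : ∀ γ δ x, hesseCubic γ δ (R *ᵥ x) = hesseCubic γ δ x) (h3 : R * R * R = 1) :
    ∃ (u : Fin 3 × Fin 3) (c : ℂ), R = c • pauli u := by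
  have hq : ∀ x : Fin 3 → ℂ, (R *ᵥ x) 0 * (R *ᵥ x) 1 * (R *ᵥ x) 2 = x 0 * x 1 * x 2 := by
    intro x; simpa [hesseCubic] using hR 0 1 x
  have hp : ∀ x : Fin 3 → ℂ, (R *ᵥ x) 0 ^ 3 + (R *ᵥ x) 1 ^ 3 + (R *ᵥ x) 2 ^ 3 =
      x 0 ^ 3 + x 1 ^ 3 + x 2 ^ 3 := by
    intro x; simpa [hesseCubic] using hR 1 0 x
  -- Since the product of the coordinates is preserved, no row can vanish on the torus; hence each
  -- row has at most one nonzero entry.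
  have hrow : ∀ (i : Fin 3) (x : Fin 3 → ℂ), x 0 ≠ 0 → x 1 ≠ 0 → x 2 ≠ 0 → (R *ᵥ x) i ≠ 0 := by
    intro i x h0 h1 h2 h
    have := hq x
    have hz : (R *ᵥ x) 0 * (R *ᵥ x) 1 * (R *ᵥ x) 2 = 0 := by
      fin_cases i <;> simp_all
    rw [hz] at this
    exact mul_ne_zero (mul_ne_zero h0 h1) h2 this.symm
  have hmv : ∀ (i : Fin 3) (x : Fin 3 → ℂ), (R *ᵥ x) i = R i 0 * x 0 + R i 1 * x 1 + R i 2 * x 2 :=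
    fun i x => by rw [Matrix.mulVec, dotProduct, Fin.sum_univ_three]
  have hex : ∀ i, ∃ s, ∀ j, j ≠ s → R i j = 0 := by
    intro i
    have h01 : R i 0 = 0 ∨ R i 1 = 0 := by
      by_contra! h
      obtain ⟨x0, x1, x2, h0, h1, h2, hx⟩ := exists_ne_zero_of_linear (R i 2) h.1 h.2
      exact hrow i ![x0, x1, x2] h0 h1 h2 (by rw [hmv]; simpa using hx)
    have h02 : R i 0 = 0 ∨ R i 2 = 0 := by
      by_contra! h
      obtain ⟨x0, x1, x2, h0, h1, h2, hx⟩ := exists_ne_zero_of_linear (R i 1) h.1 h.2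
      exact hrow i ![x0, x2, x1] h0 h2 h1 (by rw [hmv]; simp; linear_combination hx)
    have h12 : R i 1 = 0 ∨ R i 2 = 0 := by
      by_contra! h
      obtain ⟨x0, x1, x2, h0, h1, h2, hx⟩ := exists_ne_zero_of_linear (R i 0) h.1 h.2
      exact hrow i ![x2, x0, x1] h2 h0 h1 (by rw [hmv]; simp; linear_combination hx)
    by_cases h0 : R i 0 = 0
    · rcases h12 with h | h
      · exact ⟨2, fun j hj => by fin_cases j <;> simp_all⟩
      · exact ⟨1, fun j hj => by fin_cases j <;> simp_all⟩
    · exact ⟨0, fun j hj => by fin_cases j <;> simp_all⟩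
  choose σ hσ using hex
  have hmul : ∀ (x : Fin 3 → ℂ) (i : Fin 3), (R *ᵥ x) i = R i (σ i) * x (σ i) := by
    intro x i
    rw [Matrix.mulVec, dotProduct]
    exact Finset.sum_eq_single (σ i) (fun j _ hj => by rw [hσ i j hj, zero_mul]) (by simp)
  -- Order 3 is used here to exclude transpositions: a permutation of three points whose cube is the
  -- identity is a cyclic shift.
  have hσ3 : ∀ i, σ (σ (σ i)) = i := by
    intro i
    have : (R *ᵥ (R *ᵥ (R *ᵥ Pi.single i 1))) i = (Pi.single i 1 : Fin 3 → ℂ) i := by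
      rw [Matrix.mulVec_mulVec, Matrix.mulVec_mulVec, h3, Matrix.one_mulVec]
    simp only [hmul] at this
    by_contra h
    rw [Pi.single_eq_of_ne h] at this
    simp at this
  obtain ⟨s, hs⟩ : ∃ s, ∀ i, σ i = i + s := by
    clear hmul hσ
    revert σ
    decide
  -- Testing on the all-ones vector and on basis vectors shows that the entries are cube roots of
  -- unity with product 1. Relative to the first one they form the pattern 1, ω^k, ω^(2k) of a Pauli
  -- operator.
  have hprod : R 0 (0 + s) * R 1 (1 + s) * R 2 (2 + s) = 1 := by
    have := hq 1
    simp only [hmul, hs] at this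
    simpa using this
  have hcube : ∀ i, R i (i + s) ^ 3 = 1 := by
    intro i
    have := hp (Pi.single (i + s) 1)
    simp only [hmul, hs] at this
    have hsum : ∀ f : Fin 3 → ℂ, f 0 + f 1 + f 2 = ∑ j, f j := fun f => (Fin.sum_univ_three f).symm
    rw [hsum (fun j => (R j (j + s) * (Pi.single (i + s) 1 : Fin 3 → ℂ) (j + s)) ^ 3),
      hsum (fun j => (Pi.single (i + s) 1 : Fin 3 → ℂ) j ^ 3),
      Finset.sum_eq_single i, Finset.sum_eq_single (i + s)] at this
    · simpa using this
    · intro j _ hj; simp [Pi.single_eq_of_ne hj]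
    · simp
    · intro j _ hj
      rw [Pi.single_eq_of_ne (by simpa using hj)]; simp
    · simp
  have hne : ∀ i, R i (i + s) ≠ 0 := fun i h => by simpa [h] using hcube i
  obtain ⟨k, hk⟩ := exists_zeta_of_pow_three_eq (hne 0) ((hcube 1).trans (hcube 0).symm)
  obtain ⟨l, hl⟩ := exists_zeta_of_pow_three_eq (hne 0) ((hcube 2).trans (hcube 0).symm)
  have hkl : k + l = 0 := by
    apply zeta_eq_one
    rw [zeta_add]
    rw [hk, hl] at hprod
    linear_combination hprod - zeta k * zeta l * hcube 0
  refine ⟨(-s, k), R 0 (0 + s) * zeta (-(k * s)), ?_⟩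
  ext i j
  rw [Matrix.smul_apply, pauli_apply, smul_eq_mul]
  by_cases h : j = i + s
  · subst h
    rw [if_pos (by simp), mul_assoc, ← zeta_add]
    have : ∀ k s i : Fin 3, -(k * s) + k * (i + s) = k * i := by decide
    rw [this]
    have hl' : l = k * 2 := by
      have : ∀ k l : Fin 3, k + l = 0 → l = k * 2 := by decide
      exact this k l hkl
    have hi : ∀ i, R i (i + s) = R 0 (0 + s) * zeta (k * i) := by
      intro i
      fin_cases i
      · simp [zeta_zero]
      · simpa [mul_comm] using hk
      · simpa [mul_comm, hl'] using hl
    exact hi i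
  · rw [hσ i j (by rw [hs]; exact h), if_neg, mul_zero]
    rintro rfl
    simp at h

/-! ### Stabilizer elements normalize the Pauli group -/

theorem stabilizes_rotate {a b c : ℂ} {K : LocalOps qutrits}
    (h : tensorOp K *ᵥ seedState a b c = seedState a b c) :
    tensorOp (d := qutrits) (fun i => K (rotate i)) *ᵥ seedState a b c = seedState a b c := by
  refine funext fun (y : Fin 3 → Fin 3) => ?_
  have hy : (fun i => (fun j => y (rotate.symm j)) (rotate i)) = y := by
    funext i; simp
  have h1 := tensorOp_rotate_mulVec a b c K (fun i => y (rotate.symm i))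
  have h2 := seedState_rotate a b c (fun i => y (rotate.symm i))
  rw [h, ← h2] at h1
  rw [hy] at h1
  exact h1

/-- By cyclic symmetry it is enough to treat party 0. -/
theorem forall_party_of_rotate {Q : Matrix (Fin 3) (Fin 3) ℂ → Prop}
    {P : LocalOps qutrits → Prop} (hrot : ∀ K, P K → P fun i => K (rotate i))
    (h0 : ∀ K, P K → Q (K 0)) (K : LocalOps qutrits) (hK : P K) (i : Fin 3) : Q (K i) := by
  fin_cases i
  · exact h0 K hK
  · exact h0 _ (hrot K hK)
  · exact h0 _ (hrot _ (hrot K hK))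

/-- The inverse transpose `T` of the first factor preserves the cubic up to a scalar, hence acts on
the pencil. Pauli operators fix every member of the pencil, so their conjugates by `T` do as well,
and these conjugates have order 3. -/
theorem exists_pauli_conj {a b c : ℂ} (h1 : a * b * c ≠ 0)
    (h2 : (a ^ 3 + b ^ 3 + c ^ 3) ^ 3 ≠ (3 * a * b * c) ^ 3) {K : LocalOps qutrits}
    (hu : ∀ i, IsUnit (K i)) (h : tensorOp K *ᵥ seedState a b c = seedState a b c)
    (i : Fin 3) (u : Fin 3 × Fin 3) :
    ∃ (v : Fin 3 × Fin 3) (γ : ℂ), K i * pauli u = γ • (pauli v * K i) := by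
  revert u
  refine forall_party_of_rotate
    (Q := fun A => ∀ u, ∃ (v : Fin 3 × Fin 3) (γ : ℂ), A * pauli u = γ • (pauli v * A))
    (P := fun K => (∀ i, IsUnit (K i)) ∧ tensorOp K *ᵥ seedState a b c = seedState a b c)
    (fun K hK => ⟨fun i => hK.1 _, stabilizes_rotate hK.2⟩) ?_ K ⟨hu, h⟩ i
  clear i h hu K
  rintro K ⟨hu, h⟩ u
  have hdet : ∀ i, (K i).det ≠ 0 := fun i =>
    ((Matrix.isUnit_iff_isUnit_det _).mp (hu i)).ne_zero
  have hinv : K 0 * (K 0)⁻¹ = 1 := Matrix.mul_nonsing_inv _ ((Matrix.isUnit_iff_isUnit_det _).mp (hu 0))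
  have hinv' : (K 0)⁻¹ * K 0 = 1 := mul_eq_one_comm.mp hinv
  set T := ((K 0)⁻¹)ᵀ with hT
  have hTK : (K 0)ᵀ * T = 1 := by rw [hT, ← Matrix.transpose_mul, hinv', Matrix.transpose_one]
  have hKT : T * (K 0)ᵀ = 1 := mul_eq_one_comm.mp hTK
  have hinvar : ∀ x, hesseCubic (-(a * b * c)) (a ^ 3 + b ^ 3 + c ^ 3) (T *ᵥ x) =
      (K 1).det * (K 2).det * hesseCubic (-(a * b * c)) (a ^ 3 + b ^ 3 + c ^ 3) x := by
    intro x
    rw [← det_slice_seedState, ← det_slice_seedState]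
    conv_lhs => rw [← h, slice_tensorOp, Matrix.mulVec_mulVec, hTK, Matrix.one_mulVec]
    rw [Matrix.det_mul, Matrix.det_mul, Matrix.det_transpose]
    ring
  have hpen := hesseCubic_pencil_comp (neg_ne_zero.mpr h1)
    (fun h' => h2 (by linear_combination h')) (IsUnit.of_mul_eq_one _ hKT) hinvar
  -- The label `(-u.1, u.2)` is that of the transpose of `pauli u`, up to a phase.
  obtain ⟨v, γ, hv⟩ := exists_pauli_of_fixes_hesseCubic
    (R := T * pauli (-u.1, u.2) * (K 0)ᵀ) (by
      intro γ δ x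
      obtain ⟨γ', δ', hγ⟩ := hpen γ δ
      rw [← Matrix.mulVec_mulVec, ← Matrix.mulVec_mulVec, hγ, hesseCubic_pauli, ← hγ,
        Matrix.mulVec_mulVec, hKT, Matrix.one_mulVec]) (by
      have h3 : pauli (-u.1, u.2) * pauli (-u.1, u.2) * pauli (-u.1, u.2) = 1 := by
        rw [pauli_mul, Matrix.smul_mul, pauli_mul, smul_smul, ← zeta_add]
        have e1 : ∀ a b : Fin 3, b * -a + (b + b) * -a = 0 := by decide
        have e2 : ∀ a b : Fin 3, ((-a, b) : Fin 3 × Fin 3) + (-a, b) + (-a, b) = 0 := by decide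
        simp only [Prod.snd_add, e1, e2, pauli_zero, zeta_zero, one_smul]
      calc _ = T * pauli (-u.1, u.2) * ((K 0)ᵀ * T) * pauli (-u.1, u.2) * ((K 0)ᵀ * T) *
            pauli (-u.1, u.2) * (K 0)ᵀ := by simp only [Matrix.mul_assoc]
        _ = T * (pauli (-u.1, u.2) * pauli (-u.1, u.2) * pauli (-u.1, u.2)) * (K 0)ᵀ := by
            rw [hTK]; simp only [Matrix.mul_assoc, Matrix.one_mul]
        _ = 1 := by rw [h3, Matrix.mul_one, hKT])
  have ht := congrArg Matrix.transpose hv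
  rw [Matrix.transpose_mul, Matrix.transpose_mul, Matrix.transpose_transpose, Matrix.transpose_smul,
    pauli_transpose, pauli_transpose, hT, Matrix.transpose_transpose] at ht
  simp only [neg_neg] at ht
  refine ⟨(-v.1, v.2), (zeta (-(-u.1 * u.2)))⁻¹ * γ * zeta (-(v.1 * v.2)), ?_⟩
  have hz := zeta_ne_zero (-(-u.1 * u.2))
  have h4 : K 0 * (zeta (-(-u.1 * u.2)) • pauli u) =
      γ • zeta (-(v.1 * v.2)) • pauli (-v.1, v.2) * K 0 := by
    rw [← ht]
    simp only [Matrix.mul_assoc, hinv', Matrix.mul_one]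
  rw [Matrix.mul_smul] at h4
  calc K 0 * pauli u = (zeta (-(-u.1 * u.2)))⁻¹ • (zeta (-(-u.1 * u.2)) • (K 0 * pauli u)) := by
        rw [smul_smul, inv_mul_cancel₀ hz, one_smul]
    _ = _ := by rw [h4]; simp only [Matrix.smul_mul, smul_smul, mul_assoc]

/-! ### Comparison of seed states under local Pauli operators -/

/-- Comparing supports forces the three shifts to sum to zero. What remains is a phase and a
translation of the coefficient index by the difference of the first two shifts. -/
theorem seedCoef_rel_of_pauli {a b c a' b' c' γ : ℂ} (ha : a ≠ 0) {r : Fin 3 → Fin 3 × Fin 3}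
    (h : γ • (tensorOp (d := qutrits) (fun i => pauli (r i)) *ᵥ seedState a' b' c') =
      seedState a b c) :
    (r 0).1 + (r 1).1 + (r 2).1 = 0 ∧ ∀ x y, seedCoef a b c (y - x) =
      γ * zeta ((r 0).2 * (x - (r 0).1) + (r 1).2 * (y - (r 1).1) +
        (r 2).2 * (-x - y - (r 2).1)) * seedCoef a' b' c' (y - x + ((r 0).1 - (r 1).1)) := by
  have key : ∀ x y z : Fin 3, γ * (zeta ((r 0).2 * (x - (r 0).1) + (r 1).2 * (y - (r 1).1) +
        (r 2).2 * (z - (r 2).1)) * (if (x - (r 0).1) + (y - (r 1).1) + (z - (r 2).1) = 0 then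
          seedCoef a' b' c' ((y - (r 1).1) - (x - (r 0).1)) else 0)) =
      if x + y + z = 0 then seedCoef a b c (y - x) else 0 := by
    intro x y z
    have := congrFun h ![x, y, z]
    rw [Pi.smul_apply, tensorOp_pauli_mulVec, seedState_apply, seedState_apply_three,
      Fin.sum_univ_three, smul_eq_mul] at this
    exact this
  have hsum : (r 0).1 + (r 1).1 + (r 2).1 = 0 := by
    by_contra hne
    have := key 0 0 0
    rw [if_neg, if_pos (by decide)] at this
    · simp [seedCoef] at this
      exact ha this.symm
    · intro h0
      apply hne
      have e : ∀ p q s : Fin 3, 0 - p + (0 - q) + (0 - s) = 0 → p + q + s = 0 := by decide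
      exact e _ _ _ h0
  refine ⟨hsum, fun x y => ?_⟩
  have := key x y (-x - y)
  have e1 : ∀ p q s x y : Fin 3, p + q + s = 0 → x - p + (y - q) + (-x - y - s) = 0 := by decide
  have e2 : ∀ x y : Fin 3, x + y + (-x - y) = 0 := by decide
  have e3 : ∀ p q x y : Fin 3, y - q - (x - p) = y - x + (p - q) := by decide
  rw [if_pos (e1 _ _ _ _ _ hsum), if_pos (e2 _ _), e3] at this
  rw [← this]
  ring

theorem seedCoef_pow_three_of_pauli {a b c a' b' c' γ : ℂ} (ha : a ≠ 0)
    {r : Fin 3 → Fin 3 × Fin 3}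
    (h : γ • (tensorOp (d := qutrits) (fun i => pauli (r i)) *ᵥ seedState a' b' c') =
      seedState a b c) (m : Fin 3) :
    seedCoef a b c m ^ 3 = γ ^ 3 * seedCoef a' b' c' (m + ((r 0).1 - (r 1).1)) ^ 3 := by
  have := (seedCoef_rel_of_pauli ha h).2 0 m
  rw [sub_zero] at this
  rw [this, mul_pow, mul_pow, zeta_pow_three, mul_one]

theorem IsSeedParameter.ne_zero {a b c : ℂ} (h : IsSeedParameter a b c) :
    a ≠ 0 ∧ b ≠ 0 ∧ c ≠ 0 := by
  have := h.1
  simp only [ne_eq, mul_eq_zero, not_or] at this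
  exact ⟨this.1.1, this.1.2, this.2⟩

/-- Such a scaling makes `μ` a primitive cube root of unity and the three cubes a geometric
progression. Then the cubes, their squares and their pairwise products all sum to zero, which the
last genericity condition forbids. -/
theorem IsSeedParameter.no_cyclic {a b c : ℂ} (h : IsSeedParameter a b c) {μ : ℂ}
    (h1 : a ^ 3 = μ * b ^ 3) (h2 : b ^ 3 = μ * c ^ 3) (h3 : c ^ 3 = μ * a ^ 3) : False := by
  obtain ⟨h0, hd, hab, hbc, hca, hinv⟩ := h
  have ha : a ^ 3 ≠ 0 := by
    intro h; apply h0; simp at h; simp [h]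
  have hb : b ^ 3 ≠ 0 := by
    intro h; apply h0; simp at h; simp [h]
  have hμ3 : μ ^ 3 = 1 := by
    have : (μ ^ 3 - 1) * a ^ 3 = 0 := by linear_combination (-1) * h1 - μ * h2 - μ ^ 2 * h3
    linear_combination (mul_eq_zero.mp this).resolve_right ha
  have hμ1 : μ ≠ 1 := by
    rintro rfl; exact hab (by linear_combination h1)
  have hμ : 1 + μ + μ ^ 2 = 0 := by
    have : (μ - 1) * (1 + μ + μ ^ 2) = 0 := by linear_combination hμ3
    exact (mul_eq_zero.mp this).resolve_left (sub_ne_zero.mpr hμ1)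
  have hb' : b ^ 3 = μ ^ 2 * a ^ 3 := by rw [h2, h3]; ring
  apply hinv
  have e6 : ∀ z : ℂ, z ^ 6 = (z ^ 3) ^ 2 := fun z => by ring
  rw [e6 a, e6 b, e6 c, h3, hb']
  constructor
  · generalize a ^ 3 = A
    linear_combination (A ^ 2 * ((1 - μ + μ ^ 2) - 10 * μ)) * hμ
  · have : a ^ 3 + μ ^ 2 * a ^ 3 + μ * a ^ 3 = 0 := by linear_combination a ^ 3 * hμ
    rw [this]; ring

theorem IsSeedParameter.shift_eq_zero {a b c : ℂ} (h : IsSeedParameter a b c) {μ : ℂ} {d : Fin 3}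
    (hd : ∀ m, seedCoef a b c m ^ 3 = μ * seedCoef a b c (m + d) ^ 3) : d = 0 := by
  have h0 := hd 0
  have h1 := hd 1
  have h2 := hd 2
  have e1 : (1 + 1 : Fin 3) = 2 := by decide
  have e2 : (2 + 1 : Fin 3) = 0 := by decide
  have e3 : (1 + 2 : Fin 3) = 0 := by decide
  have e4 : (2 + 2 : Fin 3) = 1 := by decide
  fin_cases d
  · rfl
  · simp [seedCoef, e1, e2] at h0 h1 h2
    exact (h.no_cyclic h0 h1 h2).elim
  · simp [seedCoef, e3, e4] at h0 h1 h2
    obtain ⟨h0', hd', hab, hbc, hca, hinv⟩ := h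
    -- A shift by 2 becomes a shift by 1 after exchanging `b` and `c`, and genericity is symmetric
    -- in them.
    have hsw : IsSeedParameter a c b := by
      refine ⟨by rwa [mul_right_comm], ?_, hca.symm, hbc.symm, hab.symm, ?_⟩
      · intro h; apply hd'; linear_combination h
      · rintro ⟨h, h'⟩
        exact hinv ⟨by linear_combination h, by linear_combination h'⟩
    exact (hsw.no_cyclic h0 h2 h1).elim

/-- Cubing removes all phases, so genericity rules out a translation of the coefficients; the phases
then have to match exactly. Taking `t = 0` treats stabilizer elements, and general `t` is what
excludes shears. -/
theorem pauli_eq_of_seedState_eq {a b c γ : ℂ} (hg : IsSeedParameter a b c) {t : Fin 3}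
    {r : Fin 3 → Fin 3 × Fin 3}
    (h : γ • (tensorOp (d := qutrits) (fun i => pauli (r i)) *ᵥ
      seedState a (zeta t * b) (zeta t * c)) = seedState a b c) :
    t = 0 ∧ ∀ i, r i = r 0 := by
  obtain ⟨ha, hb, hc⟩ := hg.ne_zero
  have hτ : ∀ m, seedCoef a (zeta t * b) (zeta t * c) m ^ 3 = seedCoef a b c m ^ 3 := by
    intro m; fin_cases m <;> simp [seedCoef, mul_pow, zeta_pow_three]
  have hd : (r 0).1 - (r 1).1 = 0 := by
    refine hg.shift_eq_zero (μ := γ ^ 3) fun m => ?_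
    rw [seedCoef_pow_three_of_pauli ha h m, hτ]
  obtain ⟨hs, hrel⟩ := seedCoef_rel_of_pauli ha h
  rw [hd] at hrel
  simp only [add_zero] at hrel
  have hγ : γ ≠ 0 := by
    rintro rfl
    have := hrel 0 0
    simp [seedCoef] at this
    exact ha this
  -- Two entries equal to `a`, one equal to `b` and one equal to `c` suffice: dividing by the common
  -- factors leaves equations between exponents in ℤ/3 that determine everything.
  have h00 := hrel 0 0
  have h11 := hrel 1 1
  have h01 := hrel 0 1
  have h02 := hrel 0 2
  simp only [sub_zero, sub_self] at h00 h11 h01 h02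
  simp only [seedCoef, Matrix.cons_val_zero, Matrix.cons_val_one, Matrix.cons_val] at h00 h11 h01 h02
  rcases hp : r 0 with ⟨p1, p2⟩
  rcases hq : r 1 with ⟨q1, q2⟩
  rcases hs' : r 2 with ⟨s1, s2⟩
  rw [hp, hq, hs'] at hs
  rw [hp, hq] at hd
  rw [hp, hq, hs'] at h00 h11 h01 h02
  simp only at hs hd h00 h11 h01 h02
  have k1 : zeta (p2 * (1 - p1) + q2 * (1 - q1) + s2 * (-1 - 1 - s1)) =
      zeta (p2 * (0 - p1) + q2 * (0 - q1) + s2 * (-0 - 0 - s1)) := by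
    have := h11.symm.trans h00
    exact mul_left_cancel₀ hγ (mul_right_cancel₀ ha this)
  have k0 : γ * zeta (p2 * (0 - p1) + q2 * (0 - q1) + s2 * (-0 - 0 - s1)) = 1 := by
    have : γ * zeta (p2 * (0 - p1) + q2 * (0 - q1) + s2 * (-0 - 0 - s1)) * a = 1 * a := by
      rw [one_mul]; exact h00.symm
    exact mul_right_cancel₀ ha this
  have k2 : zeta (p2 * (0 - p1) + q2 * (1 - q1) + s2 * (-0 - 1 - s1) + t) =
      zeta (p2 * (0 - p1) + q2 * (0 - q1) + s2 * (-0 - 0 - s1)) := by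
    have : γ * zeta (p2 * (0 - p1) + q2 * (1 - q1) + s2 * (-0 - 1 - s1) + t) * b = 1 * b := by
      rw [zeta_add _ t, one_mul]; conv_rhs => rw [h01]
      ring
    rw [← k0] at this
    exact mul_left_cancel₀ hγ (mul_right_cancel₀ hb this)
  have k3 : zeta (p2 * (0 - p1) + q2 * (2 - q1) + s2 * (-0 - 2 - s1) + t) =
      zeta (p2 * (0 - p1) + q2 * (0 - q1) + s2 * (-0 - 0 - s1)) := by
    have : γ * zeta (p2 * (0 - p1) + q2 * (2 - q1) + s2 * (-0 - 2 - s1) + t) * c = 1 * c := by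
      rw [zeta_add _ t, one_mul]; conv_rhs => rw [h02]
      ring
    rw [← k0] at this
    exact mul_left_cancel₀ hγ (mul_right_cancel₀ hc this)
  have k1' := zeta_injective k1
  have k2' := zeta_injective k2
  have k3' := zeta_injective k3
  have c1 : ∀ p q s : Fin 3, p + q + s = 0 → p - q = 0 → q = p ∧ s = p := by decide
  obtain ⟨rfl, rfl⟩ := c1 _ _ _ hs hd
  have c2 : ∀ p q s t u : Fin 3,
      p * (1 - u) + q * (1 - u) + s * (-1 - 1 - u) =
        p * (0 - u) + q * (0 - u) + s * (-0 - 0 - u) →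
      p * (0 - u) + q * (1 - u) + s * (-0 - 1 - u) + t =
        p * (0 - u) + q * (0 - u) + s * (-0 - 0 - u) →
      p * (0 - u) + q * (2 - u) + s * (-0 - 2 - u) + t =
        p * (0 - u) + q * (0 - u) + s * (-0 - 0 - u) → t = 0 ∧ q = p ∧ s = p := by decide
  obtain ⟨ht, rfl, rfl⟩ := c2 _ _ _ _ _ k1' k2' k3'
  refine ⟨ht, fun i => ?_⟩
  fin_cases i
  · exact hp
  · exact hq
  · exact hs'

/-- A transposition followed by a translation of ℤ/3 has a fixed point. That coefficient gives `γ ^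
3 = 1`, and then the cubes of the other two coefficients coincide. -/
theorem seedState_swap_ne {a b c γ : ℂ} (hg : IsSeedParameter a b c)
    {r : Fin 3 → Fin 3 × Fin 3} :
    γ • (tensorOp (d := qutrits) (fun i => pauli (r i)) *ᵥ seedState a c b) ≠ seedState a b c := by
  intro h
  obtain ⟨ha, hb, hc⟩ := hg.ne_zero
  have h3 := seedCoef_pow_three_of_pauli ha h
  generalize (r 0).1 - (r 1).1 = d at h3
  obtain ⟨-, -, hab, hbc, hca, -⟩ := hg
  have h0 := h3 0
  have h1 := h3 1
  have h2 := h3 2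
  have e1 : (1 + 1 : Fin 3) = 2 := by decide
  have e2 : (2 + 1 : Fin 3) = 0 := by decide
  have e3 : (1 + 2 : Fin 3) = 0 := by decide
  have e4 : (2 + 2 : Fin 3) = 1 := by decide
  have hμ : ∀ z : ℂ, z ≠ 0 → z ^ 3 = γ ^ 3 * z ^ 3 → γ ^ 3 = 1 := by
    intro z hz h
    have : γ ^ 3 * z ^ 3 = 1 * z ^ 3 := by rw [one_mul]; exact h.symm
    exact mul_right_cancel₀ (pow_ne_zero 3 hz) this
  fin_cases d
  · simp [seedCoef] at h0 h1 h2
    rw [hμ a ha h0, one_mul] at h1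
    exact hbc h1
  · simp [seedCoef, e1, e2] at h0 h1 h2
    rw [hμ b hb h1, one_mul] at h2
    exact hca h2
  · simp [seedCoef, e3, e4] at h0 h1 h2
    rw [hμ c hc h2, one_mul] at h1
    exact hab h1.symm

/-! ### Clifford operators -/

/-- Commuting with the diagonal generator up to a factor confines the support to one shifted
diagonal. Commuting with the shift up to a factor makes the entries there a geometric progression
whose ratio is a cube root of unity. -/
theorem exists_pauli_of_commute {R : Matrix (Fin 3) (Fin 3) ℂ} {α β : ℂ}
    (hX : R * pauli (1, 0) = α • (pauli (1, 0) * R))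
    (hZ : R * pauli (0, 1) = β • (pauli (0, 1) * R)) :
    ∃ (r : Fin 3 × Fin 3) (γ : ℂ), R = γ • pauli r := by
  by_cases hR : R = 0
  · exact ⟨0, 0, by rw [hR, zero_smul]⟩
  obtain ⟨i₀, j₀, h₀⟩ : ∃ i j, R i j ≠ 0 := by
    by_contra! h
    exact hR (by ext i j; exact h i j)
  have hZ' : ∀ i j, R i j * zeta j = β * (zeta i * R i j) := by
    intro i j
    have := congrFun (congrFun hZ i) j
    simpa [Matrix.mul_apply, pauli_apply, zeta_zero] using this
  have hX' : ∀ i j, R i (j + 1) = α * R (i - 1) j := by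
    intro i j
    have := congrFun (congrFun hX i) j
    rw [Matrix.smul_apply, Matrix.mul_apply, Matrix.mul_apply, Finset.sum_eq_single (j + 1),
      Finset.sum_eq_single (i - 1)] at this
    · simpa [pauli_apply, zeta_zero] using this
    · intro k _ hk
      rw [pauli_apply, if_neg, zero_mul]
      rintro rfl; simp at hk
    · simp
    · intro k _ hk
      rw [pauli_apply, if_neg hk, mul_zero]
    · simp
  have hβ : β = zeta (j₀ - i₀) := by
    have h1 : zeta j₀ = β * zeta i₀ := mul_left_cancel₀ h₀ (by rw [hZ']; ring)
    have h2 : zeta j₀ = zeta (j₀ - i₀) * zeta i₀ := by rw [← zeta_add, sub_add_cancel]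
    exact mul_right_cancel₀ (zeta_ne_zero i₀) (h1.symm.trans h2)
  set s := i₀ - j₀ with hs
  have hsupp : ∀ i j, i ≠ j + s → R i j = 0 := by
    intro i j hij
    by_contra hne
    have h1 : zeta j = zeta (j₀ - i₀ + i) := by
      rw [zeta_add, ← hβ]
      exact mul_left_cancel₀ hne (by rw [hZ']; ring)
    have h2 := zeta_injective h1
    apply hij
    rw [h2, hs]; abel
  set f : Fin 3 → ℂ := fun j => R (j + s) j with hf
  have hstep : ∀ j, f (j + 1) = α * f j := by
    intro j
    simp only [hf]
    rw [hX']
    congr 2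
    abel
  have hα : α ^ 3 = 1 := by
    have hj : f j₀ ≠ 0 := by
      simp only [hf, hs]
      rwa [add_sub_cancel]
    have h4 : f (j₀ + 1 + 1 + 1) = α ^ 3 * f j₀ := by rw [hstep, hstep, hstep]; ring
    have e : ∀ j : Fin 3, j + 1 + 1 + 1 = j := by decide
    rw [e] at h4
    exact mul_right_cancel₀ hj (by rw [one_mul]; exact h4.symm)
  obtain ⟨k, hk⟩ := exists_zeta_of_pow_three hα
  refine ⟨(s, k), f 0, ?_⟩
  ext i j
  rw [Matrix.smul_apply, pauli_apply, smul_eq_mul]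
  by_cases h : i = j + s
  · rw [if_pos h, h]
    change f j = _
    have e1 : f 1 = α * f 0 := hstep 0
    have e2 : f 2 = α * f 1 := hstep 1
    fin_cases j
    · simp [zeta_zero]
    · simp [e1, hk, mul_comm]
    · have : k * 2 = k + k := by clear hk; revert k; decide
      simp only [Fin.reduceFinMk, e2, e1, hk, this, zeta_add]; ring
  · rw [if_neg h, mul_zero, hsupp i j h]

/-- The unitary `|j⟩ ↦ |-j⟩`. -/
def parityMat : Matrix (Fin 3) (Fin 3) ℂ := fun i j => if i = -j then 1 else 0

theorem parityMat_pauli (u : Fin 3 × Fin 3) : parityMat * pauli u = pauli (-u) * parityMat := by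
  ext i j
  rw [Matrix.mul_apply, Matrix.mul_apply, Finset.sum_eq_single (j + u.1),
    Finset.sum_eq_single (-j)]
  · simp only [parityMat, pauli_apply, if_true, Prod.fst_neg, Prod.snd_neg, neg_mul_neg, one_mul,
      mul_one, ite_mul, zero_mul]
    have : i = -(j + u.1) ↔ i = -j + -u.1 := by rw [neg_add]
    simp only [this]
  · intro k _ hk; simp [parityMat, hk]
  · simp
  · intro k _ hk; simp [pauli_apply, hk]
  · simp

theorem tensorOp_parityMat_mulVec (a b c : ℂ) :
    tensorOp (d := qutrits) (fun _ => parityMat) *ᵥ seedState a b c = seedState a c b := by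
  refine funext fun (x : Fin 3 → Fin 3) => ?_
  have hx : x = ![x 0, x 1, x 2] := by ext i; fin_cases i <;> rfl
  rw [hx, tensorOp_mulVec_apply]
  generalize x 0 = i; generalize x 1 = j; generalize x 2 = k
  have hn : ∀ i l, l ≠ -i → parityMat i l = 0 := by
    intro i l h
    rw [parityMat, if_neg]
    rintro rfl; simp at h
  rw [Finset.sum_eq_single (-i), Finset.sum_eq_single (-j), Finset.sum_eq_single (-k)]
  · rw [seedState_apply_three, seedState_apply_three]
    have h1 : -i + -j + -k = 0 ↔ i + j + k = 0 := by revert i j k; decide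
    have h2 : ∀ m, seedCoef a c b m = seedCoef a b c (-m) := by
      intro m
      fin_cases m
      · rfl
      · rfl
      · rfl
    simp only [parityMat, neg_neg, if_true, h1, h2]
    have : -j - -i = -(j - i) := by abel
    simp [this]
  · intro l _ hl; rw [hn k l hl]; simp
  · simp
  · intro l _ hl; rw [hn j l hl]; simp
  · simp
  · intro l _ hl; rw [hn i l hl]; simp
  · simp

/-- The diagonal unitary with entries `1, 1, zeta m`. -/
def phaseMat (m : Fin 3) : Matrix (Fin 3) (Fin 3) ℂ :=
  Matrix.diagonal fun j => if j = 2 then zeta m else 1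

theorem phaseMat_mul (m l : Fin 3) : phaseMat m * phaseMat l = phaseMat (m + l) := by
  rw [phaseMat, phaseMat, phaseMat, Matrix.diagonal_mul_diagonal]
  congr 1
  ext j
  split_ifs <;> simp [zeta_add]

theorem phaseMat_zero : phaseMat 0 = 1 := by
  rw [phaseMat, ← Matrix.diagonal_one]
  congr 1
  ext j
  simp [zeta_zero]

/-- On the label plane this Clifford operator is the shear that fixes `(0, 1)`. -/
theorem phaseMat_pauli (m : Fin 3) (u : Fin 3 × Fin 3) :
    ∃ γ : ℂ, phaseMat m * pauli u = γ • (pauli (u.1, u.2 + m * u.1) * phaseMat m) := by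
  have h : ∀ m u1 : Fin 3, ∃ e, ∀ u2 j : Fin 3,
      (if j + u1 = 2 then m else 0) + u2 * j =
        e + ((u2 + m * u1) * j + (if j = 2 then m else 0)) := by decide
  obtain ⟨e, he⟩ := h m u.1
  refine ⟨zeta e, ?_⟩
  have hd : ∀ j : Fin 3, (if j = 2 then zeta m else 1) = zeta (if j = 2 then m else 0) := by
    intro j; split_ifs <;> simp [zeta_zero]
  ext i j
  rw [phaseMat, Matrix.diagonal_mul, Matrix.smul_apply, Matrix.mul_diagonal, pauli_apply,
    pauli_apply, hd, hd]
  by_cases hi : i = j + u.1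
  · rw [if_pos hi, if_pos hi, smul_eq_mul, ← zeta_add, ← zeta_add, ← zeta_add, hi, he]
  · rw [if_neg hi, if_neg hi]; simp

/-- On the support the labels are all equal, and the phases multiply to 1, or all distinct, and
exactly one of them is 2. -/
theorem tensorOp_phaseMat_mulVec (m : Fin 3) (a b c : ℂ) :
    tensorOp (d := qutrits) (fun _ => phaseMat m) *ᵥ seedState a b c =
      seedState a (zeta m * b) (zeta m * c) := by
  have hd : ∀ j : Fin 3, (if j = 2 then zeta m else 1) = zeta (if j = 2 then m else 0) := by
    intro j; split_ifs <;> simp [zeta_zero]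
  have hz : ∀ i j k m : Fin 3, i + j + k = 0 →
      ((if i = 2 then m else 0) + (if j = 2 then m else 0) + (if k = 2 then m else 0) : Fin 3) =
        if j - i = 0 then 0 else m := by decide
  have hc : ∀ l, seedCoef a (zeta m * b) (zeta m * c) l =
      zeta (if l = 0 then 0 else m) * seedCoef a b c l := by
    intro l; fin_cases l <;> simp [seedCoef, zeta_zero]
  refine funext fun (x : Fin 3 → Fin 3) => ?_
  have hx : x = ![x 0, x 1, x 2] := by ext i; fin_cases i <;> rfl
  rw [hx, tensorOp_mulVec_apply]
  generalize x 0 = i; generalize x 1 = j; generalize x 2 = k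
  rw [Finset.sum_eq_single i, Finset.sum_eq_single j, Finset.sum_eq_single k]
  · rw [seedState_apply_three, seedState_apply_three, phaseMat, Matrix.diagonal_apply_eq,
      Matrix.diagonal_apply_eq, Matrix.diagonal_apply_eq, hd, hd, hd, ← zeta_add, ← zeta_add]
    by_cases h : i + j + k = 0
    · rw [if_pos h, if_pos h, hz _ _ _ _ h, hc]
    · rw [if_neg h, if_neg h, mul_zero]
  · intro l _ hl; rw [phaseMat, Matrix.diagonal_apply_ne' _ hl]; simp
  · simp
  · intro l _ hl; rw [phaseMat, Matrix.diagonal_apply_ne' _ hl]; simp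
  · simp
  · intro l _ hl; rw [phaseMat, Matrix.diagonal_apply_ne' _ hl]; simp
  · simp

/-- The discrete Fourier matrix (not normalized). -/
def fourierMat : Matrix (Fin 3) (Fin 3) ℂ := fun i j => zeta (i * j)

/-- The inverse of `fourierMat`. -/
def fourierInv : Matrix (Fin 3) (Fin 3) ℂ := fun i j => 3⁻¹ * zeta (-(i * j))

theorem fourierMat_mul_inv : fourierMat * fourierInv = 1 := by
  ext i j
  rw [Matrix.mul_apply]
  have : ∀ k, fourierMat i k * fourierInv k j = 3⁻¹ * zeta (k * (i - j)) := by
    intro k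
    rw [fourierMat, fourierInv, mul_left_comm, ← zeta_add]
    congr 2
    revert i j k; decide
  simp only [this, ← Finset.mul_sum, sum_zeta_mul, sub_eq_zero, Matrix.one_apply]
  split_ifs <;> simp

theorem fourierMat_pauli (u : Fin 3 × Fin 3) :
    ∃ γ : ℂ, fourierMat * pauli u = γ • (pauli (-u.2, u.1) * fourierMat) := by
  refine ⟨zeta (-(u.1 * u.2)), ?_⟩
  ext i j
  rw [Matrix.smul_apply, Matrix.mul_apply, Matrix.mul_apply, Finset.sum_eq_single (j + u.1),
    Finset.sum_eq_single (i + u.2)]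
  · rw [pauli_add_apply, pauli_apply, if_pos (by simp), smul_eq_mul, fourierMat, fourierMat]
    simp only [← zeta_add]
    congr 1
    have : ∀ i j a b : Fin 3, i * (j + a) + b * j = -(a * b) + (a * (i + b) + (i + b) * j) := by
      decide
    exact this _ _ _ _
  · intro k _ hk
    rw [pauli_apply, if_neg, zero_mul]
    rintro rfl; simp at hk
  · simp
  · intro k _ hk; rw [pauli_apply, if_neg hk, mul_zero]
  · simp

/-- Summing over the first label yields the factor 3 and the support condition; summing over the
difference of the labels yields the discrete Fourier transform of the coefficients. -/
theorem tensorOp_fourierMat_mulVec (a b c : ℂ) :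
    tensorOp (d := qutrits) (fun _ => fourierMat) *ᵥ seedState a b c =
      (3 : ℂ) • seedState (a + b + c) (a + omega ^ 2 * b + omega * c)
        (a + omega * b + omega ^ 2 * c) := by
  have hc : ∀ l, seedCoef (a + b + c) (a + omega ^ 2 * b + omega * c)
      (a + omega * b + omega ^ 2 * c) l = ∑ m, seedCoef a b c m * zeta (-(m * l)) := by
    intro l
    rw [Fin.sum_univ_three]
    have e1 : (-1 : Fin 3) = 2 := by decide
    have e2 : (-2 : Fin 3) = 1 := by decide
    fin_cases l
    · simp [seedCoef, zeta_zero]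
    · simp [seedCoef, zeta_zero, zeta_one, zeta_two, e1, e2, mul_comm]
    · simp [seedCoef, zeta_zero, zeta_one, zeta_two, e1, e2, mul_comm]
  refine funext fun (x : Fin 3 → Fin 3) => ?_
  have hx : x = ![x 0, x 1, x 2] := by ext i; fin_cases i <;> rfl
  rw [hx, Pi.smul_apply, tensorOp_mulVec_apply, seedState_apply_three]
  generalize x 0 = i; generalize x 1 = j; generalize x 2 = k
  have h1 : ∀ i', ∑ j' : Fin 3, ∑ k' : Fin 3, fourierMat i i' * fourierMat j j' *
      fourierMat k k' * seedState a b c ![i', j', k'] =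
      ∑ m, zeta (i' * (i + j + k)) * (seedCoef a b c m * zeta (m * (j - k))) := by
    intro i'
    rw [← Equiv.sum_comp (Equiv.addLeft i')]
    refine Finset.sum_congr rfl fun m _ => ?_
    rw [Finset.sum_eq_single (i' - m)]
    · have e1 : ∀ i m : Fin 3, i + (i + m) + (i - m) = 0 := by decide
      rw [seedState_apply_three, Equiv.coe_addLeft, if_pos (e1 _ _), add_sub_cancel_left]
      simp only [fourierMat, ← zeta_add]
      have e2 : ∀ i j k i' m : Fin 3, i * i' + j * (i' + m) + k * (i' - m) =
          i' * (i + j + k) + m * (j - k) := by decide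
      rw [e2, zeta_add]; ring
    · intro k' _ hk
      rw [seedState_apply_three, if_neg, mul_zero]
      intro h
      apply hk
      rw [Equiv.coe_addLeft] at h
      have e : ∀ i m k : Fin 3, i + (i + m) + k = 0 → k = i - m := by decide
      exact e _ _ _ h
    · simp
  simp only [h1, ← Finset.mul_sum, ← Finset.sum_mul, sum_zeta_mul]
  split_ifs with h
  · rw [hc, smul_eq_mul]
    congr 1
    refine Finset.sum_congr rfl fun m _ => ?_
    congr 2
    have e : ∀ i j k m : Fin 3, i + j + k = 0 → m * (j - k) = -(m * (j - i)) := by decide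
    exact e _ _ _ _ h
  · simp

/-! ### The stabilizer of a generic seed state -/

theorem IsSeedParameter.phase {a b c : ℂ} (h : IsSeedParameter a b c) (m : Fin 3) :
    IsSeedParameter a (zeta m * b) (zeta m * c) := by
  obtain ⟨h0, hd, hab, hbc, hca, hinv⟩ := h
  have hz := zeta_pow_three m
  have e6 : ∀ z : ℂ, (zeta m * z) ^ 6 = z ^ 6 := fun z => by
    linear_combination (z ^ 6 * (zeta m ^ 3 + 1)) * hz
  have e3 : ∀ z : ℂ, (zeta m * z) ^ 3 = z ^ 3 := fun z => by linear_combination z ^ 3 * hz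
  have ep : ∀ r : ℂ, (r * a * (zeta m * b) * (zeta m * c)) ^ 3 = (r * a * b * c) ^ 3 := fun r => by
    linear_combination ((r * a * b * c) ^ 3 * (zeta m ^ 3 + 1)) * hz
  refine ⟨?_, ?_, ?_, ?_, ?_, ?_⟩
  · intro h
    apply h0
    have : zeta m ^ 2 * (a * b * c) = 0 := by linear_combination h
    exact (mul_eq_zero.mp this).resolve_left (pow_ne_zero 2 (zeta_ne_zero m))
  · rw [e3, e3, ep]; exact hd
  · rw [e3]; exact hab
  · rw [e3, e3]; exact hbc
  · rw [e3]; exact hca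
  · rw [e6, e6, e3, e3, ep]; exact hinv

/-- Needed in order to repeat the shear argument after a change of basis. With `s` the sum of the
cubes and `q` the product, the transform sends `s` to `3 * (s + 6 * q)` and `q` to `s - 3 * q`, so
the first two conditions trade places and the two expressions in the last condition reproduce
themselves up to constants. -/
theorem IsSeedParameter.fourier {a b c : ℂ} (h : IsSeedParameter a b c) :
    IsSeedParameter (a + b + c) (a + omega ^ 2 * b + omega * c)
      (a + omega * b + omega ^ 2 * c) := by
  obtain ⟨hb0, hc0⟩ := h.ne_zero.2
  obtain ⟨h0, hd, hab, hbc, hca, hinv⟩ := h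
  have hw := omega_sq
  have hw3 := omega_pow_three
  have h1w : (1 : ℂ) - omega ≠ 0 := sub_ne_zero.mpr omega_ne_one.symm
  have hw0 : omega ≠ 0 := fun h => by simp [h] at hw3
  set x := a + b + c with hx
  set y := a + omega ^ 2 * b + omega * c with hy
  set z := a + omega * b + omega ^ 2 * c with hz
  have hs : y + z = 2 * a - b - c := by rw [hy, hz]; linear_combination (b + c) * hw
  have hp : y * z = a ^ 2 + b ^ 2 + c ^ 2 - a * b - b * c - c * a := by
    rw [hy, hz]
    linear_combination (a * b + a * c + b * c) * hw + (b ^ 2 + c ^ 2 + b * c * omega) * hw3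
  have hs3 : y ^ 3 + z ^ 3 = (2 * a - b - c) ^ 3 -
      3 * (a ^ 2 + b ^ 2 + c ^ 2 - a * b - b * c - c * a) * (2 * a - b - c) := by
    rw [← hs, ← hp]; ring
  have hS : x ^ 3 + y ^ 3 + z ^ 3 = 3 * (a ^ 3 + b ^ 3 + c ^ 3 + 6 * (a * b * c)) := by
    rw [add_assoc, hs3, hx]; ring
  have hP : x * y * z = a ^ 3 + b ^ 3 + c ^ 3 - 3 * (a * b * c) := by
    rw [mul_assoc, hp, hx]; ring
  have hE : x ^ 3 * y ^ 3 + y ^ 3 * z ^ 3 + z ^ 3 * x ^ 3 = x ^ 3 * ((2 * a - b - c) ^ 3 -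
      3 * (a ^ 2 + b ^ 2 + c ^ 2 - a * b - b * c - c * a) * (2 * a - b - c)) +
      (a ^ 2 + b ^ 2 + c ^ 2 - a * b - b * c - c * a) ^ 3 := by
    rw [← hs3, ← hp]; ring
  have hne1 : a ^ 3 + b ^ 3 + c ^ 3 - 3 * (a * b * c) ≠ 0 := by
    intro h; apply hd
    have : a ^ 3 + b ^ 3 + c ^ 3 = 3 * a * b * c := by linear_combination h
    rw [this]
  have hprod : (a ^ 3 + b ^ 3 + c ^ 3) ^ 3 - (3 * a * b * c) ^ 3 ≠ 0 := sub_ne_zero.mpr hd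
  have cancel : ∀ u v : ℂ, (1 - omega) * (u - v) = 0 → u = v := fun u v h =>
    sub_eq_zero.mp ((mul_eq_zero.mp h).resolve_left h1w)
  have cube : ∀ (u v : ℂ) (k : ℕ), u = omega ^ k * v → u ^ 3 = v ^ 3 := fun u v k h => by
    rw [h, mul_pow, ← pow_mul, mul_comm k, pow_mul, hw3, one_pow, one_mul]
  obtain ⟨⟨hx0, hy0⟩, hz0⟩ : (x ≠ 0 ∧ y ≠ 0) ∧ z ≠ 0 := by
    have := hne1
    rw [← hP] at this
    simpa only [ne_eq, mul_eq_zero, not_or] using this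
  clear_value x y z
  refine ⟨by rwa [hP], ?_, ?_, ?_, ?_, ?_⟩
  · intro h
    have h' : (x ^ 3 + y ^ 3 + z ^ 3) ^ 3 = 27 * (x * y * z) ^ 3 := by rw [h]; ring
    rw [hS, hP] at h'
    have e : 3 * a * b * c = 3 * (a * b * c) := by ring
    rw [e] at hprod
    generalize a ^ 3 + b ^ 3 + c ^ 3 = s at h' hprod
    generalize a * b * c = q at h' hprod h0
    have h2 : q * (s ^ 2 + 3 * s * q + 9 * q ^ 2) = 0 := by
      linear_combination (1 / 729) * h'
    have h3 := (mul_eq_zero.mp h2).resolve_left h0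
    apply hprod
    linear_combination (s - 3 * q) * h3
  -- Equality of two cubes means that the new coefficients agree up to a cube root of unity. This
  -- linear relation makes two of `a`, `b`, `c` agree up to a cube root of unity as well; the next
  -- two cases are alike.
  · intro h
    obtain ⟨k, hk⟩ := exists_zeta_of_pow_three_eq hy0 h
    rw [hx, hy] at hk
    fin_cases k
    · simp only [Fin.zero_eta, zeta_zero] at hk
      refine hbc (cube c b 2 (cancel _ _ ?_)).symm
      linear_combination hk + b * hw3
    · simp only [Fin.mk_one, zeta_one] at hk
      refine hca (cube a c 2 (cancel _ _ ?_)).symm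
      linear_combination hk + (b + c) * hw3
    · simp only [Fin.reduceFinMk, zeta_two] at hk
      refine hab (cube b a 2 (cancel _ _ ?_)).symm
      linear_combination hk + (a + c + b * omega) * hw3
  · intro h
    obtain ⟨k, hk⟩ := exists_zeta_of_pow_three_eq hz0 h
    rw [hy, hz] at hk
    fin_cases k
    · simp only [Fin.zero_eta, zeta_zero] at hk
      rw [mul_left_cancel₀ hw0 (cancel (omega * c) (omega * b) (by linear_combination hk))] at hbc
      exact hbc rfl
    · simp only [Fin.mk_one, zeta_one] at hk
      rw [cancel a c (by linear_combination hk + c * hw3)] at hca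
      exact hca rfl
    · simp only [Fin.reduceFinMk, zeta_two] at hk
      rw [mul_left_cancel₀ (pow_ne_zero 2 hw0) (cancel (omega ^ 2 * b) (omega ^ 2 * a)
        (by linear_combination hk + (a + omega * c) * hw3))] at hab
      exact hab rfl
  · intro h
    obtain ⟨k, hk⟩ := exists_zeta_of_pow_three_eq hx0 h
    rw [hx, hz] at hk
    fin_cases k
    · simp only [Fin.zero_eta, zeta_zero] at hk
      refine hbc (cube b c 2 (cancel _ _ ?_))
      linear_combination -hk + c * hw3
    · simp only [Fin.mk_one, zeta_one] at hk
      refine hca (cube a c 1 (cancel _ _ ?_)).symm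
      linear_combination hk
    · simp only [Fin.reduceFinMk, zeta_two] at hk
      refine hab (cube b a 1 (mul_left_cancel₀ hw0 (cancel _ _ ?_))).symm
      linear_combination hk + a * hw3
  · rintro ⟨h6, h12⟩
    apply hinv
    rw [hS] at h12
    constructor
    · have h6' : (x ^ 3 + y ^ 3 + z ^ 3) ^ 2 -
          12 * (x ^ 3 * y ^ 3 + y ^ 3 * z ^ 3 + z ^ 3 * x ^ 3) = 0 := by
        linear_combination h6
      rw [hS, hE, hx] at h6'
      linear_combination (-1 / 27) * h6'
    · have h12' : (a ^ 3 + b ^ 3 + c ^ 3 + 6 * (a * b * c)) *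
          (27 * (a ^ 3 + b ^ 3 + c ^ 3 + 6 * (a * b * c)) ^ 3 + 216 * (x * y * z) ^ 3) = 0 := by
        generalize a ^ 3 + b ^ 3 + c ^ 3 + 6 * (a * b * c) = s at h12
        linear_combination (1 / 3) * h12
      have e : 6 * a * b * c = 6 * (a * b * c) := by ring
      rw [hP] at h12'
      rw [e]
      generalize a ^ 3 + b ^ 3 + c ^ 3 = s at h12'
      generalize a * b * c = q at h12'
      linear_combination (1 / 243) * h12'

/-- Conjugation by each `K i` permutes the generalized Pauli operators up to phases, according
to `g`. -/
def ActsOnPauli (K : LocalOps qutrits) (g : Fin 3 × Fin 3 → Fin 3 × Fin 3) : Prop :=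
  ∀ i u, ∃ γ : ℂ, K i * pauli u = γ • (pauli (g u) * K i)

theorem ActsOnPauli.mul {K L : LocalOps qutrits} {g g' : Fin 3 × Fin 3 → Fin 3 × Fin 3}
    (hK : ActsOnPauli K g) (hL : ActsOnPauli L g') :
    ActsOnPauli (fun i => K i * L i) (g ∘ g') := by
  intro i u
  obtain ⟨γ, hγ⟩ := hL i u
  obtain ⟨δ, hδ⟩ := hK i (g' u)
  refine ⟨γ * δ, ?_⟩
  rw [Matrix.mul_assoc, hγ, Matrix.mul_smul, ← Matrix.mul_assoc, hδ, Matrix.smul_mul, smul_smul,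
    Matrix.mul_assoc, Function.comp]

theorem pauli_eq_of_smul_mul_eq {A : Matrix (Fin 3) (Fin 3) ℂ} (hA : IsUnit A)
    {p q : Fin 3 × Fin 3} {α β : ℂ} (hα : α ≠ 0) (h : α • (pauli p * A) = β • (pauli q * A)) :
    p = q := by
  refine pauli_smul_inj (c := α⁻¹ * β) ?_
  have : (α • pauli p) * A = (β • pauli q) * A := by rwa [Matrix.smul_mul, Matrix.smul_mul]
  rw [hA.mul_left_inj] at this
  rw [mul_smul, ← this, smul_smul, inv_mul_cancel₀ hα, one_smul]

theorem smul_ne_zero_of_mul_pauli {A : Matrix (Fin 3) (Fin 3) ℂ} (hA : IsUnit A)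
    {u v : Fin 3 × Fin 3} {γ : ℂ} (h : A * pauli u = γ • (pauli v * A)) : γ ≠ 0 := by
  rintro rfl
  rw [zero_smul] at h
  exact (hA.mul (isUnit_pauli u)).ne_zero h

theorem ActsOnPauli.map_add {K : LocalOps qutrits} {g : Fin 3 × Fin 3 → Fin 3 × Fin 3}
    (hu : ∀ i, IsUnit (K i)) (hg : ActsOnPauli K g) (u v : Fin 3 × Fin 3) :
    g (u + v) = g u + g v := by
  obtain ⟨γ, hγ⟩ := hg 0 u
  obtain ⟨δ, hδ⟩ := hg 0 v
  obtain ⟨ε, hε⟩ := hg 0 (u + v)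
  have h1 : K 0 * (pauli u * pauli v) = (zeta (u.2 * v.1) * ε) • (pauli (g (u + v)) * K 0) := by
    rw [pauli_mul, Matrix.mul_smul, hε, smul_smul]
  have h2 : K 0 * (pauli u * pauli v) =
      (γ * δ * zeta ((g u).2 * (g v).1)) • (pauli (g u + g v) * K 0) := by
    rw [← Matrix.mul_assoc, hγ, Matrix.smul_mul, Matrix.mul_assoc, hδ, Matrix.mul_smul, smul_smul,
      ← Matrix.mul_assoc, pauli_mul, Matrix.smul_mul, smul_smul]
  exact pauli_eq_of_smul_mul_eq (hu 0)
    (mul_ne_zero (zeta_ne_zero _) (smul_ne_zero_of_mul_pauli (hu 0) hε)) (h1.symm.trans h2)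

/-- The commutation phase of two Pauli operators is a scalar, so conjugation cannot change it. -/
theorem ActsOnPauli.symplectic {K : LocalOps qutrits} {g : Fin 3 × Fin 3 → Fin 3 × Fin 3}
    (hu : ∀ i, IsUnit (K i)) (hg : ActsOnPauli K g) (u v : Fin 3 × Fin 3) :
    (g u).2 * (g v).1 - (g v).2 * (g u).1 = u.2 * v.1 - v.2 * u.1 := by
  obtain ⟨γ, hγ⟩ := hg 0 u
  obtain ⟨δ, hδ⟩ := hg 0 v
  have h2 : K 0 * (pauli u * pauli v) = (γ * δ *
      zeta ((g u).2 * (g v).1 - (g v).2 * (g u).1)) • (pauli (g v) * pauli (g u) * K 0) := by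
    rw [← Matrix.mul_assoc, hγ, Matrix.smul_mul, Matrix.mul_assoc, hδ, Matrix.mul_smul, smul_smul,
      ← Matrix.mul_assoc, pauli_mul_comm, Matrix.smul_mul, smul_smul]
  have h3 : K 0 * (pauli u * pauli v) = (γ * δ *
      zeta (u.2 * v.1 - v.2 * u.1)) • (pauli (g v) * pauli (g u) * K 0) := by
    rw [pauli_mul_comm, Matrix.mul_smul, ← Matrix.mul_assoc, hδ, Matrix.smul_mul, Matrix.mul_assoc,
      hγ, Matrix.mul_smul, smul_smul, smul_smul, ← Matrix.mul_assoc]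
    congr 1; ring
  have h4 := sub_eq_zero.mpr (h2.symm.trans h3)
  rw [← sub_smul, smul_eq_zero] at h4
  have hne : pauli (g v) * pauli (g u) * K 0 ≠ 0 :=
    (((isUnit_pauli _).mul (isUnit_pauli _)).mul (hu 0)).ne_zero
  have h5 := h4.resolve_right hne
  rw [← mul_sub, mul_eq_zero, mul_eq_zero] at h5
  have h6 := h5.resolve_left (not_or.mpr
    ⟨smul_ne_zero_of_mul_pauli (hu 0) hγ, smul_ne_zero_of_mul_pauli (hu 0) hδ⟩)
  exact zeta_injective (sub_eq_zero.mp h6)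

/-- Conjugating the stabilizer element with equal factors `pauli u` gives, up to a scalar, a product
of Pauli operators that still fixes the seed state. By `pauli_eq_of_seedState_eq` its factors agree,
so one permutation serves all parties. -/
theorem exists_actsOnPauli {a b c : ℂ} (hg : IsSeedParameter a b c) {K : LocalOps qutrits}
    (hu : ∀ i, IsUnit (K i)) (h : tensorOp K *ᵥ seedState a b c = seedState a b c) :
    ∃ g, ActsOnPauli K g := by
  choose v γ hv using exists_pauli_conj hg.1 hg.2.1 hu h
  refine ⟨fun u => v 0 u, fun i u => ⟨γ i u, ?_⟩⟩
  have h1 : tensorOp K * tensorOp (d := qutrits) (fun _ => pauli u) =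
      (∏ i, γ i u) • (tensorOp (d := qutrits) (fun i => pauli (v i u)) * tensorOp K) := by
    rw [tensorOp_mul, tensorOp_mul, ← tensorOp_smul]
    congr 1
    ext1 i
    exact hv i u
  have h2 := congrArg (· *ᵥ seedState a b c) h1
  simp only [← Matrix.mulVec_mulVec, Matrix.smul_mulVec, tensorOp_pauli_mulVec_seedState, h] at h2
  have h3 := pauli_eq_of_seedState_eq hg (t := 0) (γ := ∏ i, γ i u) (r := fun i => v i u)
    (by simpa only [zeta_zero, one_mul] using h2.symm)
  have h4 := h3.2 i
  rw [hv, h4]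

theorem mulVec_eq_of_mul {a b c : ℂ} {K L : LocalOps qutrits}
    (hK : tensorOp K *ᵥ seedState a b c = seedState a b c)
    (hL : tensorOp L *ᵥ seedState a b c = seedState a b c) :
    tensorOp (d := qutrits) (fun i => K i * L i) *ᵥ seedState a b c = seedState a b c := by
  rw [← tensorOp_mul, ← Matrix.mulVec_mulVec, hL, hK]

theorem exists_tensorOp_pauli_of_commute {K L : LocalOps qutrits}
    (hX : ∀ i, ∃ γ : ℂ, K i * L i * pauli (1, 0) = γ • (pauli (1, 0) * (K i * L i)))
    (hZ : ∀ i, ∃ γ : ℂ, K i * L i * pauli (0, 1) = γ • (pauli (0, 1) * (K i * L i))) :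
    ∃ (r : Fin 3 → Fin 3 × Fin 3) (γ : ℂ),
      tensorOp K * tensorOp L = γ • tensorOp (d := qutrits) (fun i => pauli (r i)) := by
  have : ∀ i, ∃ (r : Fin 3 × Fin 3) (γ : ℂ), K i * L i = γ • pauli r := fun i => by
    obtain ⟨α, hα⟩ := hX i
    obtain ⟨β, hβ⟩ := hZ i
    exact exists_pauli_of_commute hα hβ
  choose r γ hr using this
  refine ⟨r, ∏ i, γ i, ?_⟩
  rw [tensorOp_mul, ← tensorOp_smul]
  congr 1
  ext1 i
  exact hr i

/-- Correcting by the parity operator leaves a product of Pauli operators, which would carry the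
seed state with `b` and `c` exchanged back to the original. -/
theorem not_actsOnPauli_neg {a b c : ℂ} (hg : IsSeedParameter a b c) {K : LocalOps qutrits}
    (h : tensorOp K *ᵥ seedState a b c = seedState a b c)
    {g : Fin 3 × Fin 3 → Fin 3 × Fin 3} (hK : ActsOnPauli K g) : ¬ ∀ u, g u = -u := by
  intro hneg
  have hcomm : ∀ u i, ∃ γ : ℂ, K i * parityMat * pauli u = γ • (pauli u * (K i * parityMat)) := by
    intro u i
    obtain ⟨γ, hγ⟩ := hK i (-u)
    rw [hneg, neg_neg] at hγ
    exact ⟨γ, by rw [Matrix.mul_assoc, parityMat_pauli, ← Matrix.mul_assoc, hγ, Matrix.smul_mul,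
      Matrix.mul_assoc]⟩
  obtain ⟨r, γ, hr⟩ := exists_tensorOp_pauli_of_commute (K := K) (L := fun _ => parityMat)
    (hcomm _) (hcomm _)
  refine seedState_swap_ne hg (γ := γ) (r := r) ?_
  rw [← Matrix.smul_mulVec, ← hr, ← Matrix.mulVec_mulVec, tensorOp_parityMat_mulVec, h]

/-- A symplectic map fixing `(0, 1)` is a shear by some `m`. Undoing it with `phaseMat (-m)` leaves
a product of Pauli operators relating seed states whose `b`, `c` differ by the phase `zeta m`, which
forces `m = 0`. -/
theorem actsOnPauli_eq_of_fixes_Z {a b c : ℂ} (hs : IsSeedParameter a b c) {K : LocalOps qutrits}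
    (hu : ∀ i, IsUnit (K i)) (h : tensorOp K *ᵥ seedState a b c = seedState a b c)
    {g : Fin 3 × Fin 3 → Fin 3 × Fin 3} (hK : ActsOnPauli K g) (hg : g (0, 1) = (0, 1)) :
    ∀ u, g u = u := by
  have hadd := hK.map_add hu
  have hsymp := hK.symplectic hu (1, 0) (0, 1)
  rw [hg] at hsymp
  have hx1 : (g (1, 0)).1 = 1 := by simpa using hsymp
  obtain ⟨m, hm⟩ : ∃ m, g (1, 0) = (1, m) := ⟨_, Prod.ext hx1 rfl⟩
  have hlin : ∀ k l : Fin 3, g (k, l) = (k, k * m + l) := by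
    have h01 : ∀ l : Fin 3, g (0, l) = (0, l) := by
      have h2 : g (0, 2) = (0, 2) := by
        have := hadd (0, 1) (0, 1); rw [hg] at this; exact this
      have h0 : g (0, 0) = (0, 0) := by
        have := hadd (0, 1) (0, 2); rw [hg, h2] at this; exact this
      intro l; fin_cases l
      · exact h0
      · exact hg
      · exact h2
    have h1 : ∀ l : Fin 3, g (1, l) = (1, m + l) := by
      intro l
      have := hadd (1, 0) (0, l)
      rw [hm, h01] at this
      simpa using this
    have h2 : ∀ l : Fin 3, g (2, l) = (2, 2 * m + l) := by
      intro l
      have := hadd (1, 0) (1, l)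
      rw [hm, h1] at this
      have e : ∀ m l : Fin 3, m + (m + l) = 2 * m + l := by decide
      have e2 : (1 + 1 : Fin 3) = 2 := by decide
      simpa [e2, e] using this
    intro k l; fin_cases k
    · simpa using h01 l
    · simpa using h1 l
    · simpa using h2 l
  have hcomm : ∀ u i, ∃ γ : ℂ, K i * phaseMat (-m) * pauli u =
      γ • (pauli u * (K i * phaseMat (-m))) := by
    intro u i
    obtain ⟨δ, hδ⟩ := phaseMat_pauli (-m) u
    obtain ⟨γ, hγ⟩ := hK i (u.1, u.2 + -m * u.1)
    have e : ∀ u1 u2 m : Fin 3, u1 * m + (u2 + -m * u1) = u2 := by decide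
    rw [hlin, e] at hγ
    exact ⟨δ * γ, by rw [Matrix.mul_assoc, hδ, Matrix.mul_smul, ← Matrix.mul_assoc, hγ,
      Matrix.smul_mul, Matrix.mul_assoc, smul_smul]⟩
  obtain ⟨r, γ, hr⟩ := exists_tensorOp_pauli_of_commute (K := K) (L := fun _ => phaseMat (-m))
    (hcomm _) (hcomm _)
  have hphase : tensorOp (d := qutrits) (fun _ => phaseMat (-m)) *ᵥ
      seedState a (zeta m * b) (zeta m * c) = seedState a b c := by
    rw [← tensorOp_phaseMat_mulVec, Matrix.mulVec_mulVec, tensorOp_mul]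
    simp only [phaseMat_mul, neg_add_cancel, phaseMat_zero]
    rw [tensorOp_one, Matrix.one_mulVec]
  have hm0 := (pauli_eq_of_seedState_eq hs (t := m) (γ := γ) (r := r) (by
    rw [← Matrix.smul_mulVec, ← hr, ← Matrix.mulVec_mulVec, hphase, h])).1
  rintro ⟨k, l⟩
  rw [hlin, hm0]; simp

/-- Conjugating a stabilizer element with a Clifford operator. -/
theorem actsOnPauli_eq_of_conj {a b c a' b' c' ν : ℂ} (hs : IsSeedParameter a' b' c')
    {C C' : Matrix (Fin 3) (Fin 3) ℂ} (hC : C * C' = 1) (hν : ν ≠ 0)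
    (hseed : tensorOp (d := qutrits) (fun _ => C) *ᵥ seedState a b c = ν • seedState a' b' c')
    {s s' : Fin 3 × Fin 3 → Fin 3 × Fin 3} (hss : ∀ u, s (s' u) = u) (hss' : ∀ u, s' (s u) = u)
    (hact : ∀ u, ∃ γ : ℂ, C * pauli u = γ • (pauli (s u) * C))
    {K : LocalOps qutrits} (hu : ∀ i, IsUnit (K i))
    (h : tensorOp K *ᵥ seedState a b c = seedState a b c)
    {g : Fin 3 × Fin 3 → Fin 3 × Fin 3} (hK : ActsOnPauli K g)
    (hfix : g (s' (0, 1)) = s' (0, 1)) : ∀ u, g u = u := by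
  have hC' : C' * C = 1 := mul_eq_one_comm.mp hC
  have hact' : ∀ u, ∃ γ : ℂ, C' * pauli u = γ • (pauli (s' u) * C') := by
    intro u
    obtain ⟨γ, hγ⟩ := hact (s' u)
    rw [hss] at hγ
    have hγ0 : γ ≠ 0 := by
      rintro rfl
      rw [zero_smul] at hγ
      exact ((IsUnit.of_mul_eq_one _ hC).mul (isUnit_pauli _)).ne_zero hγ
    refine ⟨γ⁻¹, ?_⟩
    calc C' * pauli u = γ⁻¹ • (C' * (γ • (pauli u * C)) * C') := by
          rw [Matrix.mul_smul, Matrix.smul_mul, smul_smul, inv_mul_cancel₀ hγ0, one_smul,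
            Matrix.mul_assoc, Matrix.mul_assoc, hC, Matrix.mul_one]
      _ = _ := by rw [← hγ, ← Matrix.mul_assoc, hC', Matrix.one_mul]
  have hconj : ActsOnPauli (fun i => C * K i * C') (s ∘ g ∘ s') :=
    (ActsOnPauli.mul (K := fun i => C) (fun _ u => hact u)
      (ActsOnPauli.mul hK (L := fun _ => C') fun _ u => hact' u)) |> fun hh => by
        simpa only [Matrix.mul_assoc] using hh
  have hinv : tensorOp (d := qutrits) (fun _ => C') *ᵥ seedState a' b' c' =
      ν⁻¹ • seedState a b c := by
    have : seedState a' b' c' = ν⁻¹ • (tensorOp (d := qutrits) (fun _ => C) *ᵥ seedState a b c) := by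
      rw [hseed, smul_smul, inv_mul_cancel₀ hν, one_smul]
    rw [this, Matrix.mulVec_smul, Matrix.mulVec_mulVec, tensorOp_mul]
    simp only [hC']
    rw [tensorOp_one, Matrix.one_mulVec]
  have hstab : tensorOp (d := qutrits) (fun i => C * K i * C') *ᵥ seedState a' b' c' =
      seedState a' b' c' := by
    rw [← tensorOp_mul, ← tensorOp_mul, ← Matrix.mulVec_mulVec, ← Matrix.mulVec_mulVec, hinv,
      Matrix.mulVec_smul, Matrix.mulVec_smul, h, hseed, smul_smul, inv_mul_cancel₀ hν, one_smul]
  have := actsOnPauli_eq_of_fixes_Z hs (K := fun i => C * K i * C')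
    (fun i => ((IsUnit.of_mul_eq_one _ hC).mul (hu i)).mul (IsUnit.of_mul_eq_one _ hC')) hstab hconj
    (by simp only [Function.comp, hfix, hss])
  intro u
  have h1 := this (s u)
  simp only [Function.comp, hss'] at h1
  rw [← hss' (g u), h1, hss']

/-- The additive map of `(ℤ/3)²` with given images of the standard basis. -/
def linMap (x z u : Fin 3 × Fin 3) : Fin 3 × Fin 3 :=
  (u.1 * x.1 + u.2 * z.1, u.1 * x.2 + u.2 * z.2)

theorem eq_linMap_of_map_add {g : Fin 3 × Fin 3 → Fin 3 × Fin 3}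
    (hadd : ∀ u v, g (u + v) = g u + g v) (u : Fin 3 × Fin 3) :
    g u = linMap (g (1, 0)) (g (0, 1)) u := by
  have h1 : ∀ u : Fin 3 × Fin 3, u = (u.1 : ℕ) • ((1, 0) : Fin 3 × Fin 3) + (u.2 : ℕ) • (0, 1) := by
    decide
  have h2 : ∀ x z u : Fin 3 × Fin 3, linMap x z u = (u.1 : ℕ) • x + (u.2 : ℕ) • z := by decide
  have h3 : ∀ (k : ℕ) v, g (k • v) = k • g v := map_nsmul (AddMonoidHom.mk' g hadd)
  rw [h2, ← h3, ← h3, ← hadd, ← h1]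

/-- The hypothesis says determinant 1. Elements of SL(2,3) of order 2, 4 or 6 have -1 as first,
second or third power; those of order 1 or 3 are unipotent and fix a nonzero vector, and one vector
on each of the four lines is enough to test. -/
theorem linMap_cases : ∀ x z : Fin 3 × Fin 3, x.2 * z.1 - z.2 * x.1 = 0 * 0 - 1 * 1 →
    (∀ u, linMap x z u = -u) ∨ (∀ u, linMap x z (linMap x z u) = -u) ∨
    (∀ u, linMap x z (linMap x z (linMap x z u)) = -u) ∨
    linMap x z (0, 1) = (0, 1) ∨ linMap x z (1, 0) = (1, 0) ∨ linMap x z (1, 1) = (1, 1) ∨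
    linMap x z (1, 2) = (1, 2) := by
  decide

theorem actsOnPauli_eq_id {a b c : ℂ} (hs : IsSeedParameter a b c) {K : LocalOps qutrits}
    (hu : ∀ i, IsUnit (K i)) (h : tensorOp K *ᵥ seedState a b c = seedState a b c)
    {g : Fin 3 × Fin 3 → Fin 3 × Fin 3} (hK : ActsOnPauli K g) : ∀ u, g u = u := by
  have hadd := hK.map_add hu
  have hlin := eq_linMap_of_map_add hadd
  have hc := linMap_cases _ _ (hK.symplectic hu (1, 0) (0, 1))
  simp only [← hlin] at hc
  have hph : ∀ m : Fin 3, g (1, m) = (1, m) → ∀ u, g u = u := by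
    intro m hm
    -- The shear takes the fixed vector `(1, m)` to `(1, 0)`, and the Fourier matrix takes that to
    -- `(0, 1)`.
    have key := actsOnPauli_eq_of_conj (C := fourierMat * phaseMat (-m))
      (C' := phaseMat m * fourierInv) (hs.phase (-m)).fourier (by
        rw [Matrix.mul_assoc, ← Matrix.mul_assoc (phaseMat (-m)), phaseMat_mul, neg_add_cancel,
          phaseMat_zero, Matrix.one_mul, fourierMat_mul_inv]) (ν := 3) (by norm_num) (by
        rw [← tensorOp_mul (K := fun _ => fourierMat) (L := fun _ => phaseMat (-m)),
          ← Matrix.mulVec_mulVec, tensorOp_phaseMat_mulVec, tensorOp_fourierMat_mulVec])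
      (s := fun u => (-(u.2 + -m * u.1), u.1)) (s' := fun u => (u.2, -u.1 + m * u.2))
      (by clear hm; revert m; decide) (by clear hm; revert m; decide) (by
        intro u
        obtain ⟨γ, hγ⟩ := phaseMat_pauli (-m) u
        obtain ⟨δ, hδ⟩ := fourierMat_pauli (u.1, u.2 + -m * u.1)
        exact ⟨γ * δ, by rw [Matrix.mul_assoc, hγ, Matrix.mul_smul, ← Matrix.mul_assoc, hδ,
          Matrix.smul_mul, smul_smul, Matrix.mul_assoc]⟩) hu h hK
    exact key (by simpa using hm)
  rcases hc with hc | hc | hc | hc | hc | hc | hc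
  · exact (not_actsOnPauli_neg hs h hK hc).elim
  · exact (not_actsOnPauli_neg hs (mulVec_eq_of_mul h h) (hK.mul hK) hc).elim
  · exact (not_actsOnPauli_neg hs (mulVec_eq_of_mul h (mulVec_eq_of_mul h h))
      (hK.mul (hK.mul hK)) hc).elim
  · exact actsOnPauli_eq_of_fixes_Z hs hu h hK hc
  · exact hph 0 hc
  · exact hph 1 hc
  · exact hph 2 hc

theorem seedState_ne_zero {a b c : ℂ} (ha : a ≠ 0) : seedState a b c ≠ 0 := by
  intro h
  apply ha
  have := congrFun h (![0, 0, 0] : Fin 3 → Fin 3)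
  rw [seedState_apply_three] at this
  simpa [seedCoef] using this

/-- Acting trivially on labels, every factor is a multiple of a Pauli operator. The labels agree by
comparison of coefficients, and the overall scalar is 1 because equal Pauli factors fix the seed
state. -/
theorem exists_pauli_of_stabilizes {a b c : ℂ} (hs : IsSeedParameter a b c)
    {K : LocalOps qutrits} (hu : ∀ i, IsUnit (K i))
    (h : tensorOp K *ᵥ seedState a b c = seedState a b c) :
    ∃ p, tensorOp K = tensorOp (d := qutrits) fun _ => pauli p := by
  obtain ⟨g, hg⟩ := exists_actsOnPauli hs hu h
  have hid := actsOnPauli_eq_id hs hu h hg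
  have hcomm : ∀ u i, ∃ γ : ℂ, K i * 1 * pauli u = γ • (pauli u * (K i * 1)) := by
    intro u i
    obtain ⟨γ, hγ⟩ := hg i u
    rw [hid] at hγ
    exact ⟨γ, by rw [Matrix.mul_one, hγ]⟩
  obtain ⟨r, γ, hr⟩ := exists_tensorOp_pauli_of_commute (K := K) (L := fun _ => 1)
    (hcomm _) (hcomm _)
  rw [tensorOp_one, Matrix.mul_one] at hr
  have h1 : γ • (tensorOp (d := qutrits) (fun i => pauli (r i)) *ᵥ seedState a b c) =
      seedState a b c := by rw [← Matrix.smul_mulVec, ← hr, h]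
  have h2 := (pauli_eq_of_seedState_eq hs (t := 0) (γ := γ) (r := r)
    (by simpa only [zeta_zero, one_mul] using h1)).2
  have h3 : (fun i => pauli (r i)) = fun _ => pauli (r 0) := by
    ext1 i; rw [h2]
  refine ⟨r 0, ?_⟩
  rw [h3] at h1 hr
  rw [tensorOp_pauli_mulVec_seedState] at h1
  have h4 : γ = 1 := by
    have h5 : (γ - 1) • seedState a b c = 0 := by rw [sub_smul, h1, one_smul, sub_self]
    exact sub_eq_zero.mp ((smul_eq_zero.mp h5).resolve_right (seedState_ne_zero hs.ne_zero.1))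
  rw [hr, h4, one_smul]

theorem stabilizer_seedState {a b c : ℂ} (hs : IsSeedParameter a b c) :
    stabilizer (seedState a b c) =
      Set.range (fun p : Fin 3 × Fin 3 => tensorOp (d := qutrits) fun _ => pauli p) := by
  ext S
  constructor
  · rintro ⟨K, hu, rfl, h⟩
    obtain ⟨p, hp⟩ := exists_pauli_of_stabilizes hs hu h
    exact ⟨p, hp.symm⟩
  · rintro ⟨p, rfl⟩
    exact ⟨_, fun _ => isUnit_pauli p, rfl, tensorOp_pauli_mulVec_seedState p a b c⟩

theorem tensorOp_pauli_injective : Function.Injective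
    (fun p : Fin 3 × Fin 3 => tensorOp (d := qutrits) fun _ => pauli p) := by
  intro p q h
  have h0 := congrFun (congrFun h ![p.1, p.1, p.1]) (![0, 0, 0] : Fin 3 → Fin 3)
  have h1 := congrFun (congrFun h ![1 + p.1, p.1, p.1]) (![1, 0, 0] : Fin 3 → Fin 3)
  simp only [tensorOp_apply_three] at h0 h1
  simp only [pauli_apply, zero_add, add_right_inj, if_true, mul_zero, zeta_zero, mul_one] at h0 h1
  by_cases hpq : p.1 = q.1
  · simp only [hpq, if_true, mul_one] at h1
    exact Prod.ext hpq (zeta_injective h1)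
  · simp [hpq] at h0

theorem ncard_stabilizer_seedState {a b c : ℂ} (hs : IsSeedParameter a b c) :
    (stabilizer (seedState a b c)).ncard = 9 := by
  rw [stabilizer_seedState hs, ← Set.image_univ,
    Set.ncard_image_of_injective _ tensorOp_pauli_injective, Set.ncard_univ]
  simp

theorem mem_unitaryGroup_of_mem_stabilizer {a b c : ℂ} (hs : IsSeedParameter a b c) :
    ∀ S ∈ stabilizer (seedState a b c), S ∈ Matrix.unitaryGroup (Idx qutrits) ℂ := by
  rw [stabilizer_seedState hs]
  rintro _ ⟨p, rfl⟩
  rw [Matrix.mem_unitaryGroup_iff', Matrix.star_eq_conjTranspose, tensorOp_conjTranspose,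
    tensorOp_mul]
  simp only [pauli_conjTranspose_mul]
  exact tensorOp_one

/-! ### Twirling -/

theorem pauliCoef_conj (k u : Fin 3 × Fin 3) (A : Matrix (Fin 3) (Fin 3) ℂ) :
    pauliCoef u ((pauli k)ᴴ * A * pauli k) = zeta (u.2 * k.1 - k.2 * u.1) * pauliCoef u A := by
  have h : pauli k * (pauli u)ᴴ * (pauli k)ᴴ = zeta (u.2 * k.1 - k.2 * u.1) • (pauli u)ᴴ := by
    have h1 : pauli k * pauli u * (pauli k)ᴴ = zeta (k.2 * u.1 - u.2 * k.1) • pauli u := by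
      rw [pauli_mul_comm k u, Matrix.smul_mul, Matrix.mul_assoc, pauli_mul_conjTranspose,
        Matrix.mul_one]
    have h2 := congrArg Matrix.conjTranspose h1
    rw [Matrix.conjTranspose_mul, Matrix.conjTranspose_mul, Matrix.conjTranspose_conjTranspose,
      Matrix.conjTranspose_smul, ← zeta_neg, neg_sub, ← Matrix.mul_assoc] at h2
    exact h2
  calc pauliCoef u ((pauli k)ᴴ * A * pauli k)
      = ((pauli k * (pauli u)ᴴ * (pauli k)ᴴ) * A).trace := by
        rw [pauliCoef, ← Matrix.mul_assoc, Matrix.trace_mul_comm]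
        simp only [Matrix.mul_assoc]
    _ = _ := by rw [h, Matrix.smul_mul, Matrix.trace_smul, smul_eq_mul, pauliCoef]

theorem sum_zeta_symp (w : Fin 3 × Fin 3) :
    ∑ k : Fin 3 × Fin 3, zeta (w.2 * k.1 - k.2 * w.1) = if w = 0 then 9 else 0 := by
  have h : ∀ k l : Fin 3, zeta (w.2 * k - l * w.1) = zeta (k * w.2) * zeta (l * -w.1) := by
    intro k l
    rw [← zeta_add]
    congr 1
    generalize w.1 = x; generalize w.2 = y
    revert k l x y; decide
  simp only [Fintype.sum_prod_type, h, ← Finset.mul_sum, ← Finset.sum_mul, sum_zeta_mul,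
    neg_eq_zero, Prod.ext_iff, Prod.fst_zero, Prod.snd_zero]
  split_ifs <;> simp_all
  norm_num

theorem conj_pauli_apply (k : Fin 3 × Fin 3) (A : Matrix (Fin 3) (Fin 3) ℂ) (i j : Fin 3) :
    ((pauli k)ᴴ * A * pauli k) i j =
      3⁻¹ * ∑ u, pauliCoef u A * zeta (u.2 * k.1 - k.2 * u.1) * pauli u i j := by
  have h := congrFun (congrFun (sum_pauliCoef_smul ((pauli k)ᴴ * A * pauli k)) i) j
  rw [Matrix.sum_apply, Matrix.smul_apply, smul_eq_mul] at h
  rw [eq_inv_mul_iff_mul_eq₀ (by norm_num), ← h]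
  refine Finset.sum_congr rfl fun u _ => ?_
  rw [Matrix.smul_apply, pauliCoef_conj, smul_eq_mul]
  ring

/-- Conjugation multiplies the coefficient at `(u, v)` by a character evaluated at `u + v`.
Summation therefore retains only `v = -u`, and the hypothesis removes all of these except `u = 0`.
-/
theorem sum_conj_pauli_mul {A B : Matrix (Fin 3) (Fin 3) ℂ}
    (h : ∀ u, u ≠ 0 → pauliCoef u A * pauliCoef (-u) B = 0) (i i' j j' : Fin 3) :
    ∑ k, ((pauli k)ᴴ * A * pauli k) i i' * ((pauli k)ᴴ * B * pauli k) j j' =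
      pauliCoef 0 A * pauliCoef 0 B *
        ((1 : Matrix (Fin 3) (Fin 3) ℂ) i i' * (1 : Matrix (Fin 3) (Fin 3) ℂ) j j') := by
  have h1 : ∀ k : Fin 3 × Fin 3,
      ((pauli k)ᴴ * A * pauli k) i i' * ((pauli k)ᴴ * B * pauli k) j j' =
      ∑ u, ∑ v, 9⁻¹ * (pauliCoef u A * pauliCoef v B * (pauli u i i' * pauli v j j')) *
        zeta ((u + v).2 * k.1 - k.2 * (u + v).1) := by
    intro k
    rw [conj_pauli_apply, conj_pauli_apply, mul_mul_mul_comm, Finset.sum_mul_sum, Finset.mul_sum]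
    refine Finset.sum_congr rfl fun u _ => ?_
    rw [Finset.mul_sum]
    refine Finset.sum_congr rfl fun v _ => ?_
    have : zeta ((u + v).2 * k.1 - k.2 * (u + v).1) =
        zeta (u.2 * k.1 - k.2 * u.1) * zeta (v.2 * k.1 - k.2 * v.1) := by
      rw [← zeta_add]
      congr 1
      have e : ∀ a b c d x y : Fin 3, (a + b) * x - y * (c + d) = a * x - y * c + (b * x - y * d) := by
        decide
      exact e _ _ _ _ _ _
    rw [this]
    ring
  simp only [h1]
  rw [Finset.sum_comm]
  have h2 : ∀ u : Fin 3 × Fin 3, ∑ k : Fin 3 × Fin 3, ∑ v,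
      9⁻¹ * (pauliCoef u A * pauliCoef v B * (pauli u i i' * pauli v j j')) *
        zeta ((u + v).2 * k.1 - k.2 * (u + v).1) =
      pauliCoef u A * pauliCoef (-u) B * (pauli u i i' * pauli (-u) j j') := by
    intro u
    rw [Finset.sum_comm]
    simp only [← Finset.mul_sum, sum_zeta_symp]
    rw [Finset.sum_eq_single (-u)]
    · simp; ring
    · intro v _ hv
      rw [if_neg, mul_zero]
      intro h; exact hv (eq_neg_of_add_eq_zero_right h)
    · simp
  simp only [h2]
  rw [Finset.sum_eq_single 0]
  · simp [pauli_zero]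
  · intro u _ hu
    rw [h u hu, zero_mul]
  · simp

theorem pauliCoef_pair (u p q : Fin 3 × Fin 3) (z w : ℂ) :
    pauliCoef u (1 + pauliHerm p z + pauliHerm q w) =
      3 * ((if u = 0 then 1 else 0) + (if u = p then z else 0) +
        (if u = -p then star z * zeta (p.1 * p.2) else 0) + (if u = q then w else 0) +
        (if u = -q then star w * zeta (q.1 * q.2) else 0)) := by
  rw [← pauli_zero]
  simp only [pauliHerm, pauliCoef_add, pauliCoef_smul, pauli_conjTranspose, pauliCoef_pauli]
  split_ifs <;> ring

/-- Conjugates of the Gram operator `h₁ᴴ h₁ ⊗ h₂ᴴ h₂ ⊗ 1` by stabilizer elements. -/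
def twist (A B : Matrix (Fin 3) (Fin 3) ℂ) (k : Fin 3 × Fin 3) : LocalOps qutrits :=
  fun i => (pauli k)ᴴ * (![A, B, 1] : Fin 3 → Matrix (Fin 3) (Fin 3) ℂ) i * pauli k

theorem sum_tensorOp_twist {A B : Matrix (Fin 3) (Fin 3) ℂ}
    (h : ∀ u, u ≠ 0 → pauliCoef u A * pauliCoef (-u) B = 0) (hA : pauliCoef 0 A = 3)
    (hB : pauliCoef 0 B = 3) : ∑ k, tensorOp (twist A B k) = (9 : ℂ) • (1 : Op qutrits) := by
  refine Matrix.ext fun (x : Fin 3 → Fin 3) (y : Fin 3 → Fin 3) => ?_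
  have hx : x = ![x 0, x 1, x 2] := by ext i; fin_cases i <;> rfl
  have hy : y = ![y 0, y 1, y 2] := by ext i; fin_cases i <;> rfl
  rw [Matrix.sum_apply, hx, hy, ← tensorOp_one, Matrix.smul_apply]
  simp only [tensorOp_apply_three]
  have := sum_conj_pauli_mul h (x 0) (y 0) (x 1) (y 1)
  simp only [twist, Matrix.cons_val_zero, Matrix.cons_val_one, Matrix.cons_val,
    Matrix.mul_one, pauli_conjTranspose_mul]
  rw [← Finset.sum_mul, this, hA, hB, smul_eq_mul]
  ring

/-- What the analysis uses of an example pair. -/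
theorem IsExamplePair.exists_coef {h₁ h₂ : Matrix (Fin 3) (Fin 3) ℂ} (h : IsExamplePair h₁ h₂) :
    ∃ p : Fin 4 → Fin 3 × Fin 3,
      (Pairwise fun i j => (p i).1 * (p j).2 ≠ (p i).2 * (p j).1) ∧
      pauliCoef 0 (h₁ᴴ * h₁) = 3 ∧ pauliCoef 0 (h₂ᴴ * h₂) = 3 ∧
      (∀ u, pauliCoef u (h₁ᴴ * h₁) ≠ 0 ↔ u = 0 ∨ u = p 0 ∨ u = -p 0 ∨ u = p 1 ∨ u = -p 1) ∧
      (∀ u, pauliCoef u (h₂ᴴ * h₂) ≠ 0 ↔ u = 0 ∨ u = p 2 ∨ u = -p 2 ∨ u = p 3 ∨ u = -p 3) := by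
  obtain ⟨-, -, p, z, hp, hz, h1, h2⟩ := h
  have key1 : ∀ p q : Fin 3 × Fin 3, p.1 * q.2 ≠ p.2 * q.1 →
      p ≠ 0 ∧ p ≠ -p ∧ p ≠ q ∧ p ≠ -q := by decide
  have key2 : ∀ p q : Fin 3 × Fin 3, p.1 * q.2 ≠ p.2 * q.1 →
      q ≠ 0 ∧ q ≠ -q ∧ q ≠ p ∧ q ≠ -p := by decide
  have key3 : ∀ p q : Fin 3 × Fin 3, p.1 * q.2 ≠ p.2 * q.1 →
      -p ≠ 0 ∧ -p ≠ p ∧ -p ≠ q ∧ -p ≠ -q := by decide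
  have key4 : ∀ p q : Fin 3 × Fin 3, p.1 * q.2 ≠ p.2 * q.1 →
      -q ≠ 0 ∧ -q ≠ q ∧ -q ≠ p ∧ -q ≠ -p := by decide
  have main : ∀ (p q : Fin 3 × Fin 3) (z w : ℂ), p.1 * q.2 ≠ p.2 * q.1 → z ≠ 0 → w ≠ 0 →
      pauliCoef 0 (1 + pauliHerm p z + pauliHerm q w) = 3 ∧
      ∀ u, pauliCoef u (1 + pauliHerm p z + pauliHerm q w) ≠ 0 ↔
        u = 0 ∨ u = p ∨ u = -p ∨ u = q ∨ u = -q := by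
    intro p q z w hpq hz hw
    constructor
    · obtain ⟨hp, -⟩ := key1 p q hpq
      obtain ⟨hq, -⟩ := key2 p q hpq
      rw [pauliCoef_pair, if_pos rfl, if_neg hp.symm, if_neg hq.symm,
        if_neg (by simpa [eq_comm] using hp), if_neg (by simpa [eq_comm] using hq)]
      norm_num
    · intro u
      rw [pauliCoef_pair]
      have hz' : star z * zeta (p.1 * p.2) ≠ 0 :=
        mul_ne_zero (star_ne_zero.mpr hz) (zeta_ne_zero _)
      have hw' : star w * zeta (q.1 * q.2) ≠ 0 :=
        mul_ne_zero (star_ne_zero.mpr hw) (zeta_ne_zero _)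
      by_cases c1 : u = p
      · obtain ⟨a1, a2, a3, a4⟩ := key1 p q hpq
        rw [c1, if_neg a1, if_pos rfl, if_neg a2, if_neg a3, if_neg a4]
        simp [hz]
      by_cases c2 : u = -p
      · obtain ⟨a1, a2, a3, a4⟩ := key3 p q hpq
        rw [c2, if_neg a1, if_neg a2, if_pos rfl, if_neg a3, if_neg a4]
        simpa using hz'
      by_cases c3 : u = q
      · obtain ⟨a1, a2, a3, a4⟩ := key2 p q hpq
        rw [c3, if_neg a1, if_neg a3, if_neg a4, if_pos rfl, if_neg a2]
        simp [hw]
      by_cases c4 : u = -q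
      · obtain ⟨a1, a2, a3, a4⟩ := key4 p q hpq
        rw [c4, if_neg a1, if_neg a3, if_neg a4, if_neg a2, if_pos rfl]
        simpa using hw'
      rw [if_neg c1, if_neg c2, if_neg c3, if_neg c4]
      by_cases c0 : u = 0
      · simp [c0]
      · simp [c0, c1, c2, c3, c4]
  obtain ⟨a1, a2⟩ := main (p 0) (p 1) (z 0) (z 1) (hp (by decide)) (hz 0) (hz 1)
  obtain ⟨b1, b2⟩ := main (p 2) (p 3) (z 2) (z 3) (hp (by decide)) (hz 2) (hz 3)
  rw [← h1] at a1 a2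
  rw [← h2] at b1 b2
  exact ⟨p, hp, a1, b1, a2, b2⟩

theorem IsExamplePair.coef_mul_coef_neg {h₁ h₂ : Matrix (Fin 3) (Fin 3) ℂ}
    (h : IsExamplePair h₁ h₂) (u : Fin 3 × Fin 3) (hu : u ≠ 0) :
    pauliCoef u (h₁ᴴ * h₁) * pauliCoef (-u) (h₂ᴴ * h₂) = 0 := by
  obtain ⟨p, hp, -, -, h1, h2⟩ := h.exists_coef
  by_contra hne
  rw [mul_eq_zero, not_or] at hne
  have c1 := ((h1 u).mp hne.1).resolve_left hu
  have c2 := ((h2 (-u)).mp hne.2).resolve_left (neg_ne_zero.mpr hu)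
  have key : ∀ a b u : Fin 3 × Fin 3, a.1 * b.2 ≠ a.2 * b.1 → (u = a ∨ u = -a) →
      (-u = b ∨ -u = -b) → False := by decide
  rw [← or_assoc] at c1 c2
  rcases c1 with c | c <;> rcases c2 with d | d
  · exact key _ _ u (hp (by decide)) c d
  · exact key _ _ u (hp (by decide)) c d
  · exact key _ _ u (hp (by decide)) c d
  · exact key _ _ u (hp (by decide)) c d

/-! ### Conversion by a separable map with invertible Kraus operators -/

theorem IsSEP₁.of_fintype {n : ℕ} {d : Fin n → ℕ} {ι : Type*} [Fintype ι] (K : ι → LocalOps d)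
    (hu : ∀ k i, IsUnit (K k i)) (h : ∑ k, (tensorOp (K k))ᴴ * tensorOp (K k) = 1) :
    IsSEP₁ d fun X => ∑ k, tensorOp (K k) * X * (tensorOp (K k))ᴴ := by
  refine ⟨Fintype.card ι, fun k => K ((Fintype.equivFin ι).symm k), fun k i => hu _ i, ?_, ?_⟩
  · rw [← h, ← Equiv.sum_comp (Fintype.equivFin ι).symm]
  · intro X
    exact (Equiv.sum_comp (Fintype.equivFin ι).symm
      fun k => tensorOp (K k) * X * (tensorOp (K k))ᴴ).symm

theorem IsSEP₁.isSEP {n : ℕ} {d : Fin n → ℕ} {Λ : Op d → Op d} (h : IsSEP₁ d Λ) : IsSEP d Λ := by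
  obtain ⟨r, K, -, h1, h2⟩ := h
  exact ⟨r, K, h1, h2⟩

theorem mul_vecMulVec_conj {m : Type*} [Fintype m] (A : Matrix m m ℂ) (v : m → ℂ) :
    A * Matrix.vecMulVec v (star v) * Aᴴ = Matrix.vecMulVec (A *ᵥ v) (star (A *ᵥ v)) := by
  rw [Matrix.mul_vecMulVec, Matrix.vecMulVec_mul, Matrix.star_mulVec]

theorem trace_sum_conj {m ι : Type*} [Fintype m] [DecidableEq m] (s : Finset ι)
    (K : ι → Matrix m m ℂ) (h : ∑ k ∈ s, (K k)ᴴ * K k = 1) (X : Matrix m m ℂ) :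
    (∑ k ∈ s, K k * X * (K k)ᴴ).trace = X.trace := by
  calc _ = ∑ k ∈ s, ((K k)ᴴ * K k * X).trace := by
        rw [Matrix.trace_sum]
        refine Finset.sum_congr rfl fun k _ => ?_
        rw [Matrix.trace_mul_comm, Matrix.mul_assoc]
    _ = X.trace := by rw [← Matrix.trace_sum, ← Finset.sum_mul, h, Matrix.one_mul]

theorem sum_mul_star_eq_trace {m : Type*} [Fintype m] (v : m → ℂ) :
    ∑ x, v x * star (v x) = (Matrix.vecMulVec v (star v)).trace := by
  simp [Matrix.trace, Matrix.vecMulVec_apply]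

/-- Each stabilizer element followed by `h / 3` is one Kraus operator, and all nine send the seed
state to the same vector. Only completeness needs the choice of `h₁` and `h₂`, through the twirl. -/
theorem convSEP₁_applyPair (a b c : ℂ) {h₁ h₂ : Matrix (Fin 3) (Fin 3) ℂ}
    (h : IsExamplePair h₁ h₂) :
    ConvSEP₁ qutrits (seedState a b c) (applyPair h₁ h₂ (seedState a b c)) := by
  obtain ⟨p, -, hA, hB, -, -⟩ := h.exists_coef
  set K : Fin 3 × Fin 3 → LocalOps qutrits := fun k i =>
    (![(3 : ℂ)⁻¹, 1, 1] : Fin 3 → ℂ) i •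
      ((![h₁, h₂, 1] : Fin 3 → Matrix (Fin 3) (Fin 3) ℂ) i * pauli k) with hK
  have hKt : ∀ k, tensorOp (K k) = (3 : ℂ)⁻¹ • (tensorOp (d := qutrits) ![h₁, h₂, 1] *
      tensorOp (d := qutrits) fun _ => pauli k) := by
    intro k
    rw [tensorOp_mul, hK, tensorOp_smul]
    congr 1
    simp [Fin.prod_univ_three]
  have hsum : ∑ k, (tensorOp (K k))ᴴ * tensorOp (K k) = 1 := by
    have h1 : ∀ k, (tensorOp (K k))ᴴ * tensorOp (K k) =
        (9 : ℂ)⁻¹ • tensorOp (twist (h₁ᴴ * h₁) (h₂ᴴ * h₂) k) := by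
      intro k
      rw [hKt, Matrix.conjTranspose_smul, Matrix.smul_mul, Matrix.mul_smul, smul_smul,
        tensorOp_mul, tensorOp_conjTranspose, tensorOp_mul]
      congr 1
      · norm_num
      · congr 1
        ext1 i
        fin_cases i <;> simp [twist, Matrix.conjTranspose_mul, Matrix.mul_assoc]
    simp only [h1]
    rw [← Finset.smul_sum, sum_tensorOp_twist h.coef_mul_coef_neg hA hB, smul_smul]
    norm_num
  refine ⟨_, IsSEP₁.of_fintype K ?_ hsum, ?_⟩
  · intro k i
    have : (![(3 : ℂ)⁻¹, 1, 1] : Fin 3 → ℂ) i ≠ 0 := by fin_cases i <;> simp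
    refine (IsUnit.mul ?_ (isUnit_pauli k)).smul (Units.mk0 _ this)
    fin_cases i
    · exact h.1
    · exact h.2.1
    · exact isUnit_one
  · set ψ := seedState a b c
    set φ := applyPair h₁ h₂ ψ with hφ
    have hKψ : ∀ k, tensorOp (K k) *ᵥ ψ = (3 : ℂ)⁻¹ • φ := by
      intro k
      rw [hKt, Matrix.smul_mulVec, ← Matrix.mulVec_mulVec, tensorOp_pauli_mulVec_seedState]
      rfl
    have hmap : ∑ k, tensorOp (K k) * Matrix.vecMulVec ψ (star ψ) * (tensorOp (K k))ᴴ =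
        Matrix.vecMulVec φ (star φ) := by
      simp only [mul_vecMulVec_conj, hKψ]
      rw [Finset.sum_const, Finset.card_univ, star_smul, Matrix.smul_vecMulVec,
        Matrix.vecMulVec_smul, smul_smul, ← Nat.cast_smul_eq_nsmul ℂ, smul_smul]
      norm_num
    -- Trace preservation shows that source and target have equal norm, so the two normalizations
    -- agree.
    have hnorm : ∑ x, ψ x * star (ψ x) = ∑ x, φ x * star (φ x) := by
      rw [sum_mul_star_eq_trace, sum_mul_star_eq_trace, ← hmap]
      exact (trace_sum_conj _ _ hsum _).symm
    simp only [density, Matrix.mul_smul, Matrix.smul_mul]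
    rw [← Finset.smul_sum, hmap, hnorm]

theorem ConvSEP₁.convSEP {n : ℕ} {d : Fin n → ℕ} {ψ φ : StateVec d} (h : ConvSEP₁ d ψ φ) :
    ConvSEP d ψ φ := by
  obtain ⟨Λ, h1, h2⟩ := h
  exact ⟨Λ, h1.isSEP, h2⟩

/-! ### Full entanglement -/

open scoped ComplexOrder in
-- A reduced density matrix is the Gram matrix of the slices along that party, so full rank means
-- that these slices are independent.
theorem rank_gram {ι : Type*} [Fintype ι] (f : Fin 3 → ι → ℂ)
    (h : ∀ u : Fin 3 → ℂ, (∀ j, ∑ s, u s * f s j = 0) → u = 0)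
    {R : Matrix (Fin 3) (Fin 3) ℂ} (hR : ∀ s t, R s t = ∑ j, f s j * star (f t j)) :
    R.rank = 3 := by
  have h1 : R = Matrix.of f * (Matrix.of f)ᴴ := by
    ext s t
    simp [hR, Matrix.mul_apply]
  rw [h1, Matrix.rank_self_mul_conjTranspose]
  have : LinearIndependent ℂ (Matrix.of f).row := by
    rw [Fintype.linearIndependent_iff]
    intro u hu
    have := h u fun j => by simpa [Matrix.row] using congrFun hu j
    intro i; rw [this]; rfl
  simpa using this.rank_matrix

theorem slice_seedState_eq_zero {a b c : ℂ} (ha : a ≠ 0) {x : Fin 3 → ℂ}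
    (h : slice (seedState a b c) x = 0) : x = 0 := by
  rw [slice_seedState] at h
  ext i
  have := congrFun (congrFun h i) i
  fin_cases i <;> simpa [ha] using this

theorem slice_tensorOp_seedState_eq_zero {a b c : ℂ} (ha : a ≠ 0) {K : LocalOps qutrits}
    (hu : ∀ i, IsUnit (K i)) {x : Fin 3 → ℂ}
    (h : slice (tensorOp K *ᵥ seedState a b c) x = 0) : x = 0 := by
  rw [slice_tensorOp] at h
  have h2 : IsUnit (K 2)ᵀ := (Matrix.isUnit_transpose (K 2)).mpr (hu 2)
  rw [h2.mul_left_eq_zero, (hu 1).mul_right_eq_zero] at h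
  have h3 := slice_seedState_eq_zero ha h
  have h0 : IsUnit (K 0)ᵀ := (Matrix.isUnit_transpose (K 0)).mpr (hu 0)
  exact (Matrix.mulVec_injective_iff_isUnit.mpr h0) (by rw [h3, Matrix.mulVec_zero])

theorem reducedDensity_zero (χ : StateVec qutrits) (s t : Fin 3) :
    reducedDensity χ 0 s t = ∑ j : Fin 3, ∑ k : Fin 3, χ ![s, j, k] * star (χ ![t, j, k]) := by
  rw [reducedDensity, sum_idx, Finset.sum_eq_single s]
  · refine Finset.sum_congr rfl fun j _ => Finset.sum_congr rfl fun k _ => ?_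
    refine (if_pos rfl).trans ?_
    congr 3
    ext i; fin_cases i <;> rfl
  · intro i _ hi
    refine Finset.sum_eq_zero fun j _ => Finset.sum_eq_zero fun k _ => if_neg hi
  · simp

theorem reducedDensity_one (χ : StateVec qutrits) (s t : Fin 3) :
    reducedDensity χ 1 s t = ∑ i : Fin 3, ∑ k : Fin 3, χ ![i, s, k] * star (χ ![i, t, k]) := by
  rw [reducedDensity, sum_idx]
  refine Finset.sum_congr rfl fun i _ => ?_
  rw [Finset.sum_eq_single s]
  · refine Finset.sum_congr rfl fun k _ => ?_
    refine (if_pos rfl).trans ?_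
    congr 3
    ext i; fin_cases i <;> rfl
  · intro j _ hj
    refine Finset.sum_eq_zero fun k _ => if_neg hj
  · simp

theorem reducedDensity_two (χ : StateVec qutrits) (s t : Fin 3) :
    reducedDensity χ 2 s t = ∑ i : Fin 3, ∑ j : Fin 3, χ ![i, j, s] * star (χ ![i, j, t]) := by
  rw [reducedDensity, sum_idx]
  refine Finset.sum_congr rfl fun i _ => Finset.sum_congr rfl fun j _ => ?_
  rw [Finset.sum_eq_single s]
  · refine (if_pos rfl).trans ?_
    congr 3
    ext i; fin_cases i <;> rfl
  · intro k _ hk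
    exact if_neg hk
  · simp

theorem tensorOp_rotate_mulVec_apply (a b c : ℂ) (K : LocalOps qutrits) (i j k : Fin 3) :
    (tensorOp (d := qutrits) (fun l => K (rotate l)) *ᵥ seedState a b c) ![j, k, i] =
      (tensorOp K *ᵥ seedState a b c) ![i, j, k] := by
  rw [← tensorOp_rotate_mulVec a b c K ![i, j, k]]
  congr 1
  ext l; fin_cases l <;> rfl

theorem fullyEntangled_tensorOp_seedState {a b c : ℂ} (ha : a ≠ 0) {K : LocalOps qutrits}
    (hu : ∀ i, IsUnit (K i)) : FullyEntangled (tensorOp K *ᵥ seedState a b c) := by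
  have key : ∀ L : LocalOps qutrits, (∀ i, IsUnit (L i)) → ∀ u : Fin 3 → ℂ,
      (∀ j : Fin 3 × Fin 3, ∑ s, u s * (tensorOp L *ᵥ seedState a b c) ![s, j.1, j.2] = 0) →
        u = 0 := by
    intro L hL u h
    apply slice_tensorOp_seedState_eq_zero ha hL
    ext j k
    exact h (j, k)
  constructor
  · intro h0
    have := key K hu (fun _ => 1) (fun j => by simp [h0])
    exact one_ne_zero (congrFun this 0)
  · intro i
    fin_cases i
    · exact rank_gram _ (key K hu) fun s t => by
        rw [Fintype.sum_prod_type]; exact reducedDensity_zero _ s t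
    · refine rank_gram _ (key _ fun i => hu (rotate i)) fun s t => ?_
      rw [Fintype.sum_prod_type, Finset.sum_comm]
      simp only [tensorOp_rotate_mulVec_apply a b c K]
      exact reducedDensity_one _ s t
    · refine rank_gram _ (key _ fun i => hu (rotate (rotate i))) fun s t => ?_
      rw [Fintype.sum_prod_type]
      simp only [tensorOp_rotate_mulVec_apply a b c fun i => K (rotate i),
        tensorOp_rotate_mulVec_apply a b c K]
      exact reducedDensity_two _ s t

theorem IsExamplePair.isUnit {h₁ h₂ : Matrix (Fin 3) (Fin 3) ℂ} (h : IsExamplePair h₁ h₂) (i : Fin 3) :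
    IsUnit ((![h₁, h₂, 1] : Fin 3 → Matrix (Fin 3) (Fin 3) ℂ) i) := by
  fin_cases i
  · exact h.1
  · exact h.2.1
  · exact isUnit_one

theorem fullyEntangled_seedState {a b c : ℂ} (ha : a ≠ 0) : FullyEntangled (seedState a b c) := by
  have := fullyEntangled_tensorOp_seedState (b := b) (c := c) ha (K := fun _ => 1)
    fun _ => isUnit_one
  rwa [tensorOp_one, Matrix.one_mulVec] at this

/-! ### Existence of parameters -/

theorem exists_isSeedParameter : ∃ a b c : ℂ, IsSeedParameter a b c := by
  refine ⟨1, 2, 3, ?_⟩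
  refine ⟨by norm_num, by norm_num, by norm_num, by norm_num, by norm_num, ?_⟩
  rintro ⟨h, -⟩
  norm_num at h

open scoped ComplexOrder MatrixOrder Matrix.Norms.L2Operator in
-- `W + W† = (1 + W)† (1 + W) - 2`, so two such terms with weight 1/8 subtract at most 1/2 from the
-- identity. The operator is positive definite and hence a Gram operator of an invertible matrix.
theorem exists_gram_pauliHerm (p q : Fin 3 × Fin 3) :
    ∃ h : Matrix (Fin 3) (Fin 3) ℂ, IsUnit h ∧
      hᴴ * h = 1 + pauliHerm p (1 / 8) + pauliHerm q (1 / 8) := by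
  have hpd : (1 + pauliHerm p (1 / 8) + pauliHerm q (1 / 8)).PosDef := by
    have e : ∀ r, ((1 + pauli r)ᴴ * (1 + pauli r)) = (2 : ℂ) • 1 + (8 : ℂ) • pauliHerm r (1 / 8) := by
      intro r
      rw [Matrix.conjTranspose_add, Matrix.conjTranspose_one, Matrix.add_mul, Matrix.one_mul,
        Matrix.mul_add, Matrix.mul_one, pauli_conjTranspose_mul, pauliHerm]
      have : star (1 / 8 : ℂ) = 1 / 8 := by simp
      rw [this, smul_add, smul_smul, smul_smul, two_smul]
      norm_num
      rw [← one_add_one_eq_two]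
      abel
    have h1 : 1 + pauliHerm p (1 / 8) + pauliHerm q (1 / 8) = (1 / 2 : ℝ) • (1 : Matrix (Fin 3) (Fin 3) ℂ) +
        ((1 / 8 : ℝ) • ((1 + pauli p)ᴴ * (1 + pauli p)) +
          (1 / 8 : ℝ) • ((1 + pauli q)ᴴ * (1 + pauli q))) := by
      rw [e, e]
      ext i j
      simp
      ring
    rw [h1]
    exact (Matrix.PosDef.one.smul (by norm_num)).add_posSemidef
      (((Matrix.posSemidef_conjTranspose_mul_self _).smul (by norm_num)).add
        ((Matrix.posSemidef_conjTranspose_mul_self _).smul (by norm_num)))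
  obtain ⟨h, hh⟩ := CStarAlgebra.nonneg_iff_eq_star_mul_self.mp hpd.posSemidef.nonneg
  refine ⟨h, ?_, hh.symm⟩
  have := hpd.isUnit
  rw [hh] at this
  exact isUnit_of_mul_isUnit_right this

theorem exists_isExamplePair : ∃ h₁ h₂ : Matrix (Fin 3) (Fin 3) ℂ, IsExamplePair h₁ h₂ := by
  obtain ⟨h₁, u₁, e₁⟩ := exists_gram_pauliHerm (1, 0) (0, 1)
  obtain ⟨h₂, u₂, e₂⟩ := exists_gram_pauliHerm (1, 1) (1, 2)
  refine ⟨h₁, h₂, u₁, u₂, ![(1, 0), (0, 1), (1, 1), (1, 2)], fun _ => 1 / 8, ?_, fun _ => by norm_num,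
    e₁, e₂⟩
  intro i j
  revert i j
  decide

/-! ### Squared norms -/

section SquaredNorm

variable {ι κ : Type*} [Fintype ι] [Fintype κ]

/-- The squared Euclidean norm of a vector. -/
def nsq (v : ι → ℂ) : ℝ := ∑ i, ‖v i‖ ^ 2

theorem nsq_nonneg (v : ι → ℂ) : 0 ≤ nsq v := Finset.sum_nonneg fun _ _ => sq_nonneg _

theorem nsq_eq_zero {v : ι → ℂ} : nsq v = 0 ↔ v = 0 := by
  rw [nsq, Finset.sum_eq_zero_iff_of_nonneg fun _ _ => sq_nonneg _]
  simp [funext_iff]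

@[simp] theorem nsq_zero : nsq (0 : ι → ℂ) = 0 := nsq_eq_zero.mpr rfl

theorem nsq_pos {v : ι → ℂ} : 0 < nsq v ↔ v ≠ 0 := by
  rw [(nsq_nonneg v).lt_iff_ne, ne_comm, ne_eq, nsq_eq_zero]

theorem nsq_smul (c : ℂ) (v : ι → ℂ) : nsq (c • v) = ‖c‖ ^ 2 * nsq v := by
  simp [nsq, mul_pow, Finset.mul_sum]

theorem nsq_star (v : ι → ℂ) : nsq (star v) = nsq v := by simp [nsq]

theorem ofReal_nsq (v : ι → ℂ) : (nsq v : ℂ) = star v ⬝ᵥ v := by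
  simp only [nsq, dotProduct, Pi.star_apply, Complex.ofReal_sum, Complex.ofReal_pow]
  exact Finset.sum_congr rfl fun i _ => (Complex.conj_mul' (v i)).symm

theorem continuous_nsq : Continuous (nsq : (ι → ℂ) → ℝ) := by
  unfold nsq; fun_prop

theorem exists_unit_smul {v : ι → ℂ} (hv : v ≠ 0) :
    ∃ (r : ℝ) (w : ι → ℂ), 0 < r ∧ nsq w = 1 ∧ v = (r : ℂ) • w ∧ nsq v = r ^ 2 := by
  have h := nsq_pos.mpr hv
  have hr : 0 < Real.sqrt (nsq v) := Real.sqrt_pos.mpr h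
  have hr' : ((Real.sqrt (nsq v) : ℝ) : ℂ) ≠ 0 := Complex.ofReal_ne_zero.mpr hr.ne'
  refine ⟨Real.sqrt (nsq v), ((Real.sqrt (nsq v) : ℝ) : ℂ)⁻¹ • v, hr, ?_, ?_, ?_⟩
  · rw [nsq_smul, norm_inv, Complex.norm_of_nonneg hr.le, inv_pow, Real.sq_sqrt h.le,
      inv_mul_cancel₀ h.ne']
  · rw [smul_smul, mul_inv_cancel₀ hr', one_smul]
  · rw [Real.sq_sqrt h.le]

theorem norm_le_one_of_nsq {v : ι → ℂ} (h : nsq v = 1) (i : ι) : ‖v i‖ ≤ 1 := by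
  have h1 : ‖v i‖ ^ 2 ≤ nsq v :=
    Finset.single_le_sum (f := fun i => ‖v i‖ ^ 2) (fun _ _ => sq_nonneg _) (Finset.mem_univ i)
  rw [h] at h1
  exact (sq_le_one_iff₀ (norm_nonneg _)).mp h1

theorem isCompact_nsq_eq_one : IsCompact {v : ι → ℂ | nsq v = 1} := by
  refine (isCompact_univ_pi fun _ : ι => isCompact_closedBall (0 : ℂ) 1).of_isClosed_subset
    (isClosed_eq continuous_nsq continuous_const) fun v hv i _ => ?_
  rw [mem_closedBall_zero_iff]
  exact norm_le_one_of_nsq hv i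

/-- The squared Frobenius norm of a matrix. -/
def frobSq (A : Matrix κ ι ℂ) : ℝ := ∑ i, nsq fun j => A i j

theorem frobSq_nonneg (A : Matrix κ ι ℂ) : 0 ≤ frobSq A :=
  Finset.sum_nonneg fun _ _ => nsq_nonneg _

theorem frobSq_eq_zero {A : Matrix κ ι ℂ} : frobSq A = 0 ↔ A = 0 := by
  rw [frobSq, Finset.sum_eq_zero_iff_of_nonneg fun _ _ => nsq_nonneg _]
  simp only [nsq_eq_zero, Finset.mem_univ, true_implies]
  exact ⟨fun h => funext h, fun h i => by rw [h]; rfl⟩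

theorem frobSq_smul (c : ℂ) (A : Matrix κ ι ℂ) : frobSq (c • A) = ‖c‖ ^ 2 * frobSq A := by
  rw [frobSq, frobSq, Finset.mul_sum]
  exact Finset.sum_congr rfl fun i _ => nsq_smul c _

theorem frobSq_eq_uncurry (A : Matrix κ ι ℂ) : frobSq A = nsq fun p : κ × ι => A p.1 p.2 := by
  simp [frobSq, nsq, Fintype.sum_prod_type]

theorem continuous_frobSq : Continuous (frobSq : Matrix κ ι ℂ → ℝ) := by
  unfold frobSq nsq; fun_prop

theorem ofReal_frobSq (A : Matrix κ ι ℂ) : (frobSq A : ℂ) = (Aᴴ * A).trace := by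
  simp only [frobSq, nsq, Matrix.trace, Matrix.diag_apply, Matrix.mul_apply,
    Matrix.conjTranspose_apply, Complex.ofReal_sum, Complex.ofReal_pow]
  rw [Finset.sum_comm]
  exact Finset.sum_congr rfl fun i _ => Finset.sum_congr rfl fun j _ =>
    (Complex.conj_mul' (A j i)).symm

theorem isCompact_frobSq_eq_one : IsCompact {A : Matrix κ ι ℂ | frobSq A = 1} := by
  have hc : IsCompact (Set.univ.pi fun _ : κ => Set.univ.pi fun _ : ι => Metric.closedBall (0 : ℂ) 1) :=
    isCompact_univ_pi fun _ => isCompact_univ_pi fun _ => isCompact_closedBall (0 : ℂ) 1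
  refine hc.of_isClosed_subset (isClosed_eq continuous_frobSq continuous_const)
    fun A hA i _ j _ => ?_
  rw [mem_closedBall_zero_iff]
  exact norm_le_one_of_nsq (v := fun p : κ × ι => A p.1 p.2)
    ((frobSq_eq_uncurry A).symm.trans hA) (i, j)

theorem exists_frob_unit_smul {A : Matrix κ ι ℂ} (hA : A ≠ 0) :
    ∃ (r : ℝ) (B : Matrix κ ι ℂ), 0 < r ∧ frobSq B = 1 ∧ A = (r : ℂ) • B ∧ frobSq A = r ^ 2 := by
  have h : 0 < frobSq A := (frobSq_nonneg A).lt_of_ne' (frobSq_eq_zero.not.mpr hA)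
  have hr : 0 < Real.sqrt (frobSq A) := Real.sqrt_pos.mpr h
  have hr' : ((Real.sqrt (frobSq A) : ℝ) : ℂ) ≠ 0 := Complex.ofReal_ne_zero.mpr hr.ne'
  refine ⟨Real.sqrt (frobSq A), ((Real.sqrt (frobSq A) : ℝ) : ℂ)⁻¹ • A, hr, ?_, ?_, ?_⟩
  · rw [frobSq_smul, norm_inv, Complex.norm_of_nonneg hr.le, inv_pow, Real.sq_sqrt h.le,
      inv_mul_cancel₀ h.ne']
  · rw [smul_smul, mul_inv_cancel₀ hr', one_smul]
  · rw [Real.sq_sqrt h.le]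

theorem ofReal_nsq_mulVec (A : Matrix κ ι ℂ) (v : ι → ℂ) :
    (nsq (A *ᵥ v) : ℂ) = star v ⬝ᵥ ((Aᴴ * A) *ᵥ v) := by
  rw [ofReal_nsq, Matrix.star_mulVec, Matrix.dotProduct_mulVec, Matrix.dotProduct_mulVec,
    Matrix.vecMul_vecMul]

/-- All estimates see a local operator only through its Gram operator, which makes the correcting
unitaries of a protocol invisible. -/
theorem nsq_mulVec_congr {μ : Type*} [Fintype μ] {A : Matrix κ ι ℂ} {B : Matrix μ ι ℂ}
    (h : Aᴴ * A = Bᴴ * B) (v : ι → ℂ) : nsq (A *ᵥ v) = nsq (B *ᵥ v) := by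
  have : (nsq (A *ᵥ v) : ℂ) = nsq (B *ᵥ v) := by rw [ofReal_nsq_mulVec, ofReal_nsq_mulVec, h]
  exact_mod_cast this

theorem frobSq_congr {μ : Type*} [Fintype μ] {A : Matrix κ ι ℂ} {B : Matrix μ ι ℂ}
    (h : Aᴴ * A = Bᴴ * B) : frobSq A = frobSq B := by
  have : (frobSq A : ℂ) = frobSq B := by rw [ofReal_frobSq, ofReal_frobSq, h]
  exact_mod_cast this

theorem sum_nsq_mulVec {α : Type*} (s : Finset α) (A : α → Matrix κ ι ℂ) {B : Matrix κ ι ℂ}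
    (h : ∑ k ∈ s, (A k)ᴴ * A k = Bᴴ * B) (v : ι → ℂ) :
    ∑ k ∈ s, nsq (A k *ᵥ v) = nsq (B *ᵥ v) := by
  have : ((∑ k ∈ s, nsq (A k *ᵥ v) : ℝ) : ℂ) = nsq (B *ᵥ v) := by
    rw [Complex.ofReal_sum]
    simp only [ofReal_nsq_mulVec]
    rw [← h, Matrix.sum_mulVec, dotProduct_sum]
  exact_mod_cast this

theorem sum_frobSq {α : Type*} (s : Finset α) (A : α → Matrix κ ι ℂ) {B : Matrix κ ι ℂ}
    (h : ∑ k ∈ s, (A k)ᴴ * A k = Bᴴ * B) : ∑ k ∈ s, frobSq (A k) = frobSq B := by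
  have : ((∑ k ∈ s, frobSq (A k) : ℝ) : ℂ) = frobSq B := by
    rw [Complex.ofReal_sum]
    simp only [ofReal_frobSq]
    rw [← h, Matrix.trace_sum]
  exact_mod_cast this

/-! ### The defect of a vector from a line -/

/-- Vanishes exactly when `χ` is a multiple of `φ`, for `φ ≠ 0`. -/
def defect (φ χ : ι → ℂ) : ℝ := nsq χ * nsq φ - ‖star φ ⬝ᵥ χ‖ ^ 2

/-- The vector on the left is the part of `χ` orthogonal to `φ`, rescaled. Nonnegativity of its norm
is the Cauchy–Schwarz inequality, and its vanishing is the equality case. -/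
theorem nsq_mul_defect (φ χ : ι → ℂ) :
    nsq ((nsq φ : ℂ) • χ - (star φ ⬝ᵥ χ) • φ) = nsq φ * defect φ χ := by
  have h1 : star χ ⬝ᵥ φ = star (star φ ⬝ᵥ χ) := by
    rw [Matrix.star_dotProduct]
  have h2 : ((‖star φ ⬝ᵥ χ‖ ^ 2 : ℝ) : ℂ) = star (star φ ⬝ᵥ χ) * (star φ ⬝ᵥ χ) := by
    rw [Complex.ofReal_pow]; exact (Complex.conj_mul' _).symm
  have h3 : star (nsq φ : ℂ) = nsq φ := Complex.conj_ofReal _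
  have : (nsq ((nsq φ : ℂ) • χ - (star φ ⬝ᵥ χ) • φ) : ℂ) = (nsq φ * defect φ χ : ℝ) := by
    rw [defect, ofReal_nsq ((nsq φ : ℂ) • χ - (star φ ⬝ᵥ χ) • φ)]
    push_cast
    rw [← Complex.ofReal_pow, h2]
    simp only [star_sub, star_smul, sub_dotProduct, dotProduct_sub, smul_dotProduct,
      dotProduct_smul, smul_eq_mul, h3, h1, ← ofReal_nsq]
    ring
  exact_mod_cast this

theorem defect_nonneg (φ χ : ι → ℂ) : 0 ≤ defect φ χ := by
  by_cases h : φ = 0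
  · simp [h, defect]
  · have h1 := nsq_nonneg ((nsq φ : ℂ) • χ - (star φ ⬝ᵥ χ) • φ)
    rw [nsq_mul_defect] at h1
    exact nonneg_of_mul_nonneg_right h1 (nsq_pos.mpr h)

theorem exists_eq_smul_of_defect_eq_zero {φ χ : ι → ℂ} (hφ : φ ≠ 0) (h : defect φ χ = 0) :
    ∃ c : ℂ, χ = c • φ := by
  have h1 := nsq_mul_defect φ χ
  rw [h, mul_zero, nsq_eq_zero, sub_eq_zero] at h1
  have h2 : (nsq φ : ℂ) ≠ 0 := Complex.ofReal_ne_zero.mpr (nsq_pos.mpr hφ).ne'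
  refine ⟨(nsq φ : ℂ)⁻¹ * (star φ ⬝ᵥ χ), ?_⟩
  rw [mul_smul, ← h1, smul_smul, inv_mul_cancel₀ h2, one_smul]

theorem defect_smul (c : ℂ) (φ χ : ι → ℂ) : defect φ (c • χ) = ‖c‖ ^ 2 * defect φ χ := by
  rw [defect, defect, nsq_smul, dotProduct_smul, norm_smul]
  ring

theorem defect_self_smul (c : ℂ) (φ : ι → ℂ) : defect φ (c • φ) = 0 := by
  rw [defect_smul, defect, ← ofReal_nsq, Complex.norm_of_nonneg (nsq_nonneg φ)]
  ring

theorem continuous_defect (φ : ι → ℂ) : Continuous (defect φ) := by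
  unfold defect dotProduct
  have := continuous_nsq (ι := ι)
  fun_prop

theorem norm_star_dotProduct_sq_le (φ χ : ι → ℂ) : ‖star φ ⬝ᵥ χ‖ ^ 2 ≤ nsq χ * nsq φ :=
  sub_nonneg.mp (defect_nonneg φ χ)

theorem nsq_mulVec_le (A : Matrix κ ι ℂ) (v : ι → ℂ) : nsq (A *ᵥ v) ≤ frobSq A * nsq v := by
  rw [nsq, frobSq, Finset.sum_mul]
  refine Finset.sum_le_sum fun i _ => ?_
  have := norm_star_dotProduct_sq_le (star fun j => A i j) v
  rwa [star_star, nsq_star, mul_comm] at this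

theorem exists_min_mulVec [Nonempty ι] (A : Matrix κ ι ℂ) :
    ∃ w : ι → ℂ, nsq w = 1 ∧ ∀ v, nsq (A *ᵥ w) * nsq v ≤ nsq (A *ᵥ v) := by
  classical
  have hne : {v : ι → ℂ | nsq v = 1}.Nonempty := by
    obtain ⟨r, w, -, h, -⟩ := exists_unit_smul (ι := ι) (v := fun _ => 1)
      (Function.ne_iff.mpr ⟨Classical.arbitrary ι, one_ne_zero⟩)
    exact ⟨w, h⟩
  have hcont : Continuous fun v : ι → ℂ => nsq (A *ᵥ v) :=
    continuous_nsq.comp (Continuous.matrix_mulVec continuous_const continuous_id)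
  obtain ⟨w, hw, hmin⟩ := isCompact_nsq_eq_one.exists_isMinOn hne hcont.continuousOn
  refine ⟨w, hw, fun v => ?_⟩
  by_cases hv : v = 0
  · simp [hv]
  · obtain ⟨r, u, hr, hu, rfl, hn⟩ := exists_unit_smul hv
    rw [hn, Matrix.mulVec_smul, nsq_smul, Complex.norm_of_nonneg hr.le, mul_comm]
    exact mul_le_mul_of_nonneg_left (hmin hu) (sq_nonneg r)

/-- A continuous function that is positive on a compact set is bounded below there. -/
theorem IsCompact.exists_pos_le {X : Type*} [TopologicalSpace X] {s : Set X} (hs : IsCompact s)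
    {f : X → ℝ} (hf : ContinuousOn f s) (h : ∀ x ∈ s, 0 < f x) : ∃ m > 0, ∀ x ∈ s, m ≤ f x := by
  rcases s.eq_empty_or_nonempty with rfl | hne
  · exact ⟨1, one_pos, by simp⟩
  · obtain ⟨x, hx, hmin⟩ := hs.exists_isMinOn hne hf
    exact ⟨f x, h x hx, fun y hy => hmin hy⟩

theorem IsCompact.exists_pos_ge {X : Type*} [TopologicalSpace X] {s : Set X} (hs : IsCompact s)
    {f : X → ℝ} (hf : ContinuousOn f s) : ∃ C > 0, ∀ x ∈ s, f x ≤ C := by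
  obtain ⟨C, hC⟩ := (hs.bddAbove_image hf)
  exact ⟨max C 1, lt_max_of_lt_right one_pos, fun x hx =>
    (hC (Set.mem_image_of_mem f hx)).trans (le_max_left _ _)⟩

end SquaredNorm

/-! ### The gradient of the slice determinant -/

/-- The gradient of `x ↦ det (slice χ x)`. -/
def detGrad (χ : StateVec qutrits) (x : Fin 3 → ℂ) : Fin 3 → ℂ := fun i =>
  ((slice χ x).adjugate * slice χ (Pi.single i 1)).trace

theorem slice_smul_smul (c d : ℂ) (χ : StateVec qutrits) (x : Fin 3 → ℂ) :
    slice (c • χ) (d • x) = (c * d) • slice χ x := by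
  ext j k
  simp only [slice, Pi.smul_apply, smul_eq_mul, Matrix.smul_apply, Finset.mul_sum]
  exact Finset.sum_congr rfl fun i _ => by ring

theorem slice_transpose_mulVec_single (χ : StateVec qutrits) (A : Matrix (Fin 3) (Fin 3) ℂ)
    (i : Fin 3) :
    slice χ (Aᵀ *ᵥ Pi.single i 1) = ∑ j, A i j • slice χ (Pi.single j 1) := by
  ext k l
  rw [Matrix.sum_apply]
  simp [slice, Matrix.mulVec_single, Pi.single_apply]

/-- The chain rule, in the adjugate form of Jacobi's formula. The operator of party 0 occurs once
outside and twice, through its transpose, inside; this imbalance is what later bounds its condition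
number. -/
theorem detGrad_tensorOp (K : LocalOps qutrits) (χ : StateVec qutrits) (x : Fin 3 → ℂ) :
    detGrad (tensorOp K *ᵥ χ) x =
      ((K 1).det * (K 2).det) • (K 0 *ᵥ detGrad χ ((K 0)ᵀ *ᵥ x)) := by
  have key : ∀ (A B M N : Matrix (Fin 3) (Fin 3) ℂ),
      ((A * M * Bᵀ).adjugate * (A * N * Bᵀ)).trace = A.det * B.det * (M.adjugate * N).trace := by
    intro A B M N
    rw [Matrix.adjugate_mul_distrib, Matrix.adjugate_mul_distrib]
    calc ((Bᵀ).adjugate * (M.adjugate * A.adjugate) * (A * N * Bᵀ)).trace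
        = ((Bᵀ).adjugate * (M.adjugate * (A.adjugate * A) * N * Bᵀ)).trace := by
          simp only [Matrix.mul_assoc]
      _ = (M.adjugate * (A.adjugate * A) * N * (Bᵀ * (Bᵀ).adjugate)).trace := by
          rw [Matrix.trace_mul_comm, Matrix.mul_assoc]
      _ = _ := by
          rw [Matrix.adjugate_mul, Matrix.mul_adjugate, Matrix.det_transpose]
          simp
          ring
  ext i
  rw [detGrad, slice_tensorOp, slice_tensorOp, key, slice_transpose_mulVec_single,
    Matrix.mul_sum, Matrix.trace_sum]
  simp only [Pi.smul_apply, smul_eq_mul, Matrix.mulVec, dotProduct, detGrad, Matrix.mul_smul,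
    Matrix.trace_smul]

theorem detGrad_smul_smul (c d : ℂ) (χ : StateVec qutrits) (x : Fin 3 → ℂ) :
    detGrad (c • χ) (d • x) = (c ^ 3 * d ^ 2) • detGrad χ x := by
  ext i
  have h : slice (c • χ) (Pi.single i 1) = c • slice χ (Pi.single i 1) := by
    have := slice_smul_smul c 1 χ (Pi.single i 1)
    rwa [one_smul, mul_one] at this
  rw [detGrad, slice_smul_smul, h, Matrix.adjugate_smul]
  simp [detGrad]
  ring

theorem detGrad_zero_right (χ : StateVec qutrits) : detGrad χ 0 = 0 := by
  have := detGrad_smul_smul 1 0 χ 0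
  simpa using this

theorem continuous_slice :
    Continuous fun p : StateVec qutrits × (Fin 3 → ℂ) => slice p.1 p.2 := by
  refine continuous_matrix fun j k => ?_
  simp only [slice]
  fun_prop

theorem continuous_detGrad :
    Continuous fun p : StateVec qutrits × (Fin 3 → ℂ) => detGrad p.1 p.2 := by
  refine continuous_pi fun i => ?_
  have h := continuous_slice.comp
    (continuous_fst.prodMk (continuous_const (y := (Pi.single i 1 : Fin 3 → ℂ))) :
      Continuous fun p : StateVec qutrits × (Fin 3 → ℂ) => (p.1, (Pi.single i 1 : Fin 3 → ℂ)))
  exact (continuous_slice.matrix_adjugate.matrix_mul h).matrix_trace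

theorem detGrad_seedState (a b c : ℂ) (x : Fin 3 → ℂ) (i : Fin 3) :
    detGrad (seedState a b c) x i = (a ^ 3 + b ^ 3 + c ^ 3) * (x (i + 1) * x (i + 2)) -
      3 * (a * b * c) * x i ^ 2 := by
  rw [detGrad, slice_seedState, slice_seedState, Matrix.adjugate_fin_three, Matrix.trace_fin_three]
  fin_cases i <;>
    simp [Matrix.mul_apply, Fin.sum_univ_three, Fin.reduceAdd] <;> ring

/-- Smoothness of the cubic: multiplying the three equations gives the discriminant times `(x 0 * x
1 * x 2) ^ 2`, so this product vanishes, and each equation then kills its own coordinate. -/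
theorem detGrad_seedState_eq_zero {a b c : ℂ} (hs : IsSeedParameter a b c) {x : Fin 3 → ℂ}
    (h : detGrad (seedState a b c) x = 0) : x = 0 := by
  obtain ⟨habc, hs2, -⟩ := hs
  have h0 : (a ^ 3 + b ^ 3 + c ^ 3) * (x 1 * x 2) = 3 * (a * b * c) * x 0 ^ 2 := by
    have := congrFun h 0
    rw [detGrad_seedState] at this
    exact sub_eq_zero.mp this
  have h1 : (a ^ 3 + b ^ 3 + c ^ 3) * (x 2 * x 0) = 3 * (a * b * c) * x 1 ^ 2 := by
    have := congrFun h 1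
    rw [detGrad_seedState] at this
    exact sub_eq_zero.mp this
  have h2 : (a ^ 3 + b ^ 3 + c ^ 3) * (x 0 * x 1) = 3 * (a * b * c) * x 2 ^ 2 := by
    have := congrFun h 2
    rw [detGrad_seedState] at this
    exact sub_eq_zero.mp this
  have h3 : ((a ^ 3 + b ^ 3 + c ^ 3) ^ 3 - (3 * a * b * c) ^ 3) * (x 0 * x 1 * x 2) ^ 2 = 0 := by
    have : (a ^ 3 + b ^ 3 + c ^ 3) * (x 1 * x 2) * ((a ^ 3 + b ^ 3 + c ^ 3) * (x 2 * x 0)) *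
        ((a ^ 3 + b ^ 3 + c ^ 3) * (x 0 * x 1)) = 3 * (a * b * c) * x 0 ^ 2 *
        (3 * (a * b * c) * x 1 ^ 2) * (3 * (a * b * c) * x 2 ^ 2) := by rw [h0, h1, h2]
    linear_combination this
  have h4 : x 0 * x 1 * x 2 = 0 :=
    pow_eq_zero_iff two_ne_zero |>.mp ((mul_eq_zero.mp h3).resolve_left (sub_ne_zero.mpr hs2))
  have h5 : ∀ y : ℂ, 3 * (a * b * c) * y ^ 3 = 0 → y = 0 := by
    intro y hy
    simpa [habc] using hy
  ext i
  fin_cases i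
  · exact h5 (x 0) (by linear_combination (a ^ 3 + b ^ 3 + c ^ 3) * h4 - x 0 * h0)
  · exact h5 (x 1) (by linear_combination (a ^ 3 + b ^ 3 + c ^ 3) * h4 - x 1 * h1)
  · exact h5 (x 2) (by linear_combination (a ^ 3 + b ^ 3 + c ^ 3) * h4 - x 2 * h2)

theorem detGrad_tensorOp_seedState_eq_zero {a b c : ℂ} (hs : IsSeedParameter a b c)
    {K : LocalOps qutrits} (hu : ∀ i, IsUnit (K i)) {x : Fin 3 → ℂ}
    (h : detGrad (tensorOp K *ᵥ seedState a b c) x = 0) : x = 0 := by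
  have hd : ∀ i, (K i).det ≠ 0 := fun i => ((Matrix.isUnit_iff_isUnit_det _).mp (hu i)).ne_zero
  rw [detGrad_tensorOp, smul_eq_zero] at h
  have h1 := h.resolve_left (mul_ne_zero (hd 1) (hd 2))
  have h2 := Matrix.eq_zero_of_mulVec_eq_zero (hd 0) h1
  exact Matrix.eq_zero_of_mulVec_eq_zero (by rw [Matrix.det_transpose]; exact hd 0)
    (detGrad_seedState_eq_zero hs h2)

theorem nsq_detGrad_smul_smul {r s : ℝ} (hr : 0 < r) (hs : 0 < s) (χ : StateVec qutrits)
    (x : Fin 3 → ℂ) : nsq (detGrad ((r : ℂ) • χ) ((s : ℂ) • x)) =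
      (r ^ 2) ^ 3 * (s ^ 2) ^ 2 * nsq (detGrad χ x) := by
  rw [detGrad_smul_smul, nsq_smul, norm_mul, norm_pow, norm_pow, Complex.norm_of_nonneg hr.le,
    Complex.norm_of_nonneg hs.le]
  ring

/-- On the product of unit spheres, gradient and defect do not vanish together: zero defect means
`χ` is a multiple of `φ`, where the gradient is nonzero. Compactness bounds their sum below, half of
the bound is spent on the defect, and homogeneity of degrees 3 and 2 removes the normalization. -/
theorem exists_le_nsq_detGrad {φ : StateVec qutrits} (hφ : φ ≠ 0)
    (h : ∀ x, detGrad φ x = 0 → x = 0) :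
    ∃ m > 0, ∀ χ x, defect φ χ ≤ m * nsq χ →
      m * nsq χ ^ 3 * nsq x ^ 2 ≤ nsq (detGrad χ x) := by
  have hcont : Continuous fun p : StateVec qutrits × (Fin 3 → ℂ) =>
      nsq (detGrad p.1 p.2) + defect φ p.1 :=
    (continuous_nsq.comp continuous_detGrad).add ((continuous_defect φ).comp continuous_fst)
  obtain ⟨m, hm, hmin⟩ := (isCompact_nsq_eq_one (ι := Idx qutrits).prod
    (isCompact_nsq_eq_one (ι := Fin 3))).exists_pos_le hcont.continuousOn (by
      rintro ⟨χ, x⟩ ⟨h1, h2⟩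
      have h1 : nsq χ = 1 := h1
      have h2 : nsq x = 1 := h2
      show 0 < nsq (detGrad χ x) + defect φ χ
      have n1 := nsq_nonneg (detGrad χ x)
      have n2 := defect_nonneg φ χ
      by_contra hle
      have e1 : nsq (detGrad χ x) = 0 := by linarith
      have e2 : defect φ χ = 0 := by linarith
      obtain ⟨c, rfl⟩ := exists_eq_smul_of_defect_eq_zero hφ e2
      have hc : c ≠ 0 := by
        rintro rfl
        simp at h1
      have e3 := detGrad_smul_smul c 1 φ x
      rw [one_smul, nsq_eq_zero.mp e1, eq_comm, smul_eq_zero] at e3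
      have e4 := h x (e3.resolve_left (by simpa using hc))
      simp [e4] at h2)
  refine ⟨m / 2, by positivity, fun χ x hd => ?_⟩
  by_cases hχ : χ = 0
  · simp [hχ, nsq_nonneg]
  by_cases hx : x = 0
  · simp [hx, nsq_nonneg]
  obtain ⟨r, χ', hr, e1, rfl, e2⟩ := exists_unit_smul hχ
  obtain ⟨s, x', hs, f1, rfl, f2⟩ := exists_unit_smul hx
  rw [defect_smul, Complex.norm_of_nonneg hr.le, e2, mul_comm (m / 2)] at hd
  have hd' := le_of_mul_le_mul_left hd (by positivity)
  have := hmin (χ', x') ⟨e1, f1⟩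
  simp only at this
  rw [nsq_detGrad_smul_smul hr hs, e2, f2]
  have h3 : m / 2 ≤ nsq (detGrad χ' x') := by linarith
  calc m / 2 * (r ^ 2) ^ 3 * (s ^ 2) ^ 2 = (r ^ 2) ^ 3 * (s ^ 2) ^ 2 * (m / 2) := by ring
    _ ≤ _ := mul_le_mul_of_nonneg_left h3 (by positivity)

theorem exists_nsq_detGrad_le :
    ∃ C > 0, ∀ χ x, nsq (detGrad χ x) ≤ C * nsq χ ^ 3 * nsq x ^ 2 := by
  have hcont : Continuous fun p : StateVec qutrits × (Fin 3 → ℂ) => nsq (detGrad p.1 p.2) :=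
    continuous_nsq.comp continuous_detGrad
  obtain ⟨C, hC, hmax⟩ := (isCompact_nsq_eq_one (ι := Idx qutrits).prod
    (isCompact_nsq_eq_one (ι := Fin 3))).exists_pos_ge hcont.continuousOn
  refine ⟨C, hC, fun χ x => ?_⟩
  by_cases hχ : χ = 0
  · have := detGrad_smul_smul 0 1 0 x
    simp at this
    simp [hχ, this]
  by_cases hx : x = 0
  · simp [hx, detGrad_zero_right]
  obtain ⟨r, χ', hr, e1, rfl, e2⟩ := exists_unit_smul hχ
  obtain ⟨s, x', hs, f1, rfl, f2⟩ := exists_unit_smul hx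
  rw [nsq_detGrad_smul_smul hr hs, e2, f2]
  calc _ ≤ (r ^ 2) ^ 3 * (s ^ 2) ^ 2 * C :=
        mul_le_mul_of_nonneg_left (hmax (χ', x') ⟨e1, f1⟩) (by positivity)
    _ = _ := by ring

/-! ### Well-conditioned local operators -/

/-- The smallest squared singular value is at least `κ` times the squared Frobenius norm. -/
def WellConditioned (κ : ℝ) (A : Matrix (Fin 3) (Fin 3) ℂ) : Prop :=
  ∀ v, κ * frobSq A * nsq v ≤ nsq (A *ᵥ v)

theorem WellConditioned.mono {κ κ' : ℝ} (h : κ' ≤ κ) {A : Matrix (Fin 3) (Fin 3) ℂ}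
    (hA : WellConditioned κ A) : WellConditioned κ' A := fun v =>
  (mul_le_mul_of_nonneg_right (mul_le_mul_of_nonneg_right h (frobSq_nonneg A))
    (nsq_nonneg v)).trans (hA v)

theorem WellConditioned.congr {κ : ℝ} {A B : Matrix (Fin 3) (Fin 3) ℂ} (h : Aᴴ * A = Bᴴ * B)
    (hA : WellConditioned κ A) : WellConditioned κ B := fun v => by
  rw [← frobSq_congr h, ← nsq_mulVec_congr h]; exact hA v

theorem exists_conditioned_row (A : Matrix (Fin 3) (Fin 3) ℂ) :
    ∃ i, frobSq A / 3 ≤ nsq (Aᵀ *ᵥ Pi.single i 1) := by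
  by_contra! h
  have h1 : ∑ i, nsq (Aᵀ *ᵥ Pi.single i 1) = frobSq A := by
    simp [frobSq, Matrix.mulVec_single, nsq]
  have h2 := Finset.sum_lt_sum_of_nonempty (s := Finset.univ) Finset.univ_nonempty fun i _ => h i
  rw [h1] at h2
  simp at h2
  linarith

/-- With `z` the preimage of `w` under the adjoint, the pairing of `z` with `A *ᵥ w` equals 1, and
Cauchy–Schwarz makes `z` long wherever `A` contracts. Conjugation turns the adjoint into the
transpose. -/
theorem exists_transpose_mulVec_unit {A : Matrix (Fin 3) (Fin 3) ℂ} (hA : A.det ≠ 0)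
    {w : Fin 3 → ℂ} (hw : nsq w = 1) :
    ∃ x, nsq (Aᵀ *ᵥ x) = 1 ∧ 1 ≤ nsq (A *ᵥ w) * nsq x := by
  obtain ⟨z, h1⟩ : ∃ z, Aᴴ *ᵥ z = w := ⟨(A⁻¹)ᴴ *ᵥ w, by
    rw [Matrix.mulVec_mulVec, ← Matrix.conjTranspose_mul,
      Matrix.nonsing_inv_mul _ (isUnit_iff_ne_zero.mpr hA), Matrix.conjTranspose_one,
      Matrix.one_mulVec]⟩
  refine ⟨star z, ?_, ?_⟩
  · have : Aᵀ *ᵥ star z = star w := by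
      rw [← h1, Matrix.star_mulVec, Matrix.conjTranspose_conjTranspose, Matrix.mulVec_transpose]
    rw [this, nsq_star, hw]
  · have h2 : star z ⬝ᵥ (A *ᵥ w) = 1 := by
      rw [Matrix.dotProduct_mulVec]
      have : star z ᵥ* A = star w := by
        rw [← h1, Matrix.star_mulVec, Matrix.conjTranspose_conjTranspose]
      rw [this, ← ofReal_nsq, hw, Complex.ofReal_one]
    have h3 := norm_star_dotProduct_sq_le z (A *ᵥ w)
    rw [h2, norm_one, one_pow] at h3
    rwa [nsq_star]

/-- For small defect the gradient of the output cubic is bounded above and below. By the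
transformation law it is also the image under `K 0` of the seed gradient at a transposed image of
`x`. Evaluating at a vector adapted to the smallest singular value and at a basis vector gives two
inequalities that leave no room for a small ratio. -/
theorem exists_wellConditioned_zero {a b c : ℂ} (hs : IsSeedParameter a b c)
    {h : LocalOps qutrits} (hu : ∀ i, IsUnit (h i)) :
    ∃ η > 0, ∃ κ > 0, ∀ K : LocalOps qutrits,
      η * nsq (tensorOp K *ᵥ seedState a b c) ≤
        defect (tensorOp h *ᵥ seedState a b c) (tensorOp K *ᵥ seedState a b c) ∨
      WellConditioned κ (K 0) := by
  set ψ := seedState a b c with hψ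
  have hψ0 : ψ ≠ 0 := seedState_ne_zero hs.ne_zero.1
  obtain ⟨m, hm, hmin⟩ := exists_le_nsq_detGrad
    (fullyEntangled_tensorOp_seedState (b := b) (c := c) hs.ne_zero.1 hu).1
    fun x => detGrad_tensorOp_seedState_eq_zero hs hu
  obtain ⟨m', hm', hmin'⟩ := exists_le_nsq_detGrad hψ0 fun x => detGrad_seedState_eq_zero hs
  obtain ⟨C, hC, hmax⟩ := exists_nsq_detGrad_le
  have hn := nsq_pos.mpr hψ0
  set s := C * nsq ψ ^ 3 with hsdef
  set s' := m' * nsq ψ ^ 3 with hsdef'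
  have hspos : 0 < s := by positivity
  have hspos' : 0 < s' := by positivity
  refine ⟨m, hm, s' * m / (9 * C * s), by positivity, fun K => ?_⟩
  rw [or_iff_not_imp_left, not_le]
  intro hdef
  set N := nsq (tensorOp K *ᵥ ψ) with hN
  have hNpos : 0 < N := by
    have := (defect_nonneg (tensorOp h *ᵥ ψ) (tensorOp K *ᵥ ψ)).trans_lt hdef
    exact pos_of_mul_pos_right this hm.le
  set A := K 0 with hA
  set D := ‖(K 1).det * (K 2).det‖ ^ 2 with hD
  have hgrad : ∀ x, nsq (detGrad (tensorOp K *ᵥ ψ) x) = D * nsq (A *ᵥ detGrad ψ (Aᵀ *ᵥ x)) := by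
    intro x; rw [detGrad_tensorOp, nsq_smul]
  have hlow : ∀ x, m * N ^ 3 * nsq x ^ 2 ≤ D * nsq (A *ᵥ detGrad ψ (Aᵀ *ᵥ x)) := by
    intro x; rw [← hgrad]; exact hmin _ _ hdef.le
  have hdet : A.det ≠ 0 := by
    intro h0
    obtain ⟨x, hx, hx0⟩ := Matrix.exists_mulVec_eq_zero_iff.mpr
      (show (Aᵀ).det = 0 by rw [Matrix.det_transpose, h0])
    have := hlow x
    rw [hx0, detGrad_zero_right, Matrix.mulVec_zero, nsq_zero, mul_zero] at this
    have hxpos := nsq_pos.mpr hx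
    have : 0 < m * N ^ 3 * nsq x ^ 2 := by positivity
    linarith
  obtain ⟨w, hw, hwmin⟩ := exists_min_mulVec A
  set μ := nsq (A *ᵥ w) with hμ
  have hμ0 : 0 ≤ μ := nsq_nonneg _
  set F := frobSq A with hF
  have hF0 : 0 ≤ F := frobSq_nonneg _
  have hD0 : 0 ≤ D := by positivity
  -- The lower gradient bound, at a vector `x` whose transposed image has norm 1 while `nsq x` is at
  -- least `1 / μ`.
  have I1 : m * N ^ 3 ≤ D * F * s * μ ^ 2 := by
    obtain ⟨x, hx1, hx2⟩ := exists_transpose_mulVec_unit hdet hw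
    have h1 := hlow x
    have h2 := nsq_mulVec_le A (detGrad ψ (Aᵀ *ᵥ x))
    have h3 := hmax ψ (Aᵀ *ᵥ x)
    rw [hx1, one_pow, mul_one] at h3
    have h4 : m * N ^ 3 * nsq x ^ 2 ≤ D * (F * s) :=
      h1.trans (mul_le_mul_of_nonneg_left (h2.trans (mul_le_mul_of_nonneg_left h3 hF0)) hD0)
    have h5 : 1 ≤ (μ * nsq x) ^ 2 := one_le_pow₀ hx2
    calc m * N ^ 3 = m * N ^ 3 * 1 := (mul_one _).symm
      _ ≤ m * N ^ 3 * (μ * nsq x) ^ 2 := mul_le_mul_of_nonneg_left h5 (by positivity)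
      _ = m * N ^ 3 * nsq x ^ 2 * μ ^ 2 := by ring
      _ ≤ D * (F * s) * μ ^ 2 := mul_le_mul_of_nonneg_right h4 (by positivity)
      _ = _ := by ring
  -- The upper gradient bound, at a basis vector selecting a row with at least a third of the
  -- squared norm; hence the 9.
  have I2 : D * μ * s' * F ^ 2 ≤ 9 * (C * N ^ 3) := by
    obtain ⟨i, hi⟩ := exists_conditioned_row A
    set y := Aᵀ *ᵥ Pi.single i 1 with hy
    have h1 := hmax (tensorOp K *ᵥ ψ) (Pi.single i 1)
    have hsingle : nsq (Pi.single i 1 : Fin 3 → ℂ) = 1 := by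
      simp [nsq, Pi.single_apply, apply_ite]
    rw [hgrad, hsingle, one_pow, mul_one] at h1
    have h2 := hwmin (detGrad ψ y)
    have h3 := hmin' ψ y (by rw [show defect ψ ψ = 0 by simpa using defect_self_smul 1 ψ]; positivity)
    have h4 : (F / 3) ^ 2 ≤ nsq y ^ 2 := pow_le_pow_left₀ (by positivity) hi 2
    have h5 : D * (μ * (s' * (F / 3) ^ 2)) ≤ C * N ^ 3 :=
      (mul_le_mul_of_nonneg_left ((mul_le_mul_of_nonneg_left
        ((mul_le_mul_of_nonneg_left h4 hspos'.le).trans h3) hμ0).trans h2) hD0).trans h1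
    nlinarith [h5]
  have hpos : 0 < D * F * s * μ ^ 2 := lt_of_lt_of_le (by positivity) I1
  have hDpos : 0 < D := hD0.lt_of_ne (by rintro h0; rw [← h0] at hpos; simp at hpos)
  have hFpos : 0 < F := hF0.lt_of_ne (by rintro h0; rw [← h0] at hpos; simp at hpos)
  have hμpos : 0 < μ := hμ0.lt_of_ne (by rintro h0; rw [← h0] at hpos; simp at hpos)
  -- Eliminating the determinants `D` and the norm `N` between the two inequalities leaves the
  -- condition number.
  have key : s' * m / (9 * C * s) * F ≤ μ := by
    rw [div_mul_eq_mul_div, div_le_iff₀ (by positivity)]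
    refine le_of_mul_le_mul_left ?_ (by positivity : 0 < D * μ * F)
    calc D * μ * F * (s' * m * F) = m * (D * μ * s' * F ^ 2) := by ring
      _ ≤ m * (9 * (C * N ^ 3)) := mul_le_mul_of_nonneg_left I2 hm.le
      _ = 9 * C * (m * N ^ 3) := by ring
      _ ≤ 9 * C * (D * F * s * μ ^ 2) := mul_le_mul_of_nonneg_left I1 (by positivity)
      _ = _ := by ring
  intro v
  exact (mul_le_mul_of_nonneg_right key (nsq_nonneg v)).trans (hwmin v)

theorem nsq_tensorOp_rotate (a b c : ℂ) (K : LocalOps qutrits) :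
    nsq (tensorOp (d := qutrits) (fun i => K (rotate i)) *ᵥ seedState a b c) =
      nsq (tensorOp K *ᵥ seedState a b c) := by
  rw [nsq, ← sum_comp_perm rotate]
  simp only [tensorOp_rotate_mulVec]
  rfl

theorem defect_tensorOp_rotate (a b c : ℂ) (h K : LocalOps qutrits) :
    defect (tensorOp (d := qutrits) (fun i => h (rotate i)) *ᵥ seedState a b c)
      (tensorOp (d := qutrits) (fun i => K (rotate i)) *ᵥ seedState a b c) =
    defect (tensorOp h *ᵥ seedState a b c) (tensorOp K *ᵥ seedState a b c) := by
  rw [defect, defect, nsq_tensorOp_rotate, nsq_tensorOp_rotate, dotProduct,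
    ← sum_comp_perm rotate]
  simp only [Pi.star_apply, tensorOp_rotate_mulVec]
  rfl

theorem exists_wellConditioned {a b c : ℂ} (hs : IsSeedParameter a b c)
    {h : LocalOps qutrits} (hu : ∀ i, IsUnit (h i)) :
    ∃ η > 0, ∃ κ > 0, ∀ K : LocalOps qutrits,
      η * nsq (tensorOp K *ᵥ seedState a b c) ≤
        defect (tensorOp h *ᵥ seedState a b c) (tensorOp K *ᵥ seedState a b c) ∨
      ∀ i, WellConditioned κ (K i) := by
  obtain ⟨η₀, hη₀, κ₀, hκ₀, H₀⟩ := exists_wellConditioned_zero hs hu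
  obtain ⟨η₁, hη₁, κ₁, hκ₁, H₁⟩ := exists_wellConditioned_zero hs fun i => hu (rotate i)
  obtain ⟨η₂, hη₂, κ₂, hκ₂, H₂⟩ := exists_wellConditioned_zero hs fun i => hu (rotate (rotate i))
  refine ⟨min η₀ (min η₁ η₂), by positivity, min κ₀ (min κ₁ κ₂), by positivity, fun K => ?_⟩
  rw [or_iff_not_imp_left]
  intro hlt
  have hN := nsq_nonneg (tensorOp K *ᵥ seedState a b c)
  have lift : ∀ η, min η₀ (min η₁ η₂) ≤ η → ¬ η * nsq (tensorOp K *ᵥ seedState a b c) ≤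
      defect (tensorOp h *ᵥ seedState a b c) (tensorOp K *ᵥ seedState a b c) :=
    fun η hη hle => hlt ((mul_le_mul_of_nonneg_right hη hN).trans hle)
  have g0 := (H₀ K).resolve_left (lift _ (min_le_left _ _))
  have g1 := (H₁ fun i => K (rotate i)).resolve_left (by
    rw [nsq_tensorOp_rotate, defect_tensorOp_rotate]
    exact lift _ ((min_le_right _ _).trans (min_le_left _ _)))
  have g2 := (H₂ fun i => K (rotate (rotate i))).resolve_left (by
    rw [nsq_tensorOp_rotate a b c fun i => K (rotate i), nsq_tensorOp_rotate,
      defect_tensorOp_rotate a b c (fun i => h (rotate i)) fun i => K (rotate i),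
      defect_tensorOp_rotate]
    exact lift _ ((min_le_right _ _).trans (min_le_right _ _)))
  intro i
  fin_cases i
  · exact g0.mono (min_le_left _ _)
  · exact WellConditioned.mono ((min_le_right _ _).trans (min_le_left _ _)) g1
  · exact WellConditioned.mono ((min_le_right _ _).trans (min_le_right _ _)) g2

/-! ### Weights of product operators -/

/-- The squared Frobenius norm of a product operator, as the product over the parties. -/
def weight {n : ℕ} {d : Fin n → ℕ} (K : LocalOps d) : ℝ := ∏ i, frobSq (K i)

theorem weight_nonneg {n : ℕ} {d : Fin n → ℕ} (K : LocalOps d) : 0 ≤ weight K :=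
  Finset.prod_nonneg fun _ _ => frobSq_nonneg _

theorem frobSq_tensorOp {n : ℕ} {d : Fin n → ℕ} (K : LocalOps d) : frobSq (tensorOp K) = weight K := by
  have h : ∀ x : Idx d, nsq (fun y => tensorOp K x y) = ∏ i, nsq fun j => K i (x i) j := by
    intro x
    simp only [nsq, tensorOp, norm_prod, ← Finset.prod_pow]
    rw [Finset.prod_univ_sum]
    simp
  simp only [frobSq, h, weight]
  rw [Finset.prod_univ_sum]
  simp

theorem nsq_tensorOp_le (K : LocalOps qutrits) (χ : StateVec qutrits) :
    nsq (tensorOp K *ᵥ χ) ≤ weight K * nsq χ := by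
  rw [← frobSq_tensorOp]; exact nsq_mulVec_le _ _

theorem nsq_idx (χ : StateVec qutrits) :
    nsq χ = ∑ i : Fin 3, ∑ j : Fin 3, ∑ k : Fin 3, ‖χ ![i, j, k]‖ ^ 2 := sum_idx _

theorem le_nsq_tensorOp_one {μ : ℝ} {A : Matrix (Fin 3) (Fin 3) ℂ}
    (h : ∀ v, μ * nsq v ≤ nsq (A *ᵥ v)) (χ : StateVec qutrits) :
    μ * nsq χ ≤ nsq (tensorOp (d := qutrits) ![1, A, 1] *ᵥ χ) := by
  have h1 : ∀ i j k : Fin 3, (tensorOp (d := qutrits) ![1, A, 1] *ᵥ χ) ![i, j, k] =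
      (A *ᵥ fun l => χ ![i, l, k]) j := by
    intro i j k
    rw [tensorOp_mulVec_apply]
    show ∑ i' : Fin 3, ∑ j' : Fin 3, ∑ k' : Fin 3, (1 : Matrix (Fin 3) (Fin 3) ℂ) i i' * A j j' *
      (1 : Matrix (Fin 3) (Fin 3) ℂ) k k' * χ ![i', j', k'] = ∑ l, A j l * χ ![i, l, k]
    simp [Matrix.one_apply]
  have h2 : ∀ χ : StateVec qutrits,
      nsq χ = ∑ i : Fin 3, ∑ k : Fin 3, nsq fun l : Fin 3 => χ ![i, l, k] := by
    intro χ
    rw [nsq_idx]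
    exact Finset.sum_congr rfl fun i _ => Finset.sum_comm
  rw [h2, h2, Finset.mul_sum]
  simp only [h1, Finset.mul_sum]
  exact Finset.sum_le_sum fun i _ => Finset.sum_le_sum fun k _ => h _

theorem le_nsq_tensorOp_two {μ : ℝ} {A : Matrix (Fin 3) (Fin 3) ℂ}
    (h : ∀ v, μ * nsq v ≤ nsq (A *ᵥ v)) (χ : StateVec qutrits) :
    μ * nsq χ ≤ nsq (tensorOp (d := qutrits) ![1, 1, A] *ᵥ χ) := by
  have h1 : ∀ i j k : Fin 3, (tensorOp (d := qutrits) ![1, 1, A] *ᵥ χ) ![i, j, k] =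
      (A *ᵥ fun l => χ ![i, j, l]) k := by
    intro i j k
    rw [tensorOp_mulVec_apply]
    show ∑ i' : Fin 3, ∑ j' : Fin 3, ∑ k' : Fin 3, (1 : Matrix (Fin 3) (Fin 3) ℂ) i i' *
      (1 : Matrix (Fin 3) (Fin 3) ℂ) j j' * A k k' * χ ![i', j', k'] = ∑ l, A k l * χ ![i, j, l]
    simp [Matrix.one_apply]
  rw [nsq_idx, nsq_idx, Finset.mul_sum]
  simp only [h1, Finset.mul_sum]
  refine Finset.sum_le_sum fun i _ => Finset.sum_le_sum fun j _ => ?_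
  rw [← Finset.mul_sum]
  exact h _

/-- The reduced state of one party of the seed state is a multiple of the identity. -/
theorem nsq_tensorOp_zero_seedState (a b c : ℂ) (A : Matrix (Fin 3) (Fin 3) ℂ) :
    nsq (tensorOp (d := qutrits) ![A, 1, 1] *ᵥ seedState a b c) =
      (‖a‖ ^ 2 + ‖b‖ ^ 2 + ‖c‖ ^ 2) * frobSq A := by
  have h1 : ∀ i j k : Fin 3, (tensorOp (d := qutrits) ![A, 1, 1] *ᵥ seedState a b c) ![i, j, k] =
      ∑ l : Fin 3, A i l * seedState a b c ![l, j, k] := by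
    intro i j k
    rw [tensorOp_mulVec_apply]
    show ∑ i' : Fin 3, ∑ j' : Fin 3, ∑ k' : Fin 3, A i i' * (1 : Matrix (Fin 3) (Fin 3) ℂ) j j' *
      (1 : Matrix (Fin 3) (Fin 3) ℂ) k k' * seedState a b c ![i', j', k'] = _
    simp [Matrix.one_apply]
  have h2 : ∀ i : Fin 3, ∑ j : Fin 3, ∑ k : Fin 3,
      ‖∑ l : Fin 3, A i l * seedState a b c ![l, j, k]‖ ^ 2 =
      (‖a‖ ^ 2 + ‖b‖ ^ 2 + ‖c‖ ^ 2) * nsq fun j => A i j := by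
    intro i
    have h3 : ∀ j k : Fin 3, ∑ l : Fin 3, A i l * seedState a b c ![l, j, k] =
        slice (seedState a b c) (fun l => A i l) j k := fun _ _ => rfl
    simp only [h3, slice_seedState, nsq, Fin.sum_univ_three]
    simp [mul_pow]
    ring
  rw [nsq_idx]
  simp only [h1, h2, frobSq, Finset.mul_sum]

/-- Party `i` acts first, where the maximally mixed reduced state gives its full Frobenius norm;
each other party then costs at most its smallest squared singular value. Party `i` may be
arbitrarily ill-conditioned. -/
theorem le_nsq_tensorOp_seedState (a b c : ℂ) (K : LocalOps qutrits) {μ : Fin 3 → ℝ}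
    (hμ : ∀ i, 0 ≤ μ i) (i : Fin 3) (h : ∀ j, j ≠ i → ∀ v, μ j * nsq v ≤ nsq (K j *ᵥ v)) :
    (‖a‖ ^ 2 + ‖b‖ ^ 2 + ‖c‖ ^ 2) * frobSq (K i) * ∏ j ∈ Finset.univ.erase i, μ j ≤
      nsq (tensorOp K *ᵥ seedState a b c) := by
  have base : ∀ (K : LocalOps qutrits) (μ : Fin 3 → ℝ), (∀ i, 0 ≤ μ i) →
      (∀ j, j ≠ 0 → ∀ v, μ j * nsq v ≤ nsq (K j *ᵥ v)) →
      μ 2 * (μ 1 * ((‖a‖ ^ 2 + ‖b‖ ^ 2 + ‖c‖ ^ 2) * frobSq (K 0))) ≤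
        nsq (tensorOp K *ᵥ seedState a b c) := by
    intro K μ hμ h
    have e : tensorOp K = tensorOp (d := qutrits) ![1, 1, K 2] *
        (tensorOp (d := qutrits) ![1, K 1, 1] * tensorOp (d := qutrits) ![K 0, 1, 1]) := by
      rw [tensorOp_mul, tensorOp_mul]
      congr 1
      ext1 i
      fin_cases i <;> simp
    rw [e, ← Matrix.mulVec_mulVec, ← Matrix.mulVec_mulVec, ← nsq_tensorOp_zero_seedState]
    exact (mul_le_mul_of_nonneg_left (le_nsq_tensorOp_one (h 1 (by decide)) _) (hμ 2)).trans
      (le_nsq_tensorOp_two (h 2 (by decide)) _)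
  fin_cases i
  · have := base K μ hμ h
    have e : (Finset.univ : Finset (Fin 3)).erase 0 = {1, 2} := by decide
    simp only [Fin.zero_eta, Fin.isValue]
    rw [e, Finset.prod_pair (by decide)]
    linarith
  · have h1 : μ 0 * (μ 2 * ((‖a‖ ^ 2 + ‖b‖ ^ 2 + ‖c‖ ^ 2) * frobSq (K 1))) ≤
        nsq (tensorOp K *ᵥ seedState a b c) := by
      rw [← nsq_tensorOp_rotate]
      exact base (fun j => K (rotate j)) (fun j => μ (rotate j)) (fun _ => hμ _)
        fun j hj => h (rotate j) ((by decide : ∀ j : Fin 3, j ≠ 0 → rotate j ≠ 1) j hj)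
    have e : (Finset.univ : Finset (Fin 3)).erase 1 = {2, 0} := by decide
    simp only [Fin.mk_one, Fin.isValue]
    rw [e, Finset.prod_pair (by decide)]
    linarith
  · have h1 : μ 1 * (μ 0 * ((‖a‖ ^ 2 + ‖b‖ ^ 2 + ‖c‖ ^ 2) * frobSq (K 2))) ≤
        nsq (tensorOp K *ᵥ seedState a b c) := by
      rw [← nsq_tensorOp_rotate, ← nsq_tensorOp_rotate]
      exact base (fun j => K (rotate (rotate j))) (fun j => μ (rotate (rotate j))) (fun _ => hμ _)
        fun j hj => h (rotate (rotate j))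
          ((by decide : ∀ j : Fin 3, j ≠ 0 → rotate (rotate j) ≠ 2) j hj)
    have e : (Finset.univ : Finset (Fin 3)).erase 2 = {0, 1} := by decide
    simp only [Fin.reduceFinMk, Fin.isValue]
    rw [e, Finset.prod_pair (by decide)]
    linarith

theorem weight_le_nsq_of_wellConditioned (a b c : ℂ) {κ : ℝ} (hκ : 0 ≤ κ) (K : LocalOps qutrits)
    (i : Fin 3) (h : ∀ j, j ≠ i → WellConditioned κ (K j)) :
    (‖a‖ ^ 2 + ‖b‖ ^ 2 + ‖c‖ ^ 2) * κ ^ 2 * weight K ≤ nsq (tensorOp K *ᵥ seedState a b c) := by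
  have := le_nsq_tensorOp_seedState a b c K (μ := fun j => κ * frobSq (K j))
    (fun j => mul_nonneg hκ (frobSq_nonneg _)) i fun j hj v => h j hj v
  rw [Finset.prod_mul_distrib, Finset.prod_const, Finset.card_erase_of_mem (Finset.mem_univ i)] at this
  rw [weight, ← Finset.mul_prod_erase _ _ (Finset.mem_univ i)]
  simp only [Finset.card_univ, Fintype.card_fin, Nat.reduceSub] at this
  linarith

/-! ### One round of a protocol -/

theorem Protocol.gram_cons (P : Protocol qutrits) (t : List ℕ) {k : ℕ} (hk : k < P.outcomes t)
    {i : Fin 3} (hi : i ≠ P.party t) :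
    (P.localKraus (k :: t) i)ᴴ * P.localKraus (k :: t) i =
      (P.localKraus t i)ᴴ * P.localKraus t i := by
  have := (Matrix.mem_unitaryGroup_iff'.mp (P.isUnitary t k hk i hi))
  rw [Matrix.star_eq_conjTranspose] at this
  rw [Protocol.localKraus, Matrix.conjTranspose_mul, Matrix.mul_assoc,
    ← Matrix.mul_assoc _ (P.op t k i), this, Matrix.one_mul]

theorem Protocol.sum_gram_cons (P : Protocol qutrits) (t : List ℕ) :
    ∑ k ∈ Finset.range (P.outcomes t),
      (P.localKraus (k :: t) (P.party t))ᴴ * P.localKraus (k :: t) (P.party t) =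
      (P.localKraus t (P.party t))ᴴ * P.localKraus t (P.party t) := by
  have : ∀ k, (P.localKraus (k :: t) (P.party t))ᴴ * P.localKraus (k :: t) (P.party t) =
      (P.localKraus t (P.party t))ᴴ * ((P.op t k (P.party t))ᴴ * P.op t k (P.party t)) *
        P.localKraus t (P.party t) := by
    intro k
    simp only [Protocol.localKraus, Matrix.conjTranspose_mul, Matrix.mul_assoc]
  simp only [this]
  rw [← Finset.sum_mul, ← Finset.mul_sum, P.complete, Matrix.mul_one]

/-- In one round a single factor of the product changes, and that factor is additive in the Gram
operator, so the product is conserved on summing over outcomes. -/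
theorem Protocol.sum_prod_cons (P : Protocol qutrits) (t : List ℕ)
    (g : Fin 3 → Matrix (Fin 3) (Fin 3) ℂ → ℝ)
    (hg : ∀ i A B, Aᴴ * A = Bᴴ * B → g i A = g i B)
    (hsum : ∀ (i : Fin 3) (s : Finset ℕ) (A : ℕ → Matrix (Fin 3) (Fin 3) ℂ) B,
      ∑ k ∈ s, (A k)ᴴ * A k = Bᴴ * B → ∑ k ∈ s, g i (A k) = g i B) :
    ∑ k ∈ Finset.range (P.outcomes t), ∏ i, g i (P.localKraus (k :: t) i) =
      ∏ i, g i (P.localKraus t i) := by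
  have h : ∀ k ∈ Finset.range (P.outcomes t), ∏ i, g i (P.localKraus (k :: t) i) =
      g (P.party t) (P.localKraus (k :: t) (P.party t)) *
        ∏ i ∈ Finset.univ.erase (P.party t), g i (P.localKraus t i) := by
    intro k hk
    rw [← Finset.mul_prod_erase _ _ (Finset.mem_univ (P.party t))]
    congr 1
    exact Finset.prod_congr rfl fun i hi =>
      hg i _ _ (P.gram_cons t (Finset.mem_range.mp hk) (Finset.ne_of_mem_erase hi))
  rw [Finset.sum_congr rfl h, ← Finset.sum_mul,
    hsum (P.party t) _ (fun k => P.localKraus (k :: t) (P.party t)) _ (P.sum_gram_cons t)]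
  exact Finset.mul_prod_erase Finset.univ (fun i => g i (P.localKraus t i))
    (Finset.mem_univ (P.party t))

theorem Protocol.sum_weight_cons (P : Protocol qutrits) (t : List ℕ) :
    ∑ k ∈ Finset.range (P.outcomes t), weight (P.localKraus (k :: t)) =
      weight (P.localKraus t) :=
  P.sum_prod_cons t (fun _ => frobSq) (fun _ _ _ h => frobSq_congr h)
    fun _ s A _ h => sum_frobSq s A h

theorem Protocol.sum_prod_nsq_cons (P : Protocol qutrits) (t : List ℕ)
    (v : Fin 3 → Fin 3 → ℂ) :
    ∑ k ∈ Finset.range (P.outcomes t), ∏ i, nsq (P.localKraus (k :: t) i *ᵥ v i) =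
      ∏ i, nsq (P.localKraus t i *ᵥ v i) :=
  P.sum_prod_cons t (fun i A => nsq (A *ᵥ v i)) (fun i _ _ h => nsq_mulVec_congr h (v i))
    fun i s A _ h => sum_nsq_mulVec s A h (v i)

theorem Protocol.sum_qop_cons (P : Protocol qutrits) (t : List ℕ) :
    ∑ k ∈ Finset.range (P.outcomes t),
      (tensorOp (P.localKraus (k :: t)))ᴴ * tensorOp (P.localKraus (k :: t)) =
      (tensorOp (P.localKraus t))ᴴ * tensorOp (P.localKraus t) := by
  have : ∀ k, (tensorOp (P.localKraus (k :: t)))ᴴ * tensorOp (P.localKraus (k :: t)) =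
      (tensorOp (P.localKraus t))ᴴ * ((tensorOp (P.op t k))ᴴ * tensorOp (P.op t k)) *
        tensorOp (P.localKraus t) := by
    intro k
    simp only [← Protocol.kraus_eq, Protocol.kraus, Matrix.conjTranspose_mul, Matrix.mul_assoc]
  simp only [this]
  rw [← Finset.sum_mul, ← Finset.mul_sum, P.sum_op, Matrix.mul_one]

theorem Protocol.sum_nsq_cons (P : Protocol qutrits) (t : List ℕ) (χ : StateVec qutrits) :
    ∑ k ∈ Finset.range (P.outcomes t), nsq (tensorOp (P.localKraus (k :: t)) *ᵥ χ) =
      nsq (tensorOp (P.localKraus t) *ᵥ χ) :=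
  sum_nsq_mulVec _ _ (P.sum_qop_cons t) χ

/-! ### The total defect of a protocol -/

/-- The total defect from `φ` of the branches `n` rounds after the history `t`. -/
def Protocol.totalDefect (P : Protocol qutrits) (φ ψ : StateVec qutrits) : ℕ → List ℕ → ℝ
  | 0, t => defect φ (tensorOp (P.localKraus t) *ᵥ ψ)
  | n + 1, t => ∑ k ∈ Finset.range (P.outcomes t), P.totalDefect φ ψ n (k :: t)

theorem Protocol.totalDefect_nonneg (P : Protocol qutrits) (φ ψ : StateVec qutrits) (n : ℕ)
    (t : List ℕ) : 0 ≤ P.totalDefect φ ψ n t := by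
  induction n generalizing t with
  | zero => exact defect_nonneg _ _
  | succ n ih => exact Finset.sum_nonneg fun k _ => ih _

theorem Protocol.sum_totalDefect (P : Protocol qutrits) (φ ψ : StateVec qutrits) (n m : ℕ) :
    ∑ t ∈ P.histories m, P.totalDefect φ ψ n t = P.totalDefect φ ψ (m + n) [] := by
  induction m generalizing n with
  | zero => simp [Protocol.histories]
  | succ m ih =>
    rw [P.sum_histories_succ, Nat.succ_add_eq_add_succ, ← ih]
    rfl

/-- If all factors are well-conditioned the product term alone dominates, otherwise the defect does.
The inequality is put in this form because each of its terms is additive over outcomes, so it can be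
summed up the protocol tree without loss. -/
theorem exists_leaf_bound {a b c : ℂ} (hs : IsSeedParameter a b c) {h : LocalOps qutrits}
    (hu : ∀ i, IsUnit (h i)) :
    ∃ γ > 0, ∃ C > 0, ∀ (K : LocalOps qutrits) (v : Fin 3 → Fin 3 → ℂ),
      γ * nsq (tensorOp K *ᵥ seedState a b c) * ∏ i, nsq (v i) ≤ ∏ i, nsq (K i *ᵥ v i) +
        C * defect (tensorOp h *ᵥ seedState a b c) (tensorOp K *ᵥ seedState a b c) *
          ∏ i, nsq (v i) := by
  obtain ⟨η, hη, κ, hκ, H⟩ := exists_wellConditioned hs hu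
  set ψ := seedState a b c
  have hn : 0 < nsq ψ := nsq_pos.mpr (seedState_ne_zero hs.ne_zero.1)
  refine ⟨κ ^ 3 / nsq ψ, by positivity, κ ^ 3 / nsq ψ / η, by positivity, fun K v => ?_⟩
  have hv : 0 ≤ ∏ i, nsq (v i) := Finset.prod_nonneg fun _ _ => nsq_nonneg _
  have hKv : 0 ≤ ∏ i, nsq (K i *ᵥ v i) := Finset.prod_nonneg fun _ _ => nsq_nonneg _
  have he := defect_nonneg (tensorOp h *ᵥ ψ) (tensorOp K *ᵥ ψ)
  rcases H K with h1 | h1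
  · refine le_trans ?_ (le_add_of_nonneg_left hKv)
    refine mul_le_mul_of_nonneg_right ?_ hv
    rw [div_mul_eq_mul_div _ η, le_div_iff₀ hη, mul_assoc]
    refine mul_le_mul_of_nonneg_left ?_ (by positivity)
    linarith
  · refine le_trans ?_ (le_add_of_nonneg_right (by positivity))
    have h2 : ∏ i, (κ * frobSq (K i) * nsq (v i)) ≤ ∏ i, nsq (K i *ᵥ v i) :=
      Finset.prod_le_prod (fun i _ => mul_nonneg (mul_nonneg hκ.le (frobSq_nonneg _))
        (nsq_nonneg _)) fun i _ => h1 i (v i)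
    rw [Finset.prod_mul_distrib, Finset.prod_mul_distrib, Finset.prod_const, Finset.card_univ,
      Fintype.card_fin] at h2
    refine le_trans (mul_le_mul_of_nonneg_right ?_ hv) h2
    rw [div_mul_eq_mul_div, div_le_iff₀ hn, mul_assoc]
    exact mul_le_mul_of_nonneg_left (nsq_tensorOp_le K ψ) (by positivity)

theorem exists_node_bound {a b c : ℂ} (hs : IsSeedParameter a b c) {h : LocalOps qutrits}
    (hu : ∀ i, IsUnit (h i)) :
    ∃ γ > 0, ∃ C > 0, ∀ (P : Protocol qutrits) (n : ℕ) (t : List ℕ) (v : Fin 3 → Fin 3 → ℂ),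
      γ * nsq (tensorOp (P.localKraus t) *ᵥ seedState a b c) * ∏ i, nsq (v i) ≤
        ∏ i, nsq (P.localKraus t i *ᵥ v i) +
        C * P.totalDefect (tensorOp h *ᵥ seedState a b c) (seedState a b c) n t *
          ∏ i, nsq (v i) := by
  obtain ⟨γ, hγ, C, hC, H⟩ := exists_leaf_bound hs hu
  refine ⟨γ, hγ, C, hC, fun P n t v => ?_⟩
  induction n generalizing t with
  | zero => exact H _ v
  | succ n ih =>
    rw [← P.sum_nsq_cons, ← P.sum_prod_nsq_cons, Protocol.totalDefect, Finset.mul_sum,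
      Finset.sum_mul, Finset.mul_sum, Finset.sum_mul, ← Finset.sum_add_distrib]
    exact Finset.sum_le_sum fun k _ => ih (k :: t)

/-- A vector at an intermediate node need not be near the target, so the leaf criterion does not
apply directly. The summed inequality does: inserting minimizing vectors for the parties other than
`i` isolates the action of party `i`. -/
theorem exists_node_wellConditioned {a b c : ℂ} (hs : IsSeedParameter a b c)
    {h : LocalOps qutrits} (hu : ∀ i, IsUnit (h i)) :
    ∃ θ > 0, ∃ κ > 0, ∀ (P : Protocol qutrits) (n : ℕ) (t : List ℕ),
      θ * nsq (tensorOp (P.localKraus t) *ᵥ seedState a b c) ≤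
        P.totalDefect (tensorOp h *ᵥ seedState a b c) (seedState a b c) n t ∨
      ∀ i, WellConditioned κ (P.localKraus t i) := by
  obtain ⟨γ, hγ, C, hC, H⟩ := exists_node_bound hs hu
  set s := ‖a‖ ^ 2 + ‖b‖ ^ 2 + ‖c‖ ^ 2 with hsdef
  have hspos : 0 < s := by
    have := norm_pos_iff.mpr hs.ne_zero.1
    positivity
  refine ⟨γ / (2 * C), by positivity, γ * s / 2, by positivity, fun P n t => ?_⟩
  rw [or_iff_not_imp_left, not_le]
  intro hlt i v
  set K := P.localKraus t
  set N := nsq (tensorOp K *ᵥ seedState a b c)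
  set e := P.totalDefect (tensorOp h *ᵥ seedState a b c) (seedState a b c) n t
  have hN : 0 < N := pos_of_mul_pos_right ((P.totalDefect_nonneg _ _ n t).trans_lt hlt)
    (by positivity)
  have hCe : C * e ≤ γ / 2 * N := by
    have := mul_le_mul_of_nonneg_left hlt.le hC.le
    calc C * e ≤ C * (γ / (2 * C) * N) := this
      _ = γ / 2 * N := by field_simp
  choose w hw hwmin using fun j => exists_min_mulVec (K j)
  set M := ∏ j ∈ Finset.univ.erase i, nsq (K j *ᵥ w j) with hM
  have hM0 : 0 ≤ M := Finset.prod_nonneg fun _ _ => nsq_nonneg _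
  have key : ∀ v, γ / 2 * N * nsq v ≤ nsq (K i *ᵥ v) * M := by
    intro v
    have h1 := H P n t (Function.update w i v)
    rw [← Finset.mul_prod_erase _ (fun j => nsq (Function.update w i v j)) (Finset.mem_univ i),
      ← Finset.mul_prod_erase _ (fun j => nsq (P.localKraus t j *ᵥ Function.update w i v j))
        (Finset.mem_univ i)] at h1
    have h2 : ∏ j ∈ Finset.univ.erase i, nsq (Function.update w i v j) = 1 :=
      Finset.prod_eq_one fun j hj => by
        rw [Function.update_of_ne (Finset.ne_of_mem_erase hj), hw]
    have h3 : ∏ j ∈ Finset.univ.erase i, nsq (P.localKraus t j *ᵥ Function.update w i v j) = M :=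
      Finset.prod_congr rfl fun j hj => by
        rw [Function.update_of_ne (Finset.ne_of_mem_erase hj)]
    rw [h2, h3, Function.update_self, mul_one] at h1
    have h4 := mul_le_mul_of_nonneg_right hCe (nsq_nonneg v)
    linarith
  have hMpos : 0 < M := by
    refine hM0.lt_of_ne fun h0 => ?_
    have := key (w i)
    rw [← h0, hw, mul_one, mul_zero] at this
    have : 0 < γ / 2 * N := by positivity
    linarith
  -- The same product `M` of smallest singular values bounds `N` from below, so it cancels and
  -- leaves a bound independent of the other parties.
  have hlow : s * frobSq (K i) * M ≤ N :=
    le_nsq_tensorOp_seedState a b c K (fun j => nsq_nonneg (K j *ᵥ w j)) i fun j _ => hwmin j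
  refine le_of_mul_le_mul_right ?_ hMpos
  calc γ * s / 2 * frobSq (K i) * nsq v * M = γ / 2 * (s * frobSq (K i) * M) * nsq v := by ring
    _ ≤ γ / 2 * N * nsq v := mul_le_mul_of_nonneg_right
        (mul_le_mul_of_nonneg_left hlow (by positivity)) (nsq_nonneg v)
    _ ≤ _ := key v

/-! ### Approximation of branch operators by mixtures -/

/-- `Q` differs by at most `B` in every entry from a nonnegative combination of the operators
`T k` with total coefficient `w / 27`. -/
def ApproxMixture (T : Fin 3 × Fin 3 → Op qutrits) (B w : ℝ) (Q : Op qutrits) : Prop :=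
  ∃ p : Fin 3 × Fin 3 → ℝ, (∀ k, 0 ≤ p k) ∧ ∑ k, p k = w / 27 ∧
    ∀ x y, ‖Q x y - ∑ k, (p k : ℂ) * T k x y‖ ≤ B

theorem ApproxMixture.mono {T : Fin 3 × Fin 3 → Op qutrits} {B B' w : ℝ} {Q : Op qutrits}
    (h : ApproxMixture T B w Q) (hB : B ≤ B') : ApproxMixture T B' w Q := by
  obtain ⟨p, h1, h2, h3⟩ := h
  exact ⟨p, h1, h2, fun x y => (h3 x y).trans hB⟩

theorem ApproxMixture.smul {T : Fin 3 × Fin 3 → Op qutrits} {B w : ℝ} {Q : Op qutrits}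
    (h : ApproxMixture T B w Q) {r : ℝ} (hr : 0 ≤ r) :
    ApproxMixture T (r * B) (r * w) ((r : ℂ) • Q) := by
  obtain ⟨p, h1, h2, h3⟩ := h
  refine ⟨fun k => r * p k, fun k => mul_nonneg hr (h1 k), ?_, fun x y => ?_⟩
  · rw [← Finset.mul_sum, h2, mul_div_assoc]
  · have : ((r : ℂ) • Q) x y - ∑ k, ((r * p k : ℝ) : ℂ) * T k x y =
        (r : ℂ) * (Q x y - ∑ k, (p k : ℂ) * T k x y) := by
      rw [mul_sub, Finset.mul_sum, Matrix.smul_apply, smul_eq_mul]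
      congr 1
      refine Finset.sum_congr rfl fun k _ => ?_
      push_cast; ring
    rw [this, norm_mul, Complex.norm_of_nonneg hr]
    exact mul_le_mul_of_nonneg_left (h3 x y) hr

theorem ApproxMixture.sum {T : Fin 3 × Fin 3 → Op qutrits} {ι : Type*} (s : Finset ι)
    {B w : ι → ℝ} {Q : ι → Op qutrits} (h : ∀ i ∈ s, ApproxMixture T (B i) (w i) (Q i)) :
    ApproxMixture T (∑ i ∈ s, B i) (∑ i ∈ s, w i) (∑ i ∈ s, Q i) := by
  choose! p h1 h2 h3 using h
  refine ⟨fun k => ∑ i ∈ s, p i k, fun k => Finset.sum_nonneg fun i hi => h1 i hi k, ?_,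
    fun x y => ?_⟩
  · rw [Finset.sum_comm, Finset.sum_div]
    exact Finset.sum_congr rfl h2
  · have : (∑ i ∈ s, Q i) x y - ∑ k, ((∑ i ∈ s, p i k : ℝ) : ℂ) * T k x y =
        ∑ i ∈ s, (Q i x y - ∑ k, (p i k : ℂ) * T k x y) := by
      rw [Finset.sum_sub_distrib, Matrix.sum_apply, Finset.sum_comm (s := s)]
      simp only [Complex.ofReal_sum, Finset.sum_mul]
    rw [this]
    exact (norm_sum_le _ _).trans (Finset.sum_le_sum fun i hi => h3 i hi x y)

theorem norm_gram_apply_le {m : Type*} [Fintype m] (A : Matrix m m ℂ) (x y : m) :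
    ‖(Aᴴ * A) x y‖ ≤ frobSq A := by
  classical
  have hc : ∀ x, nsq (fun z => A z x) ≤ frobSq A := fun x =>
    Finset.sum_le_sum fun z _ => Finset.single_le_sum (f := fun j => ‖A z j‖ ^ 2)
      (fun _ _ => sq_nonneg _) (Finset.mem_univ x)
  have h := norm_star_dotProduct_sq_le (fun z => A z x) (fun z => A z y)
  have e : (Aᴴ * A) x y = (star fun z => A z x) ⬝ᵥ fun z => A z y := rfl
  rw [← e] at h
  refine abs_le_of_sq_le_sq' (h.trans ?_) (frobSq_nonneg A) |>.2
  rw [sq]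
  exact mul_le_mul (hc y) (hc x) (nsq_nonneg _) (frobSq_nonneg A)

/-- A crude approximation, used where the weight itself is already bounded by the defect. -/
theorem exists_approxMixture_weight (T : Fin 3 × Fin 3 → Op qutrits) :
    ∃ M > 0, ∀ K : LocalOps qutrits,
      ApproxMixture T (M * weight K) (weight K) ((tensorOp K)ᴴ * tensorOp K) := by
  refine ⟨1 + ∑ x, ∑ y, ‖T 0 x y‖, by positivity, fun K => ?_⟩
  have hW := weight_nonneg K
  refine ⟨Pi.single 0 (weight K / 27), fun k => ?_, ?_, fun x y => ?_⟩
  · rw [Pi.single_apply]; split_ifs <;> positivity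
  · simp
  · rw [Finset.sum_eq_single 0 (fun k _ hk => by simp [hk]) (by simp), Pi.single_eq_same]
    refine (norm_sub_le _ _).trans ?_
    rw [add_mul, one_mul]
    refine add_le_add ((norm_gram_apply_le _ x y).trans_eq (frobSq_tensorOp K)) ?_
    rw [norm_mul, Complex.norm_of_nonneg (by positivity), mul_comm]
    have h1 : ‖T 0 x y‖ ≤ ∑ x, ∑ y, ‖T 0 x y‖ :=
      (Finset.single_le_sum (f := fun y => ‖T 0 x y‖) (fun _ _ => norm_nonneg _)
        (Finset.mem_univ y)).trans
      (Finset.single_le_sum (f := fun x => ∑ y, ‖T 0 x y‖)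
        (fun _ _ => Finset.sum_nonneg fun _ _ => norm_nonneg _) (Finset.mem_univ x))
    exact mul_le_mul h1 (by linarith) (by positivity) (by positivity)

theorem WellConditioned.isUnit {κ : ℝ} (hκ : 0 < κ) {A : Matrix (Fin 3) (Fin 3) ℂ}
    (hA : WellConditioned κ A) (hF : 0 < frobSq A) : IsUnit A := by
  rw [Matrix.isUnit_iff_isUnit_det, isUnit_iff_ne_zero]
  intro h0
  obtain ⟨v, hv, hv0⟩ := Matrix.exists_mulVec_eq_zero_iff.mpr h0
  have := hA v
  rw [hv0, nsq_zero] at this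
  have hn := nsq_pos.mpr hv
  have : 0 < κ * frobSq A * nsq v := by positivity
  linarith

/-- The stabilizer element `k`, followed by `h`. -/
def afterPauli (h : LocalOps qutrits) (k : Fin 3 × Fin 3) : LocalOps qutrits :=
  fun i => h i * pauli k

theorem frobSq_mul_pauli (A : Matrix (Fin 3) (Fin 3) ℂ) (k : Fin 3 × Fin 3) :
    frobSq (A * pauli k) = frobSq A := by
  have : (frobSq (A * pauli k) : ℂ) = frobSq A := by
    rw [ofReal_frobSq, ofReal_frobSq, Matrix.conjTranspose_mul, Matrix.mul_assoc,
      Matrix.trace_mul_comm, Matrix.mul_assoc, Matrix.mul_assoc, pauli_mul_conjTranspose,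
      Matrix.mul_one]
  exact_mod_cast this

/-- Zero defect makes `K ψ` a multiple of `h ψ`, so `h⁻¹ K`, suitably rescaled, belongs to the
stabilizer. -/
theorem exists_tensorOp_eq_smul {a b c : ℂ} (hs : IsSeedParameter a b c)
    {h K : LocalOps qutrits} (hh : ∀ i, IsUnit (h i)) (hK : ∀ i, IsUnit (K i))
    (hd : defect (tensorOp h *ᵥ seedState a b c) (tensorOp K *ᵥ seedState a b c) = 0) :
    ∃ (r : ℂ) (k : Fin 3 × Fin 3), tensorOp K = r • tensorOp (afterPauli h k) := by
  have hφ := (fullyEntangled_tensorOp_seedState (b := b) (c := c) hs.ne_zero.1 hh).1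
  have hχ := (fullyEntangled_tensorOp_seedState (b := b) (c := c) hs.ne_zero.1 hK).1
  obtain ⟨r, hr⟩ := exists_eq_smul_of_defect_eq_zero hφ hd
  have hr0 : r ≠ 0 := by
    rintro rfl
    exact hχ (by rw [hr, zero_smul])
  set s : Fin 3 → ℂ := ![r⁻¹, 1, 1] with hsdef
  have hs0 : ∀ i, s i ≠ 0 := by intro i; fin_cases i <;> simp [hsdef, hr0]
  have hprod : ∏ i, s i = r⁻¹ := by simp [hsdef, Fin.prod_univ_three]
  have hhinv : ∀ i, h i * (h i)⁻¹ = 1 := fun i =>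
    Matrix.mul_nonsing_inv _ ((Matrix.isUnit_iff_isUnit_det _).mp (hh i))
  have hhinv' : ∀ i, (h i)⁻¹ * h i = 1 := fun i =>
    Matrix.nonsing_inv_mul _ ((Matrix.isUnit_iff_isUnit_det _).mp (hh i))
  set L : LocalOps qutrits := fun i => s i • ((h i)⁻¹ * K i) with hL
  have hLt : tensorOp L = r⁻¹ • (tensorOp (d := qutrits) (fun i => (h i)⁻¹) * tensorOp K) := by
    rw [hL, tensorOp_smul, hprod, tensorOp_mul]
  have hLu : ∀ i, IsUnit (L i) := fun i =>
    (((Matrix.isUnit_nonsing_inv_iff).mpr (hh i)).mul (hK i)).smul (Units.mk0 _ (hs0 i))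
  have hinv1 : tensorOp (d := qutrits) (fun i => (h i)⁻¹) * tensorOp h = 1 := by
    rw [tensorOp_mul]; simp only [hhinv']; exact tensorOp_one
  have hinv2 : tensorOp h * tensorOp (d := qutrits) (fun i => (h i)⁻¹) = 1 := by
    rw [tensorOp_mul]; simp only [hhinv]; exact tensorOp_one
  have hfix : tensorOp L *ᵥ seedState a b c = seedState a b c := by
    rw [hLt, Matrix.smul_mulVec, ← Matrix.mulVec_mulVec, hr, Matrix.mulVec_smul, smul_smul,
      inv_mul_cancel₀ hr0, one_smul, Matrix.mulVec_mulVec, hinv1, Matrix.one_mulVec]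
  obtain ⟨k, hk⟩ := exists_pauli_of_stabilizes hs hLu hfix
  refine ⟨r, k, ?_⟩
  have e : tensorOp (afterPauli h k) = tensorOp h * tensorOp (d := qutrits) fun _ => pauli k := by
    rw [tensorOp_mul]; rfl
  rw [e, ← hk, hLt, Matrix.mul_smul, ← Matrix.mul_assoc, hinv2, Matrix.one_mul, smul_smul,
    mul_inv_cancel₀ hr0, one_smul]

/-- The operators `S† h† h S` for the stabilizer elements `S`. -/
def mixtureOp (h : LocalOps qutrits) (k : Fin 3 × Fin 3) : Op qutrits :=
  (tensorOp (afterPauli h k))ᴴ * tensorOp (afterPauli h k)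

/-- The scalar is fixed by comparing Frobenius norms: each of the three factors of `h` has squared
norm 3, which gives 27. -/
theorem gram_eq_mixtureOp {a b c : ℂ} (hs : IsSeedParameter a b c)
    {h K : LocalOps qutrits} (hh : ∀ i, IsUnit (h i)) (hh3 : ∀ i, frobSq (h i) = 3)
    (hK : ∀ i, IsUnit (K i)) (hK1 : weight K = 1)
    (hd : defect (tensorOp h *ᵥ seedState a b c) (tensorOp K *ᵥ seedState a b c) = 0) :
    ∃ k, (tensorOp K)ᴴ * tensorOp K = (27 : ℂ)⁻¹ • mixtureOp h k := by
  obtain ⟨r, k, e⟩ := exists_tensorOp_eq_smul hs hh hK hd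
  refine ⟨k, ?_⟩
  have hr : ‖r‖ ^ 2 * 27 = 1 := by
    rw [← hK1, ← frobSq_tensorOp, e, frobSq_smul, frobSq_tensorOp, weight]
    simp only [afterPauli, frobSq_mul_pauli, hh3]
    norm_num
  have hr' : star r * r = (27 : ℂ)⁻¹ := by
    refine eq_inv_of_mul_eq_one_left ?_
    have : star r * r = ((‖r‖ ^ 2 : ℝ) : ℂ) := by
      rw [Complex.ofReal_pow]; exact Complex.conj_mul' r
    rw [this]
    exact_mod_cast hr
  rw [e, Matrix.conjTranspose_smul, Matrix.smul_mul, Matrix.mul_smul, smul_smul, hr', mixtureOp]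

theorem continuous_tensorOp {n : ℕ} {d : Fin n → ℕ} :
    Continuous (tensorOp : LocalOps d → Op d) := by
  refine continuous_matrix fun x y => ?_
  unfold tensorOp
  refine continuous_finsetProd _ fun i _ => ?_
  exact ((continuous_apply i).matrix_elem (x i) (y i))

theorem isCompact_frobSq_pi {n : ℕ} {d : Fin n → ℕ} :
    IsCompact {K : LocalOps d | ∀ i, frobSq (K i) = 1} := by
  have : IsCompact (Set.univ.pi fun i : Fin n =>
      {A : Matrix (Fin (d i)) (Fin (d i)) ℂ | frobSq A = 1}) :=
    isCompact_univ_pi fun _ => isCompact_frobSq_eq_one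
  refine this.of_isClosed_subset ?_ fun K hK i _ => hK i
  rw [Set.ofPred_forall]
  exact isClosed_iInter fun i => isClosed_eq (continuous_frobSq.comp (continuous_apply i))
    continuous_const

theorem exists_unit_smul_localOps {n : ℕ} {d : Fin n → ℕ} {K : LocalOps d} (hK : ∀ i, K i ≠ 0) :
    ∃ (r : Fin n → ℝ) (L : LocalOps d), (∀ i, 0 < r i) ∧ (∀ i, frobSq (L i) = 1) ∧
      K = (fun i => (r i : ℂ) • L i) ∧ weight K = (∏ i, r i) ^ 2 := by
  choose r L hr hL hK' hF using fun i => exists_frob_unit_smul (hK i)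
  refine ⟨r, L, hr, hL, funext hK', ?_⟩
  rw [weight, Finset.prod_congr rfl fun i _ => hF i, Finset.prod_pow]

theorem gram_smul_ofReal {m : Type*} [Fintype m] (r : ℝ) (A : Matrix m m ℂ) :
    ((r : ℂ) • A)ᴴ * ((r : ℂ) • A) = ((r ^ 2 : ℝ) : ℂ) • (Aᴴ * A) := by
  have : star (r : ℂ) = r := Complex.conj_ofReal r
  rw [Matrix.conjTranspose_smul, Matrix.smul_mul, Matrix.mul_smul, smul_smul, this]
  push_cast
  rw [sq]

theorem WellConditioned.smul_iff {κ : ℝ} {r : ℝ} (hr : 0 < r) {A : Matrix (Fin 3) (Fin 3) ℂ} :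
    WellConditioned κ ((r : ℂ) • A) ↔ WellConditioned κ A := by
  refine forall_congr' fun v => ?_
  rw [frobSq_smul, Matrix.smul_mulVec, nsq_smul, Complex.norm_of_nonneg hr.le,
    show κ * (r ^ 2 * frobSq A) * nsq v = r ^ 2 * (κ * frobSq A * nsq v) by ring,
    mul_le_mul_iff_right₀ (by positivity)]

theorem isClosed_wellConditioned (κ : ℝ) :
    IsClosed {A : Matrix (Fin 3) (Fin 3) ℂ | WellConditioned κ A} := by
  simp only [WellConditioned, Set.ofPred_forall]
  refine isClosed_iInter fun v => isClosed_le ?_ ?_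
  · exact (continuous_const.mul continuous_frobSq).mul continuous_const
  · exact continuous_nsq.comp (Continuous.matrix_mulVec continuous_id continuous_const)

theorem norm_apply_sq_le_frobSq {m : Type*} [Fintype m] (A : Matrix m m ℂ) (x y : m) :
    ‖A x y‖ ^ 2 ≤ frobSq A :=
  (Finset.single_le_sum (f := fun j => ‖A x j‖ ^ 2) (fun _ _ => sq_nonneg _)
    (Finset.mem_univ y)).trans
  (Finset.single_le_sum (f := fun x => nsq fun j => A x j) (fun _ _ => nsq_nonneg _)
    (Finset.mem_univ x))

/-- Normalized well-conditioned operators whose Gram operator stays `ε` away from all nine form a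
compact set of invertible operators, on which the defect cannot vanish. There the crude bound is
paid for by the defect; elsewhere a single term of the mixture is within `ε`. -/
theorem exists_leaf_approx {a b c : ℂ} (hs : IsSeedParameter a b c) {h : LocalOps qutrits}
    (hu : ∀ i, IsUnit (h i)) (hh3 : ∀ i, frobSq (h i) = 3) {κ : ℝ} (hκ : 0 < κ) {ε : ℝ}
    (hε : 0 < ε) :
    ∃ C > 0, ∀ K : LocalOps qutrits, (∀ i, WellConditioned κ (K i)) →
      ApproxMixture (mixtureOp h) (ε * weight K +
        C * defect (tensorOp h *ᵥ seedState a b c) (tensorOp K *ᵥ seedState a b c)) (weight K)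
        ((tensorOp K)ᴴ * tensorOp K) := by
  obtain ⟨M, hM, HM⟩ := exists_approxMixture_weight (mixtureOp h)
  set ψ := seedState a b c
  set S : Set (LocalOps qutrits) := {K | (∀ i, frobSq (K i) = 1) ∧
    (∀ i, WellConditioned κ (K i)) ∧
    ∀ k, ε ^ 2 ≤ frobSq ((tensorOp K)ᴴ * tensorOp K - (27 : ℂ)⁻¹ • mixtureOp h k)} with hS
  have hgram : Continuous fun K : LocalOps qutrits => (tensorOp K)ᴴ * tensorOp K :=
    continuous_tensorOp.matrix_conjTranspose.matrix_mul continuous_tensorOp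
  have hScomp : IsCompact S := by
    refine isCompact_frobSq_pi.of_isClosed_subset ?_ fun K hK => hK.1
    have e : S = {K | ∀ i, frobSq (K i) = 1} ∩ ({K | ∀ i, WellConditioned κ (K i)} ∩
      {K | ∀ k, ε ^ 2 ≤ frobSq ((tensorOp K)ᴴ * tensorOp K - (27 : ℂ)⁻¹ • mixtureOp h k)}) := rfl
    rw [e]
    refine isCompact_frobSq_pi.isClosed.inter (IsClosed.inter ?_ ?_)
    · rw [Set.ofPred_forall]
      exact isClosed_iInter fun i => IsClosed.preimage (f := fun K : LocalOps qutrits => K i)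
        (continuous_apply i) (isClosed_wellConditioned κ)
    · rw [Set.ofPred_forall]
      exact isClosed_iInter fun k => isClosed_le continuous_const
        (continuous_frobSq.comp (hgram.sub continuous_const))
  have hdcont : Continuous fun K : LocalOps qutrits =>
      defect (tensorOp h *ᵥ ψ) (tensorOp K *ᵥ ψ) :=
    (continuous_defect _).comp (Continuous.matrix_mulVec continuous_tensorOp continuous_const)
  obtain ⟨m, hm, Hm⟩ := hScomp.exists_pos_le hdcont.continuousOn (by
    rintro K ⟨h1, h2, h3⟩
    refine (defect_nonneg _ _).lt_of_ne fun h0 => ?_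
    obtain ⟨k, hk⟩ := gram_eq_mixtureOp hs hu hh3
      (fun i => (h2 i).isUnit hκ (by rw [h1]; exact one_pos))
      (by rw [weight]; simp [h1]) h0.symm
    have := h3 k
    rw [hk, sub_self, frobSq_eq_zero.mpr rfl] at this
    have : 0 < ε ^ 2 := by positivity
    linarith)
  refine ⟨M / m, by positivity, fun K hK => ?_⟩
  by_cases hK0 : ∀ i, K i ≠ 0
  · obtain ⟨r, L, hr, hL1, rfl, hW⟩ := exists_unit_smul_localOps hK0
    have hLwc : ∀ i, WellConditioned κ (L i) := fun i =>
      (WellConditioned.smul_iff (hr i)).mp (hK i)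
    have hLw : weight L = 1 := by rw [weight]; simp [hL1]
    set R := ∏ i, r i with hR
    have hRpos : 0 < R := Finset.prod_pos fun i _ => hr i
    have hT : tensorOp (d := qutrits) (fun i => (r i : ℂ) • L i) = (R : ℂ) • tensorOp L := by
      rw [tensorOp_smul, hR]; push_cast; rfl
    have hLapprox : ApproxMixture (mixtureOp h)
        (ε + M / m * defect (tensorOp h *ᵥ ψ) (tensorOp L *ᵥ ψ)) 1
        ((tensorOp L)ᴴ * tensorOp L) := by
      have hd0 := defect_nonneg (tensorOp h *ᵥ ψ) (tensorOp L *ᵥ ψ)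
      by_cases hLS : L ∈ S
      · have := HM L
        rw [hLw, mul_one] at this
        refine this.mono (le_add_of_nonneg_of_le hε.le ?_)
        rw [div_mul_eq_mul_div, le_div_iff₀ hm]
        exact mul_le_mul_of_nonneg_left (Hm L hLS) hM.le
      · have : ∃ k, frobSq ((tensorOp L)ᴴ * tensorOp L - (27 : ℂ)⁻¹ • mixtureOp h k) < ε ^ 2 := by
          by_contra! hcon
          exact hLS ⟨hL1, hLwc, hcon⟩
        obtain ⟨k, hk⟩ := this
        refine ApproxMixture.mono (B := ε) ⟨Pi.single k (1 / 27), fun l => ?_, ?_, fun x y => ?_⟩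
          (le_add_of_nonneg_right (by positivity))
        · rw [Pi.single_apply]; split_ifs <;> norm_num
        · simp
        · rw [Finset.sum_eq_single k (fun l _ hl => by simp [hl]) (by simp), Pi.single_eq_same]
          have h1 := (norm_apply_sq_le_frobSq
            ((tensorOp L)ᴴ * tensorOp L - (27 : ℂ)⁻¹ • mixtureOp h k) x y).trans hk.le
          rw [Matrix.sub_apply, Matrix.smul_apply, smul_eq_mul] at h1
          have h2 := abs_le_of_sq_le_sq' h1 hε.le |>.2
          push_cast
          rwa [one_div]
    have := hLapprox.smul (sq_nonneg R)
    rw [hT, hW, gram_smul_ofReal, Matrix.smul_mulVec, defect_smul,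
      Complex.norm_of_nonneg hRpos.le]
    rw [mul_one] at this
    exact this.mono (le_of_eq (by ring))
  · push Not at hK0
    obtain ⟨i, hi⟩ := hK0
    have hW : weight K = 0 := by
      rw [weight]; exact Finset.prod_eq_zero (Finset.mem_univ i) (frobSq_eq_zero.mpr hi)
    have := HM K
    rw [hW, mul_zero] at this
    rw [hW, mul_zero]
    exact this.mono (by have := defect_nonneg (tensorOp h *ᵥ ψ) (tensorOp K *ᵥ ψ); positivity)

/-- If all parties but one are well-conditioned after the history `t`, the branch operator is
close to a mixture, unless the total defect is large. -/
theorem exists_node_approx {a b c : ℂ} (hs : IsSeedParameter a b c) {h : LocalOps qutrits}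
    (hu : ∀ i, IsUnit (h i)) (hh3 : ∀ i, frobSq (h i) = 3) {κ : ℝ} (hκ : 0 < κ) :
    ∀ ε > 0, ∃ C > 0, ∀ (P : Protocol qutrits) (n : ℕ) (t : List ℕ),
      (∃ i, ∀ j, j ≠ i → WellConditioned κ (P.localKraus t j)) →
      ApproxMixture (mixtureOp h) (ε * weight (P.localKraus t) +
        C * P.totalDefect (tensorOp h *ᵥ seedState a b c) (seedState a b c) n t)
        (weight (P.localKraus t))
        ((tensorOp (P.localKraus t))ᴴ * tensorOp (P.localKraus t)) := by
  intro ε hε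
  obtain ⟨θ, hθ, κ', hκ', H⟩ := exists_node_wellConditioned hs hu
  -- Conditioning recovered at a node is thus at least as good as what is assumed at its children,
  -- and the constant does not deteriorate from round to round.
  set κ₀ := min κ κ' with hκ₀
  have hκ₀pos : 0 < κ₀ := lt_min hκ hκ'
  obtain ⟨C, hC, HC⟩ := exists_leaf_approx hs hu hh3 hκ₀pos hε
  obtain ⟨M, hM, HM⟩ := exists_approxMixture_weight (mixtureOp h)
  set s := ‖a‖ ^ 2 + ‖b‖ ^ 2 + ‖c‖ ^ 2 with hsdef
  have hspos : 0 < s := by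
    have := norm_pos_iff.mpr hs.ne_zero.1
    positivity
  set θ' := θ * (s * κ₀ ^ 2) with hθ'
  have hθ'pos : 0 < θ' := by positivity
  refine ⟨max C (M / θ'), lt_max_of_lt_left hC, fun P n t ht => ?_⟩
  replace ht : ∃ i, ∀ j, j ≠ i → WellConditioned κ₀ (P.localKraus t j) :=
    ht.imp fun i hi j hj => (hi j hj).mono (min_le_left _ _)
  -- Either all parties are well-conditioned, or the total defect dominates the norm of the branch.
  -- In the latter case the norm dominates the weight, since only one party is uncontrolled, and the
  -- crude approximation finishes.
  have main : ∀ (n : ℕ) (t : List ℕ),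
      (∃ i, ∀ j, j ≠ i → WellConditioned κ₀ (P.localKraus t j)) →
      (∀ i, WellConditioned κ₀ (P.localKraus t i)) ∨ ApproxMixture (mixtureOp h)
        (ε * weight (P.localKraus t) +
        max C (M / θ') * P.totalDefect (tensorOp h *ᵥ seedState a b c) (seedState a b c) n t)
        (weight (P.localKraus t))
        ((tensorOp (P.localKraus t))ᴴ * tensorOp (P.localKraus t)) := by
    rintro n t ⟨i, hi⟩
    rcases H P n t with h1 | h1
    · right
      have h2 := weight_le_nsq_of_wellConditioned a b c hκ₀pos.le _ i hi
      refine (HM (P.localKraus t)).mono ?_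
      have hW := weight_nonneg (P.localKraus t)
      have he := P.totalDefect_nonneg (tensorOp h *ᵥ seedState a b c) (seedState a b c) n t
      have h3 : θ' * weight (P.localKraus t) ≤
          P.totalDefect (tensorOp h *ᵥ seedState a b c) (seedState a b c) n t := by
        rw [hθ', mul_assoc]
        exact (mul_le_mul_of_nonneg_left h2 hθ.le).trans h1
      calc M * weight (P.localKraus t) = M / θ' * (θ' * weight (P.localKraus t)) := by
            field_simp
        _ ≤ M / θ' * P.totalDefect (tensorOp h *ᵥ seedState a b c) (seedState a b c) n t :=
            mul_le_mul_of_nonneg_left h3 (by positivity)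
        _ ≤ max C (M / θ') * P.totalDefect (tensorOp h *ᵥ seedState a b c)
              (seedState a b c) n t := mul_le_mul_of_nonneg_right (le_max_right _ _) he
        _ ≤ _ := le_add_of_nonneg_left (by positivity)
    · exact Or.inl fun j => (h1 j).mono (min_le_right _ _)
  induction n generalizing t with
  | zero =>
    rcases main 0 t ht with h1 | h1
    · refine (HC _ h1).mono ?_
      gcongr
      · exact defect_nonneg _ _
      · exact le_max_left _ _
      · exact le_rfl
    · exact h1
  | succ n ih =>
    rcases main (n + 1) t ht with h1 | h1
    -- A round leaves the Gram operators of the nonmeasuring parties unchanged, so every child again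
    -- has at most one uncontrolled party, and the approximations at the children add up.
    · have := ApproxMixture.sum (Finset.range (P.outcomes t)) fun k hk => ih (k :: t)
        ⟨P.party t, fun j hj => WellConditioned.congr
          (P.gram_cons t (Finset.mem_range.mp hk) hj).symm (h1 j)⟩
      rw [Finset.sum_add_distrib, ← Finset.mul_sum, ← Finset.mul_sum, P.sum_weight_cons,
        P.sum_qop_cons] at this
      exact this
    · exact h1

/-! ### Pauli coefficients of product operators -/

theorem trace_tensorOp {n : ℕ} {d : Fin n → ℕ} (K : LocalOps d) :
    (tensorOp K).trace = ∏ i, (K i).trace := by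
  simp only [Matrix.trace, Matrix.diag_apply, tensorOp]
  rw [Finset.prod_univ_sum]
  simp

/-- The coefficient of a product operator along a product of generalized Pauli operators. -/
def pauliProdCoef (u : Fin 3 → Fin 3 × Fin 3) (Q : Op qutrits) : ℂ :=
  ((tensorOp (d := qutrits) fun i => pauli (u i))ᴴ * Q).trace

theorem pauliProdCoef_tensorOp (u : Fin 3 → Fin 3 × Fin 3) (K : LocalOps qutrits) :
    pauliProdCoef u (tensorOp K) = ∏ i, pauliCoef (u i) (K i) := by
  rw [pauliProdCoef, tensorOp_conjTranspose, tensorOp_mul, trace_tensorOp]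
  rfl

theorem pauliProdCoef_sum_smul (u : Fin 3 → Fin 3 × Fin 3) (p : Fin 3 × Fin 3 → ℂ)
    (T : Fin 3 × Fin 3 → Op qutrits) :
    pauliProdCoef u (∑ k, p k • T k) = ∑ k, p k * pauliProdCoef u (T k) := by
  simp [pauliProdCoef, Finset.mul_sum, Matrix.trace_sum]

theorem pauliCoef_zero (Q : Matrix (Fin 3) (Fin 3) ℂ) : pauliCoef 0 Q = Q.trace := by
  rw [pauliCoef, pauli_zero, Matrix.conjTranspose_one, Matrix.one_mul]

theorem pauliCoef_one {u : Fin 3 × Fin 3} (hu : u ≠ 0) : pauliCoef u 1 = 0 := by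
  rw [← pauli_zero, pauliCoef_pauli, if_neg hu]

theorem pauliCoef_zero_gram (A : Matrix (Fin 3) (Fin 3) ℂ) :
    pauliCoef 0 (Aᴴ * A) = frobSq A := by
  rw [pauliCoef_zero, ofReal_frobSq]

theorem pauliProdCoef_gram (u : Fin 3 → Fin 3 × Fin 3) (K : LocalOps qutrits) :
    pauliProdCoef u ((tensorOp K)ᴴ * tensorOp K) = ∏ i, pauliCoef (u i) ((K i)ᴴ * K i) := by
  rw [tensorOp_conjTranspose, tensorOp_mul, pauliProdCoef_tensorOp]

theorem pauliProdCoef_mixtureOp (u : Fin 3 → Fin 3 × Fin 3) (h : LocalOps qutrits)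
    (k : Fin 3 × Fin 3) :
    pauliProdCoef u (mixtureOp h k) =
      ∏ i, zeta ((u i).2 * k.1 - k.2 * (u i).1) * pauliCoef (u i) ((h i)ᴴ * h i) := by
  rw [mixtureOp, pauliProdCoef_gram]
  refine Finset.prod_congr rfl fun i _ => ?_
  rw [← pauliCoef_conj, afterPauli, Matrix.conjTranspose_mul]
  simp only [Matrix.mul_assoc]

/-- The symplectic Fourier transform on `(ℤ/3)²`, multiplied by 27. -/
def symplecticFourier (p : Fin 3 × Fin 3 → ℝ) (u : Fin 3 × Fin 3) : ℂ :=
  27 * ∑ k, (p k : ℂ) * zeta (u.2 * k.1 - k.2 * u.1)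

theorem symplecticFourier_neg (p : Fin 3 × Fin 3 → ℝ) (u : Fin 3 × Fin 3) :
    symplecticFourier p (-u) = star (symplecticFourier p u) := by
  rw [symplecticFourier, symplecticFourier, star_mul', star_sum]
  have h27 : star (27 : ℂ) = 27 := by simp
  rw [h27]
  congr 1
  refine Finset.sum_congr rfl fun k _ => ?_
  have hp : star (p k : ℂ) = p k := Complex.conj_ofReal _
  rw [star_mul', hp, ← zeta_neg]
  congr 2
  have : ∀ a b c d : Fin 3, -a * c - d * -b = -(a * c - d * b) := by decide
  exact this _ _ _ _

/-- The pair `(h₁, h₂)` as a triple of local operators. -/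
def pairOps (h₁ h₂ : Matrix (Fin 3) (Fin 3) ℂ) : LocalOps qutrits :=
  ![h₁, h₂, (1 : Matrix (Fin 3) (Fin 3) ℂ)]

/-- In the mixture the coefficient at `(u, v, w)` is that of `h† h` times the Fourier transform at
`u + v + w`, whereas in a product operator it factorizes. Triples with one nonzero label give the
local Gram operators, and `(u, v, 0)` gives multiplicativity. -/
theorem coef_of_gram_eq_mixture {h₁ h₂ : Matrix (Fin 3) (Fin 3) ℂ}
    (g₁ : pauliCoef 0 (h₁ᴴ * h₁) = 3) (g₂ : pauliCoef 0 (h₂ᴴ * h₂) = 3)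
    {K : LocalOps qutrits} (hK : ∀ i, frobSq (K i) = 1) {p : Fin 3 × Fin 3 → ℝ}
    (h : (tensorOp K)ᴴ * tensorOp K = ∑ k, (p k : ℂ) • mixtureOp (pairOps h₁ h₂) k) :
    (∀ u, pauliCoef u ((K 0)ᴴ * K 0) = symplecticFourier p u * pauliCoef u (h₁ᴴ * h₁) / 3) ∧
    (∀ u, pauliCoef u ((K 1)ᴴ * K 1) = symplecticFourier p u * pauliCoef u (h₂ᴴ * h₂) / 3) ∧
    (∀ u, u ≠ 0 → pauliCoef u ((K 2)ᴴ * K 2) = 0) ∧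
    ∀ u v, pauliCoef u (h₁ᴴ * h₁) ≠ 0 → pauliCoef v (h₂ᴴ * h₂) ≠ 0 →
      symplecticFourier p (u + v) = symplecticFourier p u * symplecticFourier p v := by
  have key : ∀ u v w, pauliCoef u ((K 0)ᴴ * K 0) * pauliCoef v ((K 1)ᴴ * K 1) *
      pauliCoef w ((K 2)ᴴ * K 2) = symplecticFourier p (u + v + w) * pauliCoef u (h₁ᴴ * h₁) *
        pauliCoef v (h₂ᴴ * h₂) * pauliCoef w 1 / 27 := by
    intro u v w
    have e := congrArg (pauliProdCoef ![u, v, w]) h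
    rw [pauliProdCoef_gram, pauliProdCoef_sum_smul, Fin.prod_univ_three] at e
    refine e.trans ?_
    rw [symplecticFourier, Finset.mul_sum, Finset.sum_mul, Finset.sum_mul, Finset.sum_mul,
      Finset.sum_div]
    refine Finset.sum_congr rfl fun k _ => ?_
    rw [pauliProdCoef_mixtureOp, Fin.prod_univ_three]
    have hz : zeta ((u + v + w).2 * k.1 - k.2 * (u + v + w).1) =
        zeta (u.2 * k.1 - k.2 * u.1) * zeta (v.2 * k.1 - k.2 * v.1) *
          zeta (w.2 * k.1 - k.2 * w.1) := by
      rw [← zeta_add, ← zeta_add]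
      congr 1
      simp only [Prod.fst_add, Prod.snd_add]
      have e1 : ∀ a b c d x y : Fin 3,
          (a + b) * x - y * (c + d) = a * x - y * c + (b * x - y * d) := by decide
      rw [e1, e1]
    rw [hz]
    have e0 : ((pairOps h₁ h₂ 0)ᴴ * pairOps h₁ h₂ 0) = h₁ᴴ * h₁ := rfl
    have e1 : ((pairOps h₁ h₂ 1)ᴴ * pairOps h₁ h₂ 1) = h₂ᴴ * h₂ := rfl
    have e2 : ((pairOps h₁ h₂ 2)ᴴ * pairOps h₁ h₂ 2) = 1 := by
      show (1 : Matrix (Fin 3) (Fin 3) ℂ)ᴴ * 1 = 1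
      rw [Matrix.conjTranspose_one, Matrix.one_mul]
    rw [e0, e1, e2]
    simp only [Matrix.cons_val_zero, Matrix.cons_val_one, Matrix.cons_val]
    ring
  have hK0 : ∀ i, pauliCoef 0 ((K i)ᴴ * K i) = 1 := by
    intro i; rw [pauliCoef_zero_gram, hK, Complex.ofReal_one]
  have h1 : pauliCoef 0 (1 : Matrix (Fin 3) (Fin 3) ℂ) = 3 := by
    rw [pauliCoef_zero, Matrix.trace_one]; simp
  have k0 : ∀ u, pauliCoef u ((K 0)ᴴ * K 0) =
      symplecticFourier p u * pauliCoef u (h₁ᴴ * h₁) / 3 := by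
    intro u
    have := key u 0 0
    rw [hK0, hK0, g₂, h1, add_zero, add_zero] at this
    linear_combination this
  have k1 : ∀ u, pauliCoef u ((K 1)ᴴ * K 1) =
      symplecticFourier p u * pauliCoef u (h₂ᴴ * h₂) / 3 := by
    intro u
    have := key 0 u 0
    rw [hK0, hK0, g₁, h1, add_zero, zero_add] at this
    linear_combination this
  refine ⟨k0, k1, ?_, ?_⟩
  · intro u hu
    have := key 0 0 u
    rw [hK0, hK0, pauliCoef_one hu] at this
    linear_combination this
  · intro u v hu hv
    have := key u v 0
    rw [hK0, h1, k0, k1, add_zero] at this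
    refine mul_right_cancel₀ (mul_ne_zero hu hv) ?_
    linear_combination -9 * this

/-! ### Operators close to a multiple of a unitary -/

/-- The nontrivial Pauli coefficients of `A† A` are at most `r` times its trace. -/
def NearScalar (r : ℝ) (A : Matrix (Fin 3) (Fin 3) ℂ) : Prop :=
  ∀ u, u ≠ 0 → ‖pauliCoef u (Aᴴ * A)‖ ≤ r * frobSq A

theorem NearScalar.congr {r : ℝ} {A B : Matrix (Fin 3) (Fin 3) ℂ} (h : Aᴴ * A = Bᴴ * B)
    (hA : NearScalar r A) : NearScalar r B := by
  intro u hu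
  rw [← h, ← frobSq_congr h]
  exact hA u hu

theorem nearScalar_one {r : ℝ} (hr : 0 ≤ r) : NearScalar r 1 := by
  intro u hu
  rw [Matrix.conjTranspose_one, Matrix.one_mul, pauliCoef_one hu, norm_zero]
  exact mul_nonneg hr (frobSq_nonneg _)

theorem NearScalar.smul_iff {r s : ℝ} (hs : 0 < s) {A : Matrix (Fin 3) (Fin 3) ℂ} :
    NearScalar r ((s : ℂ) • A) ↔ NearScalar r A := by
  refine forall_congr' fun u => forall_congr' fun _ => ?_
  rw [gram_smul_ofReal, pauliCoef_smul, frobSq_smul, norm_mul,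
    Complex.norm_of_nonneg (sq_nonneg s), Complex.norm_of_nonneg hs.le, mul_left_comm,
    mul_le_mul_iff_right₀ (by positivity)]

theorem nsq_pauli_mulVec (u : Fin 3 × Fin 3) (v : Fin 3 → ℂ) : nsq (pauli u *ᵥ v) = nsq v := by
  have := nsq_mulVec_congr (A := pauli u) (B := (1 : Matrix (Fin 3) (Fin 3) ℂ))
    (by rw [pauli_conjTranspose_mul, Matrix.conjTranspose_one, Matrix.one_mul]) v
  rwa [Matrix.one_mulVec] at this

/-- In the Pauli expansion of three times the Gram operator the identity term contributes the full
trace, and the eight others together at most 8/16 of it; half the trace, divided by 3, gives 1/6. -/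
theorem NearScalar.wellConditioned {r : ℝ} (hr : r ≤ 1 / 16) {A : Matrix (Fin 3) (Fin 3) ℂ}
    (hA : NearScalar r A) : WellConditioned (1 / 6) A := by
  intro v
  set F := frobSq A with hF
  have hF0 : 0 ≤ F := frobSq_nonneg A
  have hv0 := nsq_nonneg v
  have e1 : (3 : ℂ) * nsq (A *ᵥ v) =
      ∑ u, pauliCoef u (Aᴴ * A) * (star v ⬝ᵥ (pauli u *ᵥ v)) := by
    rw [ofReal_nsq_mulVec, ← smul_eq_mul, ← dotProduct_smul, ← Matrix.smul_mulVec,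
      ← sum_pauliCoef_smul, Matrix.sum_mulVec, dotProduct_sum]
    refine Finset.sum_congr rfl fun u _ => ?_
    rw [Matrix.smul_mulVec, dotProduct_smul, smul_eq_mul]
  rw [← Finset.add_sum_erase _ _ (Finset.mem_univ (0 : Fin 3 × Fin 3)), pauli_zero,
    Matrix.one_mulVec, ← ofReal_nsq, pauliCoef_zero_gram] at e1
  have e2 : ‖∑ u ∈ Finset.univ.erase (0 : Fin 3 × Fin 3),
      pauliCoef u (Aᴴ * A) * (star v ⬝ᵥ (pauli u *ᵥ v))‖ ≤ 8 * (r * F * nsq v) := by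
    refine (norm_sum_le _ _).trans ?_
    have : ∀ u ∈ Finset.univ.erase (0 : Fin 3 × Fin 3),
        ‖pauliCoef u (Aᴴ * A) * (star v ⬝ᵥ (pauli u *ᵥ v))‖ ≤ r * F * nsq v := by
      intro u hu
      rw [norm_mul]
      have h1 := norm_star_dotProduct_sq_le v (pauli u *ᵥ v)
      rw [nsq_pauli_mulVec, ← sq] at h1
      exact mul_le_mul (hA u (Finset.ne_of_mem_erase hu)) (abs_le_of_sq_le_sq' h1 hv0).2
        (norm_nonneg _) ((norm_nonneg _).trans (hA u (Finset.ne_of_mem_erase hu)))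
    refine (Finset.sum_le_card_nsmul _ _ _ this).trans_eq ?_
    rw [Finset.card_erase_of_mem (Finset.mem_univ _)]
    simp
  have e3 : ((3 * nsq (A *ᵥ v) - F * nsq v : ℝ) : ℂ) =
      ∑ u ∈ Finset.univ.erase (0 : Fin 3 × Fin 3),
        pauliCoef u (Aᴴ * A) * (star v ⬝ᵥ (pauli u *ᵥ v)) := by
    push_cast; rw [e1]; ring
  rw [← e3, Complex.norm_real, Real.norm_eq_abs] at e2
  have e4 := (abs_le.mp e2).1
  have e5 : r * F * nsq v ≤ 1 / 16 * F * nsq v :=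
    mul_le_mul_of_nonneg_right (mul_le_mul_of_nonneg_right hr hF0) hv0
  linarith

theorem continuous_pauliCoef_gram (u : Fin 3 × Fin 3) :
    Continuous fun A : Matrix (Fin 3) (Fin 3) ℂ => pauliCoef u (Aᴴ * A) :=
  (continuous_const.matrix_mul
    (continuous_id.matrix_conjTranspose.matrix_mul continuous_id)).matrix_trace

theorem isClosed_nearScalar (r : ℝ) :
    IsClosed {A : Matrix (Fin 3) (Fin 3) ℂ | NearScalar r A} := by
  simp only [NearScalar, Set.ofPred_forall]
  exact isClosed_iInter fun u => isClosed_iInter fun _ =>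
    isClosed_le (continuous_pauliCoef_gram u).norm (continuous_const.mul continuous_frobSq)

/-- Moduli of a function that is multiplicative across two pairs of lines of `(ℤ/3)²`. -/
theorem norm_eq_zero_or_one_of_multiplicative {p : Fin 4 → Fin 3 × Fin 3}
    (hp : Pairwise fun i j => (p i).1 * (p j).2 ≠ (p i).2 * (p j).1) {f : Fin 3 × Fin 3 → ℂ}
    (hneg : ∀ u, f (-u) = star (f u))
    (hmul : ∀ u v, (u = p 0 ∨ u = -p 0 ∨ u = p 1 ∨ u = -p 1) →
      (v = p 2 ∨ v = -p 2 ∨ v = p 3 ∨ v = -p 3) → f (u + v) = f u * f v) :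
    (∀ i, ‖f (p i)‖ = 0) ∨ ∀ i, ‖f (p i)‖ = 1 := by
  have hn : ∀ u, ‖f (-u)‖ = ‖f u‖ := fun u => by rw [hneg, norm_star]
  have key : ∀ a b q : Fin 3 × Fin 3, a.1 * b.2 ≠ a.2 * b.1 → a.1 * q.2 ≠ a.2 * q.1 →
      b.1 * q.2 ≠ b.2 * q.1 → q = a + b ∨ q = -(a + b) ∨ q = a + -b ∨ q = -(a + -b) := by
    decide
  -- A sum and a difference of generators of two lines generate the two remaining lines, so the
  -- modulus there is the product. Combining these relations, all four moduli agree and equal their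
  -- own square.
  have main : ∀ i j l : Fin 4, (i = 0 ∨ i = 1) → (j = 2 ∨ j = 3) → l ≠ i → l ≠ j →
      ‖f (p l)‖ = ‖f (p i)‖ * ‖f (p j)‖ := by
    intro i j l hi hj hli hlj
    have hij : i ≠ j := by rcases hi with rfl | rfl <;> rcases hj with rfl | rfl <;> decide
    have h1 : f (p i + p j) = f (p i) * f (p j) :=
      hmul _ _ (by rcases hi with rfl | rfl <;> simp) (by rcases hj with rfl | rfl <;> simp)
    have h2 : f (p i + -p j) = f (p i) * f (-p j) :=
      hmul _ _ (by rcases hi with rfl | rfl <;> simp) (by rcases hj with rfl | rfl <;> simp)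
    rcases key (p i) (p j) (p l) (hp hij) (hp hli.symm) (hp hlj.symm) with e | e | e | e
    · rw [e, h1, norm_mul]
    · rw [e, hn, h1, norm_mul]
    · rw [e, h2, norm_mul, hn]
    · rw [e, hn, h2, norm_mul, hn]
  have a1 := main 0 2 1 (by simp) (by simp) (by decide) (by decide)
  have a3 := main 0 2 3 (by simp) (by simp) (by decide) (by decide)
  have b1 := main 0 3 1 (by simp) (by simp) (by decide) (by decide)
  have b2 := main 0 3 2 (by simp) (by simp) (by decide) (by decide)
  have c0 := main 1 2 0 (by simp) (by simp) (by decide) (by decide)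
  have c3 := main 1 2 3 (by simp) (by simp) (by decide) (by decide)
  have e1 : ‖f (p 3)‖ = ‖f (p 1)‖ := a3.trans a1.symm
  have e2 : ‖f (p 2)‖ = ‖f (p 1)‖ := b2.trans b1.symm
  have e0 : ‖f (p 0)‖ = ‖f (p 1)‖ := (c0.trans c3.symm).trans e1
  rw [e0, e2] at a1
  have : ‖f (p 1)‖ = 0 ∨ ‖f (p 1)‖ = 1 := by
    by_cases h : ‖f (p 1)‖ = 0
    · exact Or.inl h
    · right
      exact mul_left_cancel₀ h (by linarith)
  refine this.imp (fun h i => ?_) fun h i => ?_ <;> fin_cases i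
  · exact e0.trans h
  · exact h
  · exact e2.trans h
  · exact e1.trans h
  · exact e0.trans h
  · exact h
  · exact e2.trans h
  · exact e1.trans h

/-! ### Impossibility of a conversion by local operations and classical communication -/

/-- Party `i` alone is not close to a multiple of a unitary. -/
def OnlyFar (r : ℝ) (K : LocalOps qutrits) (i : Fin 3) : Prop :=
  (∃ u, u ≠ 0 ∧ r * frobSq (K i) ≤ ‖pauliCoef u ((K i)ᴴ * K i)‖) ∧
    ∀ j, j ≠ i → NearScalar r (K j)

/-- If the moduli on the four lines are 0, every local Gram operator is exactly scalar and nobody is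
far; if they are 1, parties 0 and 1 are both far. So no mixture leaves exactly one party far. A
single `mixtureOp` is the case of modulus 1, which is incompatible with all parties being near. -/
theorem IsExamplePair.exists_threshold {h₁ h₂ : Matrix (Fin 3) (Fin 3) ℂ}
    (h : IsExamplePair h₁ h₂) : ∃ r > 0, r ≤ 1 / 16 ∧
      (∀ (K : LocalOps qutrits) (p : Fin 3 × Fin 3 → ℝ), (∀ i, frobSq (K i) = 1) →
        (∃ i, OnlyFar r K i) →
        (tensorOp K)ᴴ * tensorOp K ≠ ∑ k, (p k : ℂ) • mixtureOp (pairOps h₁ h₂) k) ∧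
      ∀ (K : LocalOps qutrits) (k : Fin 3 × Fin 3), (∀ i, frobSq (K i) = 1) →
        (∀ i, NearScalar r (K i)) →
        (tensorOp K)ᴴ * tensorOp K ≠ (27 : ℂ)⁻¹ • mixtureOp (pairOps h₁ h₂) k := by
  obtain ⟨p, hp, g₁, g₂, s₁, s₂⟩ := h.exists_coef
  have hindep : ∀ p q : Fin 3 × Fin 3, p.1 * q.2 ≠ p.2 * q.1 → p ≠ 0 ∧ q ≠ 0 := by decide
  have hp0 : p 0 ≠ 0 := (hindep _ _ (hp (show (0 : Fin 4) ≠ 1 by decide))).1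
  have hp2 : p 2 ≠ 0 := (hindep _ _ (hp (show (2 : Fin 4) ≠ 1 by decide))).1
  have n0 : 0 < ‖pauliCoef (p 0) (h₁ᴴ * h₁)‖ := norm_pos_iff.mpr ((s₁ _).mpr (by simp))
  have n2 : 0 < ‖pauliCoef (p 2) (h₂ᴴ * h₂)‖ := norm_pos_iff.mpr ((s₂ _).mpr (by simp))
  -- At modulus 1 the normalized coefficients have size one third of those of `h₁` and `h₂`, and
  -- half of this keeps the comparison strict. The bound 1/16 guarantees good conditioning.
  set r := min (1 / 16) (min (‖pauliCoef (p 0) (h₁ᴴ * h₁)‖ / 6) (‖pauliCoef (p 2) (h₂ᴴ * h₂)‖ / 6))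
    with hr
  have hrpos : 0 < r := by positivity
  have hr0 : r < ‖pauliCoef (p 0) (h₁ᴴ * h₁)‖ / 3 :=
    ((min_le_right _ _).trans (min_le_left _ _)).trans_lt (by linarith)
  have hr2 : r < ‖pauliCoef (p 2) (h₂ᴴ * h₂)‖ / 3 :=
    ((min_le_right _ _).trans (min_le_right _ _)).trans_lt (by linarith)
  have not_near0 : ∀ (A : Matrix (Fin 3) (Fin 3) ℂ) (z : ℂ), frobSq A = 1 → ‖z‖ = 1 →
      pauliCoef (p 0) (Aᴴ * A) = z * pauliCoef (p 0) (h₁ᴴ * h₁) / 3 → ¬ NearScalar r A := by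
    intro A z hA hz e hnear
    have := hnear _ hp0
    rw [e, norm_div, norm_mul, hz, hA, one_mul, mul_one, show ‖(3 : ℂ)‖ = 3 by simp] at this
    linarith
  have not_near2 : ∀ (A : Matrix (Fin 3) (Fin 3) ℂ) (z : ℂ), frobSq A = 1 → ‖z‖ = 1 →
      pauliCoef (p 2) (Aᴴ * A) = z * pauliCoef (p 2) (h₂ᴴ * h₂) / 3 → ¬ NearScalar r A := by
    intro A z hA hz e hnear
    have := hnear _ hp2
    rw [e, norm_div, norm_mul, hz, hA, one_mul, mul_one, show ‖(3 : ℂ)‖ = 3 by simp] at this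
    linarith
  refine ⟨r, hrpos, min_le_left _ _, ?_, ?_⟩
  · rintro K q hK ⟨i, ⟨u, hu, hfar⟩, hnear⟩ heq
    rw [hK, mul_one] at hfar
    obtain ⟨k0, k1, k2, hmul⟩ := coef_of_gram_eq_mixture g₁ g₂ hK heq
    rcases norm_eq_zero_or_one_of_multiplicative hp (symplecticFourier_neg q)
      (fun a b ha hb => hmul a b ((s₁ a).mpr (Or.inr ha)) ((s₂ b).mpr (Or.inr hb))) with hz | hz
    · have hz' : ∀ j a, (a = p j ∨ a = -p j) → symplecticFourier q a = 0 := by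
        rintro j a (rfl | rfl)
        · exact norm_eq_zero.mp (hz j)
        · rw [symplecticFourier_neg, norm_eq_zero.mp (hz j), star_zero]
      have : pauliCoef u ((K i)ᴴ * K i) = 0 := by
        fin_cases i
        · by_cases hg : pauliCoef u (h₁ᴴ * h₁) = 0
          · exact (k0 u).trans (by rw [hg]; simp)
          · refine (k0 u).trans ?_
            have : symplecticFourier q u = 0 := by
              rcases ((s₁ u).mp hg).resolve_left hu with h | h | h | h
              · exact hz' 0 u (Or.inl h)
              · exact hz' 0 u (Or.inr h)
              · exact hz' 1 u (Or.inl h)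
              · exact hz' 1 u (Or.inr h)
            rw [this]; simp
        · by_cases hg : pauliCoef u (h₂ᴴ * h₂) = 0
          · exact (k1 u).trans (by rw [hg]; simp)
          · refine (k1 u).trans ?_
            have : symplecticFourier q u = 0 := by
              rcases ((s₂ u).mp hg).resolve_left hu with h | h | h | h
              · exact hz' 2 u (Or.inl h)
              · exact hz' 2 u (Or.inr h)
              · exact hz' 3 u (Or.inl h)
              · exact hz' 3 u (Or.inr h)
            rw [this]; simp
        · exact k2 u hu
      rw [this, norm_zero] at hfar
      linarith
    · by_cases hi : i = 0
      · exact not_near2 _ _ (hK 1) (hz 2) (k1 _) (hnear 1 (by rw [hi]; decide))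
      · exact not_near0 _ _ (hK 0) (hz 0) (k0 _) (hnear 0 (Ne.symm hi))
  · intro K k hK hnear heq
    have heq' : (tensorOp K)ᴴ * tensorOp K =
        ∑ l, ((Pi.single k (1 / 27) : Fin 3 × Fin 3 → ℝ) l : ℂ) •
          mixtureOp (pairOps h₁ h₂) l := by
      rw [Finset.sum_eq_single k (fun l _ hl => by simp [hl]) (by simp), Pi.single_eq_same, heq]
      norm_num
    obtain ⟨k0, -⟩ := coef_of_gram_eq_mixture g₁ g₂ hK heq'
    refine not_near0 _ _ (hK 0) ?_ (k0 _) (hnear 0)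
    rw [symplecticFourier, Finset.sum_eq_single k (fun l _ hl => by simp [hl]) (by simp),
      Pi.single_eq_same]
    rw [norm_mul, norm_mul, norm_zeta]
    norm_num

/-- Both near and far are nonstrict inequalities, overlapping at equality, for the sake of this
closedness. -/
theorem isClosed_onlyFar (r : ℝ) : IsClosed {K : LocalOps qutrits | ∃ i, OnlyFar r K i} := by
  have e : {K : LocalOps qutrits | ∃ i, OnlyFar r K i} = ⋃ i : Fin 3, ((⋃ u : {u // u ≠ (0 : Fin 3 × Fin 3)},
      {K : LocalOps qutrits | r * frobSq (K i) ≤ ‖pauliCoef u.1 ((K i)ᴴ * K i)‖}) ∩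
      ⋂ j : {j // j ≠ i}, {K : LocalOps qutrits | NearScalar r (K j.1)}) := by
    ext K
    simp [OnlyFar]
  rw [e]
  refine isClosed_iUnion_of_finite fun i => IsClosed.inter ?_ ?_
  · exact isClosed_iUnion_of_finite fun u => isClosed_le
      (continuous_const.mul (continuous_frobSq.comp (continuous_apply i)))
      ((continuous_pauliCoef_gram u.1).comp
        (continuous_apply (A := fun _ : Fin 3 => Matrix (Fin 3) (Fin 3) ℂ) i)).norm
  · exact isClosed_iInter fun j => IsClosed.preimage (f := fun K : LocalOps qutrits => K j.1)
      (continuous_apply j.1) (isClosed_nearScalar r)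

theorem frobSq_le_of_apply_le {m : Type*} [Fintype m] (A : Matrix m m ℂ) {B : ℝ}
    (hA : ∀ x y, ‖A x y‖ ≤ B) : frobSq A ≤ (Fintype.card m : ℝ) ^ 2 * B ^ 2 := by
  have h1 : ∀ x, nsq (fun y => A x y) ≤ Fintype.card m * B ^ 2 := fun x => by
    refine (Finset.sum_le_card_nsmul _ _ (B ^ 2) fun y _ =>
      pow_le_pow_left₀ (norm_nonneg _) (hA x y) 2).trans_eq ?_
    rw [nsmul_eq_mul, Finset.card_univ]
  refine (Finset.sum_le_card_nsmul _ _ _ fun x _ => h1 x).trans_eq ?_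
  rw [nsmul_eq_mul, Finset.card_univ]
  ring

/-- Normalized operators with one far party, paired with a probability vector, form a compact set,
so exact impossibility becomes a positive distance from all mixtures. -/
theorem exists_weight_le_of_onlyFar {T : Fin 3 × Fin 3 → Op qutrits} {r : ℝ}
    (H : ∀ (K : LocalOps qutrits) (p : Fin 3 × Fin 3 → ℝ), (∀ i, frobSq (K i) = 1) →
        (∃ i, OnlyFar r K i) → (tensorOp K)ᴴ * tensorOp K ≠ ∑ k, (p k : ℂ) • T k) :
    ∃ γ > 0, ∀ (K : LocalOps qutrits) (B : ℝ), (∃ i, OnlyFar r K i) →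
      ApproxMixture T B (weight K) ((tensorOp K)ᴴ * tensorOp K) → γ * weight K ≤ B := by
  set f : LocalOps qutrits × (Fin 3 × Fin 3 → ℝ) → ℝ := fun x =>
    frobSq ((tensorOp x.1)ᴴ * tensorOp x.1 - ∑ k, ((x.2 k / 27 : ℝ) : ℂ) • T k) with hf
  have hfc : Continuous f := by
    refine continuous_frobSq.comp (Continuous.sub ?_ ?_)
    · exact (continuous_tensorOp.comp continuous_fst).matrix_conjTranspose.matrix_mul
        (continuous_tensorOp.comp continuous_fst)
    · refine continuous_finsetSum _ fun k _ => ?_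
      have : Continuous fun x : LocalOps qutrits × (Fin 3 × Fin 3 → ℝ) => ((x.2 k / 27 : ℝ) : ℂ) :=
        Complex.continuous_ofReal.comp (((continuous_apply k).comp continuous_snd).div_const 27)
      exact this.smul (continuous_const (y := T k))
  have hcomp : IsCompact (({K : LocalOps qutrits | ∀ i, frobSq (K i) = 1} ∩
      {K : LocalOps qutrits | ∃ i, OnlyFar r K i}) ×ˢ stdSimplex ℝ (Fin 3 × Fin 3)) :=
    (isCompact_frobSq_pi.inter_right (isClosed_onlyFar r)).prod (isCompact_stdSimplex ℝ _)
  obtain ⟨m, hm, Hm⟩ := hcomp.exists_pos_le hfc.continuousOn (by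
    rintro ⟨K, p⟩ ⟨⟨h1, h2⟩, -⟩
    refine (frobSq_nonneg _).lt_of_ne fun h0 => ?_
    exact H K (fun k => p k / 27) h1 h2 (sub_eq_zero.mp (frobSq_eq_zero.mp h0.symm)))
  refine ⟨Real.sqrt m / 27, by positivity, fun K B hfar happ => ?_⟩
  have hB : 0 ≤ B := by
    obtain ⟨p, -, -, h3⟩ := happ
    exact (norm_nonneg _).trans (h3 0 0)
  by_cases hK0 : ∀ i, K i ≠ 0
  · obtain ⟨s, L, hs, hL1, rfl, hW⟩ := exists_unit_smul_localOps hK0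
    have hLfar : ∃ i, OnlyFar r L i := by
      obtain ⟨i, ⟨u, hu, h1⟩, h2⟩ := hfar
      refine ⟨i, ⟨u, hu, ?_⟩, fun j hj => (NearScalar.smul_iff (hs j)).mp (h2 j hj)⟩
      rw [gram_smul_ofReal, pauliCoef_smul, frobSq_smul, norm_mul,
        Complex.norm_of_nonneg (sq_nonneg (s i)), Complex.norm_of_nonneg (hs i).le,
        mul_left_comm] at h1
      exact le_of_mul_le_mul_left h1 (by have := hs i; positivity)
    set R := ∏ i, s i with hR
    have hRpos : 0 < R := Finset.prod_pos fun i _ => hs i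
    have hT : tensorOp (d := qutrits) (fun i => (s i : ℂ) • L i) = (R : ℂ) • tensorOp L := by
      rw [tensorOp_smul, hR]; push_cast; rfl
    rw [hT, hW, gram_smul_ofReal] at happ
    have happ' := happ.smul (r := (R ^ 2)⁻¹) (by positivity)
    rw [inv_mul_cancel₀ (by positivity), smul_smul, ← Complex.ofReal_mul,
      inv_mul_cancel₀ (by positivity), Complex.ofReal_one, one_smul] at happ'
    obtain ⟨p, h1, h2, h3⟩ := happ'
    have hsimp : (fun k => 27 * p k) ∈ stdSimplex ℝ (Fin 3 × Fin 3) :=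
      ⟨fun k => mul_nonneg (by norm_num) (h1 k), by rw [← Finset.mul_sum, h2]; norm_num⟩
    have h4 := Hm (L, fun k => 27 * p k) ⟨⟨hL1, hLfar⟩, hsimp⟩
    -- Two different 27s occur: the rescaling of the mixing weights to total 1, and the dimension of
    -- the three-qutrit space, which converts an entrywise bound into a Frobenius bound.
    have h5 : f (L, fun k => 27 * p k) ≤ (27 : ℝ) ^ 2 * ((R ^ 2)⁻¹ * B) ^ 2 := by
      have hcard : (Fintype.card (Idx qutrits) : ℝ) = 27 := by
        simp [Idx, qutrits]
      refine (frobSq_le_of_apply_le (B := (R ^ 2)⁻¹ * B) _ fun x y => ?_).trans_eq (by rw [hcard])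
      have e : ((tensorOp L)ᴴ * tensorOp L - ∑ k, ((27 * p k / 27 : ℝ) : ℂ) • T k) x y =
          ((tensorOp L)ᴴ * tensorOp L) x y - ∑ k, (p k : ℂ) * T k x y := by
        rw [Matrix.sub_apply, Matrix.sum_apply]
        congr 1
        refine Finset.sum_congr rfl fun k _ => ?_
        rw [Matrix.smul_apply, smul_eq_mul, mul_div_cancel_left₀ _ (by norm_num : (27 : ℝ) ≠ 0)]
      exact (congrArg norm e).trans_le (h3 x y)
    have h6 : Real.sqrt m ≤ 27 * ((R ^ 2)⁻¹ * B) := by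
      rw [Real.sqrt_le_left (by positivity), mul_pow]
      exact h4.trans h5
    rw [hW]
    calc Real.sqrt m / 27 * R ^ 2 ≤ 27 * ((R ^ 2)⁻¹ * B) / 27 * R ^ 2 := by gcongr
      _ = B := by field_simp
  · push Not at hK0
    obtain ⟨i, hi⟩ := hK0
    have hW : weight K = 0 := by
      rw [weight]; exact Finset.prod_eq_zero (Finset.mem_univ i) (frobSq_eq_zero.mpr hi)
    rw [hW, mul_zero]
    exact hB

/-- Near-scalar normalized factors are invertible, so zero defect would identify the Gram operator
with one that `H` excludes. Compactness makes this uniform. -/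
theorem exists_leaf_nearScalar {a b c : ℂ} (hs : IsSeedParameter a b c) {h : LocalOps qutrits}
    (hu : ∀ i, IsUnit (h i)) (hh3 : ∀ i, frobSq (h i) = 3) {r : ℝ} (hr : r ≤ 1 / 16)
    (H : ∀ (K : LocalOps qutrits) (k : Fin 3 × Fin 3), (∀ i, frobSq (K i) = 1) →
        (∀ i, NearScalar r (K i)) →
        (tensorOp K)ᴴ * tensorOp K ≠ (27 : ℂ)⁻¹ • mixtureOp h k) :
    ∃ γ > 0, ∀ K : LocalOps qutrits, (∀ i, NearScalar r (K i)) →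
      γ * weight K ≤ defect (tensorOp h *ᵥ seedState a b c) (tensorOp K *ᵥ seedState a b c) := by
  set ψ := seedState a b c
  have hdcont : Continuous fun K : LocalOps qutrits =>
      defect (tensorOp h *ᵥ ψ) (tensorOp K *ᵥ ψ) :=
    (continuous_defect _).comp (Continuous.matrix_mulVec continuous_tensorOp continuous_const)
  have hclosed : IsClosed {K : LocalOps qutrits | ∀ i, NearScalar r (K i)} := by
    rw [Set.ofPred_forall]
    exact isClosed_iInter fun i => IsClosed.preimage (f := fun K : LocalOps qutrits => K i)
      (continuous_apply i) (isClosed_nearScalar r)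
  obtain ⟨m, hm, Hm⟩ := (isCompact_frobSq_pi.inter_right hclosed).exists_pos_le
    hdcont.continuousOn (by
      rintro K ⟨h1, h2⟩
      have h1 : ∀ i, frobSq (K i) = 1 := h1
      have h2 : ∀ i, NearScalar r (K i) := h2
      refine (defect_nonneg _ _).lt_of_ne fun h0 => ?_
      obtain ⟨k, hk⟩ := gram_eq_mixtureOp hs hu hh3
        (fun i => ((h2 i).wellConditioned hr).isUnit (by norm_num) (by rw [h1]; exact one_pos))
        (by rw [weight]; simp [h1]) h0.symm
      exact H K k h1 h2 hk)
  refine ⟨m, hm, fun K hK => ?_⟩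
  by_cases hK0 : ∀ i, K i ≠ 0
  · obtain ⟨s, L, hs, hL1, rfl, hW⟩ := exists_unit_smul_localOps hK0
    have h1 := Hm L ⟨hL1, fun i => (NearScalar.smul_iff (hs i)).mp (hK i)⟩
    have hR : 0 < ∏ i, s i := Finset.prod_pos fun i _ => hs i
    have hT : tensorOp (d := qutrits) (fun i => (s i : ℂ) • L i) =
        ((∏ i, s i : ℝ) : ℂ) • tensorOp L := by
      rw [tensorOp_smul]; push_cast; rfl
    rw [hT, hW, Matrix.smul_mulVec, defect_smul, Complex.norm_of_nonneg hR.le, mul_comm]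
    exact mul_le_mul_of_nonneg_left h1 (sq_nonneg _)
  · push Not at hK0
    obtain ⟨i, hi⟩ := hK0
    have hW : weight K = 0 := by
      rw [weight]; exact Finset.prod_eq_zero (Finset.mem_univ i) (frobSq_eq_zero.mpr hi)
    rw [hW, mul_zero]
    exact defect_nonneg _ _

theorem IsExamplePair.frobSq_pairOps {h₁ h₂ : Matrix (Fin 3) (Fin 3) ℂ}
    (h : IsExamplePair h₁ h₂) (i : Fin 3) : frobSq (pairOps h₁ h₂ i) = 3 := by
  obtain ⟨p, -, g₁, g₂, -, -⟩ := h.exists_coef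
  have key : ∀ A : Matrix (Fin 3) (Fin 3) ℂ, pauliCoef 0 (Aᴴ * A) = 3 → frobSq A = 3 := by
    intro A hA
    rw [pauliCoef_zero_gram] at hA
    exact_mod_cast hA
  fin_cases i
  · exact key _ g₁
  · exact key _ g₂
  · refine key _ ?_
    show pauliCoef 0 ((1 : Matrix (Fin 3) (Fin 3) ℂ)ᴴ * 1) = 3
    rw [Matrix.conjTranspose_one, Matrix.one_mul, pauliCoef_zero, Matrix.trace_one]
    simp

/-- Following a branch from the root, either all parties remain near scalar up to the leaf, or there
is a first exit, at which only the measuring party is far. In both cases the defect below is at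
least a fixed fraction of the weight, and the weights at these stopping nodes add up to the weight
of the root. -/
theorem exists_totalDefect_bound {a b c : ℂ} (hs : IsSeedParameter a b c)
    {h₁ h₂ : Matrix (Fin 3) (Fin 3) ℂ} (h : IsExamplePair h₁ h₂) :
    ∃ δ > 0, ∀ (P : Protocol qutrits) (n : ℕ),
      δ ≤ P.totalDefect (applyPair h₁ h₂ (seedState a b c)) (seedState a b c) n [] := by
  obtain ⟨r, hr, hr16, H1, H2⟩ := h.exists_threshold
  have hu : ∀ i, IsUnit (pairOps h₁ h₂ i) := h.isUnit
  obtain ⟨γ₁, hγ₁, F1⟩ := exists_weight_le_of_onlyFar H1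
  obtain ⟨γ₂, hγ₂, F2⟩ := exists_leaf_nearScalar hs hu h.frobSq_pairOps hr16 H2
  -- With precision `γ₁ / 2` the separation `γ₁` at an exit exceeds the approximation error by half
  -- the weight, which the defect has to supply.
  obtain ⟨C, hC, F3⟩ := exists_node_approx hs hu h.frobSq_pairOps (κ := 1 / 6) (by norm_num)
    (γ₁ / 2) (by positivity)
  set φ := tensorOp (pairOps h₁ h₂) *ᵥ seedState a b c with hφ
  have main : ∀ (P : Protocol qutrits) (n : ℕ) (t : List ℕ),
      (∀ i, NearScalar r (P.localKraus t i)) →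
      min γ₂ (γ₁ / (2 * C)) * weight (P.localKraus t) ≤
        P.totalDefect φ (seedState a b c) n t := by
    intro P n
    induction n with
    | zero =>
      intro t ht
      exact (mul_le_mul_of_nonneg_right (min_le_left _ _) (weight_nonneg _)).trans (F2 _ ht)
    | succ n ih =>
      intro t ht
      rw [← P.sum_weight_cons, Finset.mul_sum, Protocol.totalDefect]
      refine Finset.sum_le_sum fun k hk => ?_
      have hnear : ∀ j, j ≠ P.party t → NearScalar r (P.localKraus (k :: t) j) := fun j hj =>
        (ht j).congr (P.gram_cons t (Finset.mem_range.mp hk) hj).symm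
      by_cases hp : NearScalar r (P.localKraus (k :: t) (P.party t))
      · refine ih (k :: t) fun j => ?_
        by_cases hj : j = P.party t
        · rw [hj]; exact hp
        · exact hnear j hj
      · have hfar : OnlyFar r (P.localKraus (k :: t)) (P.party t) := by
          refine ⟨?_, hnear⟩
          simp only [NearScalar, not_forall, not_le] at hp
          obtain ⟨u, hu0, hlt⟩ := hp
          exact ⟨u, hu0, hlt.le⟩
        have h1 := F1 _ _ ⟨_, hfar⟩ (F3 P n (k :: t)
          ⟨P.party t, fun j hj => (hnear j hj).wellConditioned hr16⟩)
        refine (mul_le_mul_of_nonneg_right (min_le_right _ _) (weight_nonneg _)).trans ?_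
        rw [div_mul_eq_mul_div, div_le_iff₀ (by positivity)]
        linarith
  refine ⟨min γ₂ (γ₁ / (2 * C)) * weight (fun _ => (1 : Matrix (Fin 3) (Fin 3) ℂ)),
    mul_pos (by positivity) ?_, fun P n => main P n [] fun i => nearScalar_one hr.le⟩
  refine Finset.prod_pos fun i _ => (frobSq_nonneg _).lt_of_ne' ?_
  exact frobSq_eq_zero.not.mpr one_ne_zero

/-- A linear functional that evaluates the defect from `φ` on density operators. -/
def defectFunctional {n : ℕ} {d : Fin n → ℕ} (φ : StateVec d) (R : Op d) : ℂ :=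
  nsq φ * R.trace - star φ ⬝ᵥ (R *ᵥ φ)

theorem defectFunctional_vecMulVec {n : ℕ} {d : Fin n → ℕ} (φ χ : StateVec d) :
    defectFunctional φ (Matrix.vecMulVec χ (star χ)) = defect φ χ := by
  have h1 : (Matrix.vecMulVec χ (star χ)).trace = nsq χ := by
    rw [← sum_mul_star_eq_trace, ofReal_nsq, dotProduct_comm]; rfl
  have h2 : star φ ⬝ᵥ (Matrix.vecMulVec χ (star χ) *ᵥ φ) = ((‖star φ ⬝ᵥ χ‖ ^ 2 : ℝ) : ℂ) := by
    have e1 : Matrix.vecMulVec χ (star χ) *ᵥ φ = (star χ ⬝ᵥ φ) • χ := by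
      ext x
      simp only [Matrix.mulVec, dotProduct, Matrix.vecMulVec_apply, Pi.smul_apply, smul_eq_mul,
        Finset.sum_mul]
      exact Finset.sum_congr rfl fun y _ => by ring
    rw [e1, dotProduct_smul, smul_eq_mul, Complex.ofReal_pow, Matrix.star_dotProduct χ φ]
    exact Complex.conj_mul' _
  rw [defectFunctional, h1, h2, defect]
  push_cast
  ring

theorem defectFunctional_smul {n : ℕ} {d : Fin n → ℕ} (φ : StateVec d) (r : ℂ) (R : Op d) :
    defectFunctional φ (r • R) = r * defectFunctional φ R := by
  simp only [defectFunctional, Matrix.trace_smul, Matrix.smul_mulVec, dotProduct_smul,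
    smul_eq_mul]
  ring

theorem defectFunctional_sum {n : ℕ} {d : Fin n → ℕ} (φ : StateVec d) {ι : Type*} (s : Finset ι)
    (R : ι → Op d) : defectFunctional φ (∑ i ∈ s, R i) = ∑ i ∈ s, defectFunctional φ (R i) := by
  simp only [defectFunctional, Matrix.trace_sum, Matrix.sum_mulVec, dotProduct_sum,
    Finset.mul_sum, Finset.sum_sub_distrib]

theorem continuous_defectFunctional {n : ℕ} {d : Fin n → ℕ} (φ : StateVec d) :
    Continuous (defectFunctional φ) :=
  (continuous_const.mul continuous_id.matrix_trace).sub
    (continuous_const.dotProduct (Continuous.matrix_mulVec continuous_id continuous_const))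

theorem Protocol.defectFunctional_map (P : Protocol qutrits) (φ ψ : StateVec qutrits) (m : ℕ) :
    defectFunctional φ (P.map m (density ψ)) =
      (nsq ψ : ℂ)⁻¹ * P.totalDefect φ ψ m [] := by
  have hψ : ∑ x, ψ x * star (ψ x) = nsq ψ := by
    rw [ofReal_nsq, dotProduct_comm]; rfl
  have h1 : P.map m (density ψ) = (nsq ψ : ℂ)⁻¹ • ∑ t ∈ P.histories m,
      Matrix.vecMulVec (tensorOp (P.localKraus t) *ᵥ ψ) (star (tensorOp (P.localKraus t) *ᵥ ψ)) := by
    rw [Protocol.map, Finset.smul_sum]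
    refine Finset.sum_congr rfl fun t _ => ?_
    rw [density, hψ, Matrix.mul_smul, Matrix.smul_mul, mul_vecMulVec_conj, P.kraus_eq]
  rw [h1, defectFunctional_smul, defectFunctional_sum]
  simp only [defectFunctional_vecMulVec]
  have h2 := P.sum_totalDefect φ ψ 0 m
  rw [add_zero] at h2
  rw [← h2, Complex.ofReal_sum]
  rfl

/-- `defectFunctional` is continuous in the output and vanishes at the target, yet it is bounded
away from zero uniformly in the number of rounds; so limits are excluded as well. -/
theorem not_convLOCC_applyPair {a b c : ℂ} (hs : IsSeedParameter a b c)
    {h₁ h₂ : Matrix (Fin 3) (Fin 3) ℂ} (h : IsExamplePair h₁ h₂) :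
    ¬ ConvLOCC qutrits (seedState a b c) (applyPair h₁ h₂ (seedState a b c)) := by
  obtain ⟨δ, hδ, H⟩ := exists_totalDefect_bound hs h
  set ψ := seedState a b c
  set φ := applyPair h₁ h₂ ψ
  have hψ : 0 < nsq ψ := nsq_pos.mpr (seedState_ne_zero hs.ne_zero.1)
  have hφ : defectFunctional φ (density φ) = 0 := by
    rw [density, defectFunctional_smul, defectFunctional_vecMulVec,
      show defect φ φ = 0 by simpa using defect_self_smul 1 φ]
    simp
  have hlow : ∀ (P : Protocol qutrits) (m : ℕ),
      (nsq ψ)⁻¹ * δ ≤ ‖defectFunctional φ (P.map m (density ψ))‖ := by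
    intro P m
    rw [P.defectFunctional_map, ← Complex.ofReal_inv, ← Complex.ofReal_mul,
      Complex.norm_of_nonneg (mul_nonneg (by positivity) (P.totalDefect_nonneg _ _ _ _))]
    exact mul_le_mul_of_nonneg_left (H P m) (by positivity)
  have hpos : 0 < (nsq ψ)⁻¹ * δ := by positivity
  rintro (⟨Λ, ⟨P, m, hΛ⟩, heq⟩ | ⟨P, hlim⟩)
  · have := hlow P m
    rw [← hΛ, heq, hφ, norm_zero] at this
    linarith
  · have h1 := (((continuous_defectFunctional φ).norm).tendsto _).comp hlim
    rw [hφ, norm_zero] at h1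
    have := ge_of_tendsto' h1 fun m => hlow P m
    linarith

/-! ### Compactness of convex hulls -/

/-- By Carathéodory's theorem the hull is the continuous image of a simplex times a power of `s`,
with one more point than the dimension. Shorter combinations are padded with zero weights at `z₀`.
-/
theorem isCompact_convexHull_of_finiteDimensional {E : Type*} [AddCommGroup E] [Module ℝ E]
    [TopologicalSpace E] [IsTopologicalAddGroup E] [ContinuousSMul ℝ E] [FiniteDimensional ℝ E]
    {s : Set E} (hs : IsCompact s) : IsCompact (convexHull ℝ s) := by
  rcases s.eq_empty_or_nonempty with rfl | ⟨z₀, hz₀⟩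
  · simp
  set N := Module.finrank ℝ E + 1
  have hcomp : IsCompact (stdSimplex ℝ (Fin N) ×ˢ Set.univ.pi fun _ : Fin N => s) :=
    (isCompact_stdSimplex ℝ _).prod (isCompact_univ_pi fun _ => hs)
  have hcont : Continuous fun x : (Fin N → ℝ) × (Fin N → E) => ∑ i, x.1 i • x.2 i := by
    fun_prop
  convert hcomp.image hcont using 1
  ext x
  constructor
  · intro hx
    obtain ⟨ι, _, z, w, hz, hind, hw, hw1, rfl⟩ := eq_pos_convex_span_of_mem_convexHull hx
    obtain ⟨e⟩ : Nonempty (ι ↪ Fin N) := by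
      refine Function.Embedding.nonempty_of_card_le ?_
      rw [Fintype.card_fin]
      exact hind.card_le_finrank_succ.trans (Nat.succ_le_succ (Submodule.finrank_le _))
    have hout : ∀ i ∉ Set.range e, Function.extend e w 0 i = 0 := fun i hi =>
      Function.extend_apply' _ _ _ hi
    refine ⟨(Function.extend e w 0, Function.extend e z fun _ => z₀), ⟨⟨fun i => ?_, ?_⟩,
      fun i _ => ?_⟩, ?_⟩
    · by_cases hi : i ∈ Set.range e
      · obtain ⟨j, rfl⟩ := hi
        simpa [e.injective.extend_apply] using (hw j).le
      · exact (hout i hi).ge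
    · rw [← hw1]
      exact (Fintype.sum_of_injective e e.injective _ _ hout fun j => by
        simp [e.injective.extend_apply]).symm
    · by_cases hi : i ∈ Set.range e
      · obtain ⟨j, rfl⟩ := hi
        simpa [e.injective.extend_apply] using hz ⟨j, rfl⟩
      · simpa [Function.extend_apply' _ _ _ hi] using hz₀
    · refine (Fintype.sum_of_injective e e.injective _ _ (fun i hi => ?_) fun j => ?_).symm
      · simp [hout i hi]
      · simp [e.injective.extend_apply]
  · rintro ⟨⟨w, z⟩, ⟨⟨hw0, hw1⟩, hz⟩, rfl⟩
    exact (convex_convexHull ℝ s).sum_mem (fun i _ => hw0 i) hw1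
      fun i _ => subset_convexHull ℝ s (hz i trivial)

/-! ### Local operations and classical communication are separable -/

section Separable

variable {n : ℕ} {d : Fin n → ℕ}

theorem IsSEP.of_finset {ι : Type*} (s : Finset ι) (K : ι → LocalOps d)
    (h : ∑ k ∈ s, (tensorOp (K k))ᴴ * tensorOp (K k) = 1) {Λ : Op d → Op d}
    (hΛ : ∀ X, Λ X = ∑ k ∈ s, tensorOp (K k) * X * (tensorOp (K k))ᴴ) : IsSEP d Λ := by
  refine ⟨s.card, fun j => K (s.equivFin.symm j), ?_, fun X => ?_⟩
  · rw [← h, ← Finset.sum_coe_sort s]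
    exact Equiv.sum_comp s.equivFin.symm fun k : s =>
      (tensorOp (K k))ᴴ * tensorOp (K k)
  · rw [hΛ, ← Finset.sum_coe_sort s]
    exact (Equiv.sum_comp s.equivFin.symm fun k : s =>
      tensorOp (K k) * X * (tensorOp (K k))ᴴ).symm

theorem IsLOCCN.isSEP {Λ : Op d → Op d} (h : IsLOCCN d Λ) : IsSEP d Λ := by
  obtain ⟨P, m, hΛ⟩ := h
  refine IsSEP.of_finset (P.histories m) P.localKraus ?_ fun X => ?_
  · simp only [← P.kraus_eq]
    exact P.sum_kraus m
  · simp only [← P.kraus_eq]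
    exact hΛ X

/-- The coefficients of the map `X ↦ A X A†`. -/
def choi (A : Op d) : Idx d → Idx d → Idx d → Idx d → ℂ := fun x y x' y' => A x y * star (A x' y')

theorem choi_smul (r : ℝ) (A : Op d) : choi ((r : ℂ) • A) = (r ^ 2) • choi A := by
  have : star (r : ℂ) = r := Complex.conj_ofReal r
  ext x y x' y'
  simp only [choi, Matrix.smul_apply, smul_eq_mul, star_mul', this, Pi.smul_apply,
    Complex.real_smul]
  push_cast
  ring

theorem continuous_choi : Continuous (choi : Op d → _) := by
  unfold choi
  fun_prop

/-- The map with given coefficients. -/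
def mapOfChoi (C : Idx d → Idx d → Idx d → Idx d → ℂ) (X : Op d) : Op d := fun x x' =>
  ∑ y, ∑ y', C x y x' y' * X y y'

theorem mapOfChoi_choi (A X : Op d) : mapOfChoi (choi A) X = A * X * Aᴴ := by
  ext x x'
  simp only [mapOfChoi, choi, Matrix.mul_apply, Matrix.conjTranspose_apply, Finset.sum_mul]
  rw [Finset.sum_comm]
  exact Finset.sum_congr rfl fun y _ => Finset.sum_congr rfl fun y' _ => by ring

theorem mapOfChoi_sum {ι : Type*} (s : Finset ι) (C : ι → Idx d → Idx d → Idx d → Idx d → ℂ)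
    (X : Op d) : mapOfChoi (∑ k ∈ s, C k) X = ∑ k ∈ s, mapOfChoi (C k) X := by
  ext x x'
  rw [Matrix.sum_apply]
  simp only [mapOfChoi, Finset.sum_apply, Finset.sum_mul]
  exact (Finset.sum_congr rfl fun y _ => Finset.sum_comm).trans Finset.sum_comm

theorem continuous_mapOfChoi (X : Op d) :
    Continuous fun C : Idx d → Idx d → Idx d → Idx d → ℂ => mapOfChoi C X := by
  refine continuous_matrix fun x x' => ?_
  unfold mapOfChoi
  fun_prop

/-- Matrix units recover the coefficients, so pointwise convergence of maps is convergence of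
coefficients. -/
theorem mapOfChoi_single (C : Idx d → Idx d → Idx d → Idx d → ℂ) (x y x' y' : Idx d) :
    mapOfChoi C (Matrix.single y y' 1) x x' = C x y x' y' := by
  simp only [mapOfChoi, Matrix.single_apply]
  rw [Finset.sum_eq_single y, Finset.sum_eq_single y'] <;> simp +contextual [eq_comm]

theorem exists_choi_eq_smul [Nonempty (Idx d)] (K : LocalOps d) :
    ∃ L : LocalOps d, (∀ i, frobSq (L i) = 1) ∧
      choi (tensorOp K) = frobSq (tensorOp K) • choi (tensorOp L) := by
  by_cases hK : ∀ i, K i ≠ 0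
  · obtain ⟨r, L, -, hL, rfl, hW⟩ := exists_unit_smul_localOps hK
    refine ⟨L, hL, ?_⟩
    have hT : tensorOp (fun i => (r i : ℂ) • L i) = ((∏ i, r i : ℝ) : ℂ) • tensorOp L := by
      rw [tensorOp_smul]; push_cast; rfl
    rw [frobSq_tensorOp, hW, hT, choi_smul]
  · push Not at hK
    obtain ⟨i, hi⟩ := hK
    obtain ⟨x₀⟩ := ‹Nonempty (Idx d)›
    have h1 : ∀ i, (1 : Matrix (Fin (d i)) (Fin (d i)) ℂ) ≠ 0 := fun i h0 => by
      have := congrFun (congrFun h0 (x₀ i)) (x₀ i)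
      simp at this
    obtain ⟨-, L, -, hL, -⟩ := exists_unit_smul_localOps h1
    have h0 : frobSq (tensorOp K) = 0 := by
      rw [frobSq_tensorOp, weight]
      exact Finset.prod_eq_zero (Finset.mem_univ i) (frobSq_eq_zero.mpr hi)
    refine ⟨L, hL, ?_⟩
    rw [h0, zero_smul, frobSq_eq_zero.mp h0]
    ext
    simp [choi]

/-- At least one party is required to absorb the scalar; with no parties the only product operator
is the identity. -/
theorem exists_tensorOp_eq_ofReal_smul (hn : 0 < n) (r : ℝ) (K : LocalOps d) :
    ∃ L : LocalOps d, tensorOp L = (r : ℂ) • tensorOp K := by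
  refine ⟨fun i => (if i = ⟨0, hn⟩ then (r : ℂ) else 1) • K i, ?_⟩
  rw [tensorOp_smul, Finset.prod_ite_eq']
  simp

/-- The number of Kraus operators may grow with the rounds, but the coefficient arrays stay in one
compact convex hull. A point of the hull is a finite combination of product arrays, which yields
product Kraus operators for the limit. -/
theorem isSEP_of_tendsto (hn : 0 < n) (P : Protocol d) {Λ : Op d → Op d}
    (h : ∀ X, Filter.Tendsto (fun m => P.map m X) Filter.atTop (nhds (Λ X))) : IsSEP d Λ := by
  rcases isEmpty_or_nonempty (Idx d) with hempty | hne
  · exact ⟨0, Fin.elim0, Subsingleton.elim _ _, fun X => Subsingleton.elim _ _⟩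
  -- The squared Frobenius norms of the Kraus operators sum to that of the identity, so dividing by
  -- `D` makes them convex weights.
  set D : ℝ := frobSq (1 : Op d) with hD
  have hDpos : 0 < D := (frobSq_nonneg _).lt_of_ne' (frobSq_eq_zero.not.mpr one_ne_zero)
  set S : Set (Idx d → Idx d → Idx d → Idx d → ℂ) :=
    (fun L => D • choi (tensorOp L)) '' {L : LocalOps d | ∀ i, frobSq (L i) = 1} with hS
  have hScomp : IsCompact S :=
    isCompact_frobSq_pi.image ((continuous_choi.comp continuous_tensorOp).const_smul D)
  have hclosed : IsClosed (convexHull ℝ S) :=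
    (isCompact_convexHull_of_finiteDimensional hScomp).isClosed
  set C : ℕ → Idx d → Idx d → Idx d → Idx d → ℂ := fun m =>
    ∑ t ∈ P.histories m, choi (tensorOp (P.localKraus t)) with hC
  have hmap : ∀ m X, P.map m X = mapOfChoi (C m) X := by
    intro m X
    rw [hC, mapOfChoi_sum, Protocol.map]
    simp only [mapOfChoi_choi, P.kraus_eq]
  have hmem : ∀ m, C m ∈ convexHull ℝ S := by
    intro m
    choose L hL1 hL2 using fun K : LocalOps d => exists_choi_eq_smul K
    have e : C m = ∑ t ∈ P.histories m, (frobSq (tensorOp (P.localKraus t)) / D) •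
        (D • choi (tensorOp (L (P.localKraus t)))) := by
      refine Finset.sum_congr rfl fun t _ => ?_
      rw [smul_smul, div_mul_cancel₀ _ hDpos.ne', ← hL2]
    rw [e]
    refine (convex_convexHull ℝ S).sum_mem (fun t _ => div_nonneg (frobSq_nonneg _) hDpos.le) ?_
      fun t _ => subset_convexHull ℝ S ⟨_, hL1 _, rfl⟩
    rw [← Finset.sum_div, sum_frobSq (B := (1 : Op d)) _ _ ?_, div_self hDpos.ne']
    rw [Matrix.conjTranspose_one, Matrix.one_mul]
    simp only [← P.kraus_eq]
    exact P.sum_kraus m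
  set C' : Idx d → Idx d → Idx d → Idx d → ℂ := fun x y x' y' =>
    Λ (Matrix.single y y' 1) x x' with hC'
  have hlim : Filter.Tendsto C Filter.atTop (nhds C') := by
    simp only [tendsto_pi_nhds]
    intro x y x' y'
    have h1 := tendsto_pi_nhds.mp (tendsto_pi_nhds.mp (h (Matrix.single y y' 1)) x) x'
    simp only [hmap, mapOfChoi_single] at h1
    exact h1
  have hΛ : ∀ X, Λ X = mapOfChoi C' X := by
    intro X
    refine tendsto_nhds_unique (h X) ?_
    simp only [hmap]
    exact ((continuous_mapOfChoi X).tendsto C').comp hlim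
  have hC'mem := hclosed.mem_of_tendsto hlim (Filter.Eventually.of_forall hmem)
  obtain ⟨ι, _, z, w, hz, -, hw, -, hsum⟩ := eq_pos_convex_span_of_mem_convexHull hC'mem
  choose L hL using fun i => hz ⟨i, rfl⟩
  choose K hK using fun i => exists_tensorOp_eq_ofReal_smul hn (Real.sqrt (w i * D)) (L i)
  have hKz : ∀ i, choi (tensorOp (K i)) = w i • z i := by
    intro i
    rw [hK, choi_smul, Real.sq_sqrt (mul_nonneg (hw i).le hDpos.le), ← (hL i).2, smul_smul]
  have hΛ' : ∀ X, Λ X = ∑ i, tensorOp (K i) * X * (tensorOp (K i))ᴴ := by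
    intro X
    rw [hΛ, ← hsum]
    simp only [← hKz, mapOfChoi_sum, mapOfChoi_choi]
  refine IsSEP.of_finset Finset.univ K ?_ hΛ'
  -- Completeness is recovered by duality from trace preservation, which passes to the limit.
  rw [Matrix.ext_iff_trace_mul_right]
  intro X
  have h1 : (Λ X).trace = X.trace := by
    have h2 : Filter.Tendsto (fun m => (P.map m X).trace) Filter.atTop (nhds (Λ X).trace) :=
      (continuous_id.matrix_trace.tendsto (Λ X)).comp (h X)
    have h3 : ∀ m, (P.map m X).trace = X.trace := fun m =>
      trace_sum_conj _ _ (P.sum_kraus m) X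
    simp only [h3] at h2
    exact (tendsto_nhds_unique h2 tendsto_const_nhds)
  rw [Matrix.one_mul, ← h1, hΛ', Matrix.trace_sum, Finset.sum_mul, Matrix.trace_sum]
  refine Finset.sum_congr rfl fun i _ => ?_
  rw [Matrix.mul_assoc, Matrix.trace_mul_comm]

theorem IsLOCC.isSEP (hn : 0 < n) {Λ : Op d → Op d} (h : IsLOCC d Λ) : IsSEP d Λ := by
  rcases h with h | ⟨P, h⟩
  · exact h.isSEP
  · exact isSEP_of_tendsto hn P h

end Separable

/-! ### Assembly of the theorem -/

theorem mainTheorem6 :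
    (∀ a b c : ℂ, IsSeedParameter a b c →
      (stabilizer (seedState a b c) =
          Set.range (fun p : Fin 3 × Fin 3 => tensorOp (d := qutrits) fun _ => pauli p) ∧
        (stabilizer (seedState a b c)).ncard = 9 ∧
        ∀ S ∈ stabilizer (seedState a b c), S ∈ Matrix.unitaryGroup (Idx qutrits) ℂ) ∧
      ∀ h₁ h₂ : Matrix (Fin 3) (Fin 3) ℂ, IsExamplePair h₁ h₂ →
        FullyEntangled (seedState a b c) ∧
        FullyEntangled (applyPair h₁ h₂ (seedState a b c)) ∧
        ConvSEP₁ qutrits (seedState a b c) (applyPair h₁ h₂ (seedState a b c)) ∧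
        ConvSEP qutrits (seedState a b c) (applyPair h₁ h₂ (seedState a b c)) ∧
        ¬ ConvLOCC qutrits (seedState a b c) (applyPair h₁ h₂ (seedState a b c))) ∧
    (∃ a b c : ℂ, IsSeedParameter a b c) ∧
    (∃ h₁ h₂ : Matrix (Fin 3) (Fin 3) ℂ, IsExamplePair h₁ h₂) ∧
    ¬ SubsetT ConvSEP₁ ConvLOCC ∧
    StrictSubsetT IsLOCC IsSEP ConvLOCC ConvSEP := by
  have conv : ∀ {a b c : ℂ}, IsSeedParameter a b c → ∀ {h₁ h₂ : Matrix (Fin 3) (Fin 3) ℂ},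
      IsExamplePair h₁ h₂ →
        FullyEntangled (seedState a b c) ∧
        FullyEntangled (applyPair h₁ h₂ (seedState a b c)) ∧
        ConvSEP₁ qutrits (seedState a b c) (applyPair h₁ h₂ (seedState a b c)) ∧
        ConvSEP qutrits (seedState a b c) (applyPair h₁ h₂ (seedState a b c)) ∧
        ¬ ConvLOCC qutrits (seedState a b c) (applyPair h₁ h₂ (seedState a b c)) :=
    fun {a b c} hs {_ _} h =>
      ⟨fullyEntangled_seedState hs.ne_zero.1,
        fullyEntangled_tensorOp_seedState hs.ne_zero.1 h.isUnit,
        convSEP₁_applyPair a b c h, (convSEP₁_applyPair a b c h).convSEP,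
        not_convLOCC_applyPair hs h⟩
  obtain ⟨a₀, b₀, c₀, hs₀⟩ := exists_isSeedParameter
  obtain ⟨k₁, k₂, hk⟩ := exists_isExamplePair
  obtain ⟨f₁, f₂, v₁, v₂, v₃⟩ := conv hs₀ hk
  refine ⟨fun a b c hs => ⟨⟨stabilizer_seedState hs, ncard_stabilizer_seedState hs,
    mem_unitaryGroup_of_mem_stabilizer hs⟩, fun _ _ h => conv hs h⟩,
    ⟨a₀, b₀, c₀, hs₀⟩, ⟨k₁, k₂, hk⟩, fun hsub => ?_, fun _ _ hn _ hΛ => hΛ.isSEP hn,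
    3, qutrits, _, _, by norm_num, f₁, f₂, v₂, v₃⟩
  exact v₃ (hsub 3 qutrits (by norm_num) _ _ f₁ f₂ v₁)

end
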